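/- Let $d\ge 1$ and let $\mu$ be a compactly supported finite (positive) Borel measure on $\mathbb R^{d}\times\mathbb R^d$. For $t>0$ and measurable $f,g:\mathbb R^d\to\mathbb C$ put $$L_t(f,g)(x)=\int f(x-ty)\,g(x-tz)\,d\mu(y,z),\qquad L_{\star,t}(f,g)=\sup_{s\in[t,2t]}|L_s(f,g)|,\qquad L_{\rm full}(f,g)=\sup_{t>0}|L_t(f,g)|.$$ Let $\mathfrak B_\star\subset\mathbb R^3$ be the boundedness set: the set of all triples $(1/p,1/q,1/r)$ with $p,q\in[1,\infty]$, $r\in(0,\infty]$ such that $\|L_{\star,1}(f,g)\|_{L^r}\le C\|f\|_{L^p}\|g\|_{L^q}$ for some $C<\infty$ and all $f\in L^p(\mathbb R^d)$, $g\in L^q(\mathbb R^d)$. Write $\tau_yf(x)=f(x-y)$. Suppose that: (i) $\mathfrak B_\star$ has nonempty interior; (ii) for each $(1/p,1/q,1/r)$ in the interior of $\mathfrak B_\star$ there are $\eta_1,\eta_2>0$ and $C<\infty$ such that for all $t>0$, $y_1,y_2\in\mathbb R^d$, $f\in L^p$, $g\in L^q$, $$\big\|L_{\star,t}\big((I-\tau_{y_1})f,(I-\tau_{y_2})g\big)\big\|_{L^r}\le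 C\,t^{d(\frac1r-\frac1p-\frac1q)}\Big(\frac{|y_1|}{t}\Big)^{\eta_1}\Big(\frac{|y_2|}{t}\Big)^{\eta_2}\|f\|_{L^p}\|g\|_{L^q};$$ (iii) there are a constant $C$ and finite exponents $p,q\in[1,\infty)$, $r\in(0,\infty)$ such that for every measurable $t:\mathbb R^d\to[1,2]$ the operator $L_{t(\cdot)}(f,g)(x)=\int f(x-t(x)y)\,g(x-t(x)z)\,d\mu(y,z)$ satisfies $\|L_{t(\cdot)}(f,g)\|_{L^r}\le C\|f\|_{L^p}\|g\|_{L^q}$ for all $f\in L^p$, $g\in L^q$. Let $(1/p,1/q,1/r)$ be in the interior of $\mathfrak B_\star$ with $r\ge p$, $r\ge q$ and $r>1$, and let $r'=r/(r-1)$. Then for $f\in L^p$, $g\in L^q$, for almost every $x$ the integrals $L_t(f,g)(x)$ converge absolutely for all $t>0$, and $L_{\rm full}(f,g)$ is Lebesgue measurable. Moreover, for every $\gamma\in(0,1)$ there is a constant $C$ (independent of $f,g,h$) such that for all $f\in L^p$, $g\in L^q$ and all locally integrable $h$, $$\int_{\mathbb R^d}L_{\rm full}(f,g)(x)\,|h(x)|\,dx\le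 C\,\sup_{\mathcal S}\ \sum_{Q\in\mathcal S}|Q|\,\langle f\rangle_{Q,p}\langle g\rangle_{Q,q}\langle h\rangle_{Q,r'},\qquad \langle\varphi\rangle_{Q,s}=\Big(\frac1{|Q|}\int_Q|\varphi|^s\Big)^{1/s}.$$ The supremum is over all $\gamma$-sparse families $\mathcal S$ of axis-parallel cubes, that is, families such that for each $Q\in\mathcal S$ there is a measurable $F_Q\subseteq Q$ with $|F_Q|\ge\gamma|Q|$, and the sets $F_Q$ are pairwise disjoint. -/

import Mathlib

open MeasureTheory Set
open scoped ENNReal NNReal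

/-- `ℝᵈ` with the Euclidean norm. -/
abbrev Rd (d : ℕ) : Type := EuclideanSpace ℝ (Fin d)

noncomputable section

namespace BilinearSparse

/-- The bilinear convolution with `μ` at scale `t`:
`L_t(f,g)(x) = ∫ f(x - t y) g(x - t z) dμ(y,z)`. -/
def bilinConv {d : ℕ} (μ : Measure (Rd d × Rd d)) (t : ℝ) (f g : Rd d → ℂ) (x : Rd d) : ℂ :=
  ∫ w, f (x - t • w.1) * g (x - t • w.2) ∂μ

/-- The single-scale maximal operator `L_{⋆,t}(f,g)(x) = sup_{s ∈ [t,2t]} |L_s(f,g)(x)|`. -/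
def singleScaleMax {d : ℕ} (μ : Measure (Rd d × Rd d)) (t : ℝ) (f g : Rd d → ℂ)
    (x : Rd d) : ℝ≥0∞ :=
  ⨆ s ∈ Icc t (2 * t), ‖bilinConv μ s f g x‖ₑ

/-- The full maximal operator `L_full(f,g)(x) = sup_{t > 0} |L_t(f,g)(x)|`. -/
def fullMax {d : ℕ} (μ : Measure (Rd d × Rd d)) (f g : Rd d → ℂ) (x : Rd d) : ℝ≥0∞ :=
  ⨆ t ∈ Ioi (0 : ℝ), ‖bilinConv μ t f g x‖ₑ

/-- The linearized operator `L_{t(x)}(f,g)(x) = ∫ f(x - t(x) y) g(x - t(x) z) dμ(y,z)`. -/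
def linearized {d : ℕ} (μ : Measure (Rd d × Rd d)) (t : Rd d → ℝ) (f g : Rd d → ℂ)
    (x : Rd d) : ℂ :=
  bilinConv μ (t x) f g x

/-- `(I - τ_y) f`, where `τ_y f(x) = f(x - y)`. -/
def subTranslate {d : ℕ} (y : Rd d) (f : Rd d → ℂ) (x : Rd d) : ℂ := f x - f (x - y)

/-- `L_{⋆,1}` is bounded from `L^p × L^q` to `L^r`. -/
def SingleScaleBounded {d : ℕ} (μ : Measure (Rd d × Rd d)) (p q r : ℝ≥0∞) : Prop :=
  ∃ C : ℝ≥0, ∀ f g : Rd d → ℂ, MemLp f p volume → MemLp g q volume →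
    eLpNorm (singleScaleMax μ 1 f g) r volume ≤ C * eLpNorm f p volume * eLpNorm g q volume

/-- The boundedness set of `L_{⋆,1}`: the triples `(1/p, 1/q, 1/r)` with `p, q ∈ [1,∞]` and
`r ∈ (0,∞]` for which it is bounded from `L^p × L^q` to `L^r`. -/
def boundednessSet {d : ℕ} (μ : Measure (Rd d × Rd d)) : Set (ℝ × ℝ × ℝ) :=
  {v | ∃ p q r : ℝ≥0∞, 1 ≤ p ∧ 1 ≤ q ∧ 0 < r ∧ SingleScaleBounded μ p q r ∧
    v = ((p⁻¹).toReal, (q⁻¹).toReal, (r⁻¹).toReal)}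

/-- The scaled continuity estimate for `L_{⋆,t}` at the (finite) exponents `p, q, r`. The
constants do not depend on `t`, `y₁`, `y₂`, `f`, `g`. -/
def ContinuityEstimate {d : ℕ} (μ : Measure (Rd d × Rd d)) (p q r : ℝ) : Prop :=
  ∃ η₁ η₂ : ℝ, 0 < η₁ ∧ 0 < η₂ ∧ ∃ C : ℝ≥0,
    ∀ t : ℝ, 0 < t → ∀ y₁ y₂ : Rd d, ∀ f g : Rd d → ℂ,
      MemLp f (ENNReal.ofReal p) volume → MemLp g (ENNReal.ofReal q) volume →
        eLpNorm (singleScaleMax μ t (subTranslate y₁ f) (subTranslate y₂ g))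
            (ENNReal.ofReal r) volume ≤
          C * ENNReal.ofReal
              (t ^ ((d : ℝ) * (1 / r - 1 / p - 1 / q)) * (‖y₁‖ / t) ^ η₁ * (‖y₂‖ / t) ^ η₂) *
            eLpNorm f (ENNReal.ofReal p) volume * eLpNorm g (ENNReal.ofReal q) volume

/-- The operators `L_{t(·)}`, over all measurable `t : ℝᵈ → [1,2]`, are bounded from `L^p × L^q`
to `L^r` with one common constant. -/
def LinearizedUniformlyBounded {d : ℕ} (μ : Measure (Rd d × Rd d)) (p q r : ℝ) : Prop :=
  ∃ C : ℝ≥0, ∀ t : Rd d → ℝ, Measurable t → (∀ x, t x ∈ Icc (1 : ℝ) 2) →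
    ∀ f g : Rd d → ℂ,
      MemLp f (ENNReal.ofReal p) volume → MemLp g (ENNReal.ofReal q) volume →
        eLpNorm (linearized μ t f g) (ENNReal.ofReal r) volume ≤
          C * eLpNorm f (ENNReal.ofReal p) volume * eLpNorm g (ENNReal.ofReal q) volume

/-- A cube in `ℝᵈ` with sides parallel to the axes. -/
structure Cube (d : ℕ) where
  corner : Rd d
  side : ℝ
  side_pos : 0 < side

/-- The points of a (half-open) cube. -/
def Cube.toSet {d : ℕ} (Q : Cube d) : Set (Rd d) :=
  {x | ∀ i, x i ∈ Ico (Q.corner i) (Q.corner i + Q.side)}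

/-- A family `S` of cubes is `γ`-sparse: each `Q ∈ S` has a measurable part `F_Q ⊆ Q` with
`|F_Q| ≥ γ|Q|`, and these parts are pairwise disjoint. -/
def IsSparse {d : ℕ} (γ : ℝ) (S : Set (Cube d)) : Prop :=
  ∃ F : Cube d → Set (Rd d),
    (∀ Q ∈ S, MeasurableSet (F Q) ∧ F Q ⊆ Q.toSet ∧
      ENNReal.ofReal γ * volume Q.toSet ≤ volume (F Q)) ∧
    S.PairwiseDisjoint F

/-- The average `⟨φ⟩_{Q,s} = (|Q|⁻¹ ∫_Q |φ|^s)^{1/s}`. -/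
def cubeAvg {d : ℕ} (φ : Rd d → ℂ) (Q : Cube d) (s : ℝ) : ℝ≥0∞ :=
  ((volume Q.toSet)⁻¹ * ∫⁻ x in Q.toSet, ‖φ x‖ₑ ^ s) ^ (1 / s)

/-- The sparse form `Λ_{S,p,q,s}(f,g,h) = ∑_{Q ∈ S} |Q| ⟨f⟩_{Q,p} ⟨g⟩_{Q,q} ⟨h⟩_{Q,s}`. -/
def sparseForm {d : ℕ} (S : Set (Cube d)) (p q s : ℝ) (f g h : Rd d → ℂ) : ℝ≥0∞ :=
  ∑' Q : S, volume (Q : Cube d).toSet * cubeAvg f Q p * cubeAvg g Q q * cubeAvg h Q s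

end BilinearSparse

end

/-! The proof is a stopping-time argument on shifted dyadic grids. By the one-third trick, every
point `x` and scale `s` have a cube, in one of 2^d grids, that contains all points `x - s y`, `x - s
z` with `(y,z)` in the support of `μ` and has side comparable to `s`. So the full maximal function
is dominated by a sum over the grids of suprema of single-scale maximal functions localized to cubes
(`Grid.localMax`).

In a cube Q, stop at the maximal subcubes on which the p-average of f or the q-average of g exceeds
A times its value on Q. For A = 2/(1-γ) they cover at most (1-γ)|Q|, so their complement in Q serves
as F_Q. The scales of the stopping cubes and below are left to recursion
(`Grid.exists_isSparse_lintegral_le`).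

The scales above the stopping cubes must contribute at most a constant times |Q|⟨f⟩⟨g⟩⟨h⟩
(`Grid.exists_stoppedBound`). Split f = F + a and g = G + b, with F and G averaged over the stopping
cubes. The pair (F,G) is bounded pointwise since `μ` is finite. For the pairs (f,b) and (a,G),
consider the part of the bad function carried by stopping cubes j generations below the current
cube. It has mean zero on these small cubes, hence is an average of differences under translations
of size about 2^(-j) times the side, and the continuity estimate yields a factor 2^(-ηj)
(`OneSidedContinuity.exists_localDecay`). That estimate wants a difference in both arguments; the
other difference is free, because a translation far enough makes the translated function invisible
to the compactly supported `μ` (`ContinuityEstimate.exists_oneSided`). For fixed j the pieces at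
different scales are disjoint, so with r ≥ p and r ≥ q their r-th powers can be summed over all
scales; the sum over j is geometric, and Hölder's inequality brings in h.

Suprema over a continuum of scales are measurable because their superlevel sets are projections of
Borel sets. Absolute convergence comes from truncations of |f| and |g| by monotone convergence. -/

namespace BilinearSparse

open Filter Topology

/-! ### Analytic sets and measurability of suprema over a continuum of scales -/

section Analytic

/-- The set of sequences dominated by `b` in the first `k` coordinates. -/
def boundedUpTo (b : ℕ → ℕ) (k : ℕ) : Set (ℕ → ℕ) := {a | ∀ i < k, a i ≤ b i}

/-- Compactness. Suppose that for each k a sequence dominated by `b` below k is mapped outside U. At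
a given coordinate all but finitely many of these sequences obey `b`, so all lie in one product of
finite sets. A subsequential limit is dominated by `b` everywhere, so its image is in the open set
U, a contradiction. -/
theorem exists_boundedUpTo_subset {X : Type*} [TopologicalSpace X] {φ : (ℕ → ℕ) → X}
    (hφ : Continuous φ) (b : ℕ → ℕ) {U : Set X} (hU : IsOpen U)
    (hsub : φ '' {a | ∀ i, a i ≤ b i} ⊆ U) : ∃ k, φ '' boundedUpTo b k ⊆ U := by
  by_contra! hcon
  have : ∀ k, ∃ a ∈ boundedUpTo b k, φ a ∉ U := fun k => by
    obtain ⟨y, ⟨a, ha, rfl⟩, hy⟩ := Set.not_subset.1 (hcon k)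
    exact ⟨a, ha, hy⟩
  choose a ha haU using this
  set c : ℕ → ℕ := fun i => max (b i) ((Finset.range (i + 1)).sup fun k => a k i)
  have hc : ∀ k, a k ∈ Set.pi univ (fun i => Iic (c i)) := by
    intro k i _
    rcases lt_or_ge i k with h | h
    · exact (ha k i h).trans (le_max_left _ _)
    · exact (Finset.le_sup (f := fun k => a k i)
        (Finset.mem_range.2 (Nat.lt_succ_of_le h))).trans (le_max_right _ _)
  have hcomp : IsCompact (Set.pi univ (fun i => Iic (c i))) :=
    isCompact_univ_pi fun i => (Set.finite_Iic (c i)).isCompact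
  obtain ⟨l, -, ψ, hψ, hl⟩ := hcomp.tendsto_subseq hc
  have hlb : l ∈ {a : ℕ → ℕ | ∀ i, a i ≤ b i} := by
    intro i
    have h1 : Tendsto (fun n => a (ψ n) i) atTop (𝓝 (l i)) := (tendsto_pi_nhds.1 hl) i
    refine le_of_tendsto h1 ?_
    filter_upwards [eventually_gt_atTop i] with n hn
    exact ha (ψ n) i (hn.trans_le (hψ.id_le n))
  have h2 : Tendsto (fun n => φ (a (ψ n))) atTop (𝓝 (φ l)) := (hφ.tendsto l).comp hl
  have h3 : φ l ∈ U := hsub ⟨l, hlb, rfl⟩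
  obtain ⟨n, hn⟩ := (h2.eventually (hU.mem_nhds h3)).exists
  exact haU _ hn

/-- Choquet's capacitability argument: bound the coordinates one at a time, each time losing so
little that the outer measure of the image stays above c. The image of the resulting compact box is
K; an open set around K of measure below c would already contain the image of a finite stage. -/
theorem exists_isCompact_lt_of_continuous {X : Type*} [TopologicalSpace X] [MeasurableSpace X]
    (ν : Measure X) [ν.OuterRegular] {φ : (ℕ → ℕ) → X}
    (hφ : Continuous φ) {c : ℝ≥0∞} (hc : c < ν (range φ)) :
    ∃ K ⊆ range φ, IsCompact K ∧ c ≤ ν K := by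
  have step : ∀ (b : ℕ → ℕ) (k : ℕ), c < ν (φ '' boundedUpTo b k) →
      ∃ m, c < ν (φ '' boundedUpTo (Function.update b k m) (k + 1)) := by
    intro b k h
    have hU : φ '' boundedUpTo b k =
        ⋃ m, φ '' boundedUpTo (Function.update b k m) (k + 1) := by
      rw [← image_iUnion]
      congr 1
      ext a
      simp only [boundedUpTo, mem_ofPred_eq, mem_iUnion]
      constructor
      · intro h
        refine ⟨a k, fun i hi => ?_⟩
        rcases Nat.lt_succ_iff_lt_or_eq.1 hi with h' | rfl
        · rw [Function.update_of_ne h'.ne]; exact h i h'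
        · simp
      · rintro ⟨m, hm⟩ i hi
        have := hm i (hi.trans (Nat.lt_succ_self k))
        rwa [Function.update_of_ne hi.ne] at this
    have hmono : Monotone fun m => φ '' boundedUpTo (Function.update b k m) (k + 1) := by
      intro m m' hm
      refine image_mono fun a ha i hi => (ha i hi).trans ?_
      rcases eq_or_ne i k with rfl | h'
      · simpa using hm
      · simp [Function.update_of_ne h']
    -- Continuity from below along increasing unions holds for arbitrary sets, so the images need
    -- not be measurable.
    rw [hU, hmono.measure_iUnion] at h
    exact lt_iSup_iff.1 h
  have h0 : c < ν (φ '' boundedUpTo (fun _ => 0) 0) := by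
    have : boundedUpTo (fun _ => 0) 0 = univ := by ext; simp [boundedUpTo]
    rwa [this, image_univ]
  choose! m hm using step
  let B : ℕ → ℕ → ℕ := fun k =>
    Nat.rec (fun _ => 0) (fun k b => Function.update b k (m b k)) k
  have hB : ∀ k, c < ν (φ '' boundedUpTo (B k) k) := by
    intro k
    induction k with
    | zero => exact h0
    | succ k ih => exact hm _ _ ih
  set b : ℕ → ℕ := fun i => B (i + 1) i
  have hBb : ∀ k i, i < k → B k i = b i := by
    intro k i hik
    induction k, Nat.succ_le_of_lt hik using Nat.le_induction with
    | base => rfl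
    | succ k hk ih =>
      have : B (k + 1) i = B k i := Function.update_of_ne (Nat.lt_of_succ_le hk).ne _ _
      rw [this]; exact ih hk
  have hb : ∀ k, boundedUpTo (B k) k = boundedUpTo b k := by
    intro k
    ext a
    exact forall₂_congr fun i hi => by rw [hBb k i hi]
  have hC : IsCompact {a : ℕ → ℕ | ∀ i, a i ≤ b i} := by
    have : {a : ℕ → ℕ | ∀ i, a i ≤ b i} = Set.pi univ (fun i => Iic (b i)) := by
      ext; simp [Pi.le_def]
    rw [this]
    exact isCompact_univ_pi fun i => (Set.finite_Iic (b i)).isCompact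
  refine ⟨φ '' {a | ∀ i, a i ≤ b i}, image_subset_range _ _, hC.image hφ, ?_⟩
  by_contra! hlt
  obtain ⟨U, hKU, hUo, hUc⟩ := Set.exists_isOpen_lt_of_lt _ _ hlt
  obtain ⟨k, hk⟩ := exists_boundedUpTo_subset hφ b hUo hKU
  have := hB k
  rw [hb k] at this
  exact absurd (this.trans_le (measure_mono hk)) hUc.not_gt

theorem nullMeasurableSet_of_analyticSet {X : Type*} [TopologicalSpace X] [T2Space X]
    [MeasurableSpace X] [OpensMeasurableSpace X] (ν : Measure X) [IsFiniteMeasure ν]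
    [ν.OuterRegular] {s : Set X} (hs : AnalyticSet s) :
    NullMeasurableSet s ν := by
  rw [AnalyticSet] at hs
  rcases hs with rfl | ⟨φ, hφ, rfl⟩
  · exact nullMeasurableSet_empty
  rcases eq_or_ne (ν (range φ)) 0 with h0 | h0
  · exact NullMeasurableSet.of_null h0
  obtain ⟨u, -, hu, hul⟩ := exists_seq_strictMono_tendsto' (pos_iff_ne_zero.2 h0)
  have : ∀ n, ∃ K ⊆ range φ, IsCompact K ∧ u n ≤ ν K := fun n =>
    exists_isCompact_lt_of_continuous ν hφ (hu n).2
  choose K hKs hKc hK using this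
  have hsub : (⋃ n, K n) ⊆ range φ := iUnion_subset hKs
  have hle : ν (range φ) ≤ ν (⋃ n, K n) :=
    le_of_tendsto' hul fun n => (hK n).trans (measure_mono (subset_iUnion K n))
  have hmeas : MeasurableSet (⋃ n, K n) := .iUnion fun n => (hKc n).measurableSet
  exact ⟨_, hmeas, (ae_eq_of_subset_of_measure_ge hsub hle hmeas.nullMeasurableSet
    (measure_ne_top _ _)).symm⟩

/-- The supremum of a Borel function over a parameter in a Borel set is universally measurable. -/
theorem aemeasurable_biSup_of_measurable {X : Type*} [TopologicalSpace X] [PolishSpace X]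
    [MeasurableSpace X] [BorelSpace X] (ν : Measure X) [SFinite ν] {Φ : X × ℝ → ℝ≥0∞}
    (hΦ : Measurable Φ) {B : Set ℝ} (hB : MeasurableSet B) :
    AEMeasurable (fun x => ⨆ s ∈ B, Φ (x, s)) ν := by
  wlog hfin : IsFiniteMeasure ν generalizing ν
  · exact (this ν.toFinite inferInstance).mono_ac (absolutelyContinuous_toFinite ν)
  let _ := TopologicalSpace.upgradeIsCompletelyMetrizable X
  refine NullMeasurable.aemeasurable (m0 := inferInstance) ?_
  refine measurable_of_Ioi (α := ℝ≥0∞) (δ := NullMeasurableSpace X ν) fun a => ?_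
  change NullMeasurableSet ((fun x : X => ⨆ s ∈ B, Φ (x, s)) ⁻¹' Ioi a) ν
  -- The supremum exceeds a exactly when some parameter does: a projection of a Borel set, hence
  -- analytic.
  have : (fun x => ⨆ s ∈ B, Φ (x, s)) ⁻¹' Ioi a =
      Prod.fst '' ({z : X × ℝ | z.2 ∈ B} ∩ {z | a < Φ z}) := by
    ext x
    simp [lt_iSup_iff]
  rw [this]
  refine nullMeasurableSet_of_analyticSet ν (AnalyticSet.image_of_continuous ?_ continuous_fst)
  exact ((measurable_snd hB).inter (measurableSet_lt measurable_const hΦ)).analyticSet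

end Analytic

end BilinearSparse

/-! ### Positive averages, truncation, and the single-scale bound for them -/

namespace BilinearSparse

open Filter Topology

section Basic

variable {d : ℕ}

/-- The positive bilinear average `∫ F(x - s y) G(x - s z) dμ(y,z)` of nonnegative functions. -/
noncomputable def posConv (μ : Measure (Rd d × Rd d)) (s : ℝ) (F G : Rd d → ℝ≥0∞) (x : Rd d) :
    ℝ≥0∞ :=
  ∫⁻ w, F (x - s • w.1) * G (x - s • w.2) ∂μ

theorem measurable_posConv (μ : Measure (Rd d × Rd d)) [SFinite μ] {F G : Rd d → ℝ≥0∞}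
    (hF : Measurable F) (hG : Measurable G) :
    Measurable fun z : Rd d × ℝ => posConv μ z.2 F G z.1 := by
  refine Measurable.lintegral_prod_right'
    (f := fun z : (Rd d × ℝ) × (Rd d × Rd d) =>
      F (z.1.1 - z.1.2 • z.2.1) * G (z.1.1 - z.1.2 • z.2.2)) ?_
  exact (hF.comp (by fun_prop)).mul (hG.comp (by fun_prop))

theorem measurable_posConv_right (μ : Measure (Rd d × Rd d)) [SFinite μ] {F G : Rd d → ℝ≥0∞}
    (hF : Measurable F) (hG : Measurable G) (x : Rd d) (s : ℝ) :
    Measurable fun w : Rd d × Rd d => F (x - s • w.1) * G (x - s • w.2) :=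
  (hF.comp (by fun_prop)).mul (hG.comp (by fun_prop))

theorem posConv_mono (μ : Measure (Rd d × Rd d)) {F F' G G' : Rd d → ℝ≥0∞} (hF : F ≤ F')
    (hG : G ≤ G') (s : ℝ) (x : Rd d) : posConv μ s F G x ≤ posConv μ s F' G' x :=
  lintegral_mono fun _ => mul_le_mul' (hF _) (hG _)

theorem enorm_bilinConv_le (μ : Measure (Rd d × Rd d)) (s : ℝ) (f g : Rd d → ℂ) (x : Rd d) :
    ‖bilinConv μ s f g x‖ₑ ≤ posConv μ s (fun x => ‖f x‖ₑ) (fun x => ‖g x‖ₑ) x := by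
  refine (enorm_integral_le_lintegral_enorm _).trans (le_of_eq ?_)
  simp [posConv]

/-- Bounded Borel functions with bounded support. -/
structure IsNice (f : Rd d → ℂ) : Prop where
  measurable : Measurable f
  exists_bound : ∃ C : ℝ, ∀ x, ‖f x‖ ≤ C
  exists_support : ∃ R : ℝ, ∀ x, f x ≠ 0 → ‖x‖ ≤ R

theorem IsNice.memLp {f : Rd d → ℂ} (hf : IsNice f) (p : ℝ≥0∞) : MemLp f p volume := by
  obtain ⟨C, hC⟩ := hf.exists_bound
  obtain ⟨R, hR⟩ := hf.exists_support
  have h : MemLp ((Metric.closedBall (0 : Rd d) R).indicator fun _ => C) p volume :=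
    memLp_indicator_const p measurableSet_closedBall C (Or.inr measure_closedBall_lt_top.ne)
  refine h.mono hf.measurable.aestronglyMeasurable (ae_of_all _ fun x => ?_)
  by_cases hx : f x = 0
  · simp [hx]
  · rw [indicator_of_mem (by simpa using hR x hx)]
    exact (hC x).trans (le_abs_self C)

theorem IsNice.integrable {f : Rd d → ℂ} (hf : IsNice f) : Integrable f volume :=
  memLp_one_iff_integrable.1 (hf.memLp 1)

theorem IsNice.of_le {f g : Rd d → ℂ} (hf : IsNice f) (hg : Measurable g)
    (h : ∀ x, ‖g x‖ ≤ ‖f x‖) : IsNice g where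
  measurable := hg
  exists_bound := hf.exists_bound.imp fun _ hC x => (h x).trans (hC x)
  exists_support := hf.exists_support.imp fun _ hR x hx => hR x fun h0 => hx <| by
    simpa [h0] using h x

theorem IsNice.add {f g : Rd d → ℂ} (hf : IsNice f) (hg : IsNice g) :
    IsNice fun x => f x + g x where
  measurable := hf.measurable.add hg.measurable
  exists_bound := by
    obtain ⟨C, hC⟩ := hf.exists_bound
    obtain ⟨D, hD⟩ := hg.exists_bound
    exact ⟨C + D, fun x => (norm_add_le _ _).trans (add_le_add (hC x) (hD x))⟩
  exists_support := by
    obtain ⟨R, hR⟩ := hf.exists_support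
    obtain ⟨S, hS⟩ := hg.exists_support
    refine ⟨max R S, fun x hx => ?_⟩
    by_cases h : f x = 0
    · exact (hS x fun h' => hx (by simp [h, h'])).trans (le_max_right _ _)
    · exact (hR x h).trans (le_max_left _ _)

theorem IsNice.indicator {f : Rd d → ℂ} (hf : IsNice f) {s : Set (Rd d)}
    (hs : MeasurableSet s) : IsNice (s.indicator f) :=
  hf.of_le (hf.measurable.indicator hs) fun x => norm_indicator_le_norm_self f x

theorem IsNice.integrable_mul {f g : Rd d → ℂ} (hf : IsNice f) (hg : IsNice g)
    (μ : Measure (Rd d × Rd d)) [IsFiniteMeasure μ] (s : ℝ) (x : Rd d) :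
    Integrable (fun w : Rd d × Rd d => f (x - s • w.1) * g (x - s • w.2)) μ := by
  obtain ⟨C, hC⟩ := hf.exists_bound
  obtain ⟨D, hD⟩ := hg.exists_bound
  refine Integrable.of_bound (C := C * D) ?_ (ae_of_all _ fun w => ?_)
  · exact ((hf.measurable.comp (by fun_prop)).mul
      (hg.measurable.comp (by fun_prop))).aestronglyMeasurable
  · rw [norm_mul]
    exact mul_le_mul (hC _) (hD _) (norm_nonneg _) ((norm_nonneg _).trans (hC 0))

/-- Bridge between the Bochner integral in the hypotheses and the positive average, which makes
sense for all functions. Niceness gives integrability, so the default value 0 of the Bochner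
integral does not intervene. -/
theorem enorm_bilinConv_of_nonneg (μ : Measure (Rd d × Rd d)) [IsFiniteMeasure μ]
    {f g : Rd d → ℂ} (hf : IsNice f) (hg : IsNice g) (hf0 : ∀ x, f x = (‖f x‖ : ℂ))
    (hg0 : ∀ x, g x = (‖g x‖ : ℂ)) (s : ℝ) (x : Rd d) :
    ‖bilinConv μ s f g x‖ₑ = posConv μ s (fun x => ‖f x‖ₑ) (fun x => ‖g x‖ₑ) x := by
  have h1 : bilinConv μ s f g x =
      ((∫ w, ‖f (x - s • w.1) * g (x - s • w.2)‖ ∂μ : ℝ) : ℂ) := by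
    rw [bilinConv, ← integral_complex_ofReal]
    refine integral_congr_ae (ae_of_all _ fun w => ?_)
    simp only [norm_mul, Complex.ofReal_mul, ← hf0, ← hg0]
  have h2 : 0 ≤ ∫ w, ‖f (x - s • w.1) * g (x - s • w.2)‖ ∂μ :=
    integral_nonneg fun _ => norm_nonneg _
  rw [h1, ← ofReal_norm, Complex.norm_real, Real.norm_of_nonneg h2,
    ofReal_integral_norm_eq_lintegral_enorm (hf.integrable_mul hg μ s x)]
  simp [posConv]

/-- The truncation of `|f|` to height and radius `J`. -/
noncomputable def trunc (J : ℕ) (f : Rd d → ℂ) : Rd d → ℂ :=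
  {x | ‖f x‖ ≤ J ∧ ‖x‖ ≤ J}.indicator fun x => (‖f x‖ : ℂ)

theorem isNice_trunc (J : ℕ) {f : Rd d → ℂ} (hf : Measurable f) : IsNice (trunc J f) where
  measurable := by
    refine Measurable.indicator (by fun_prop) ?_
    exact (measurableSet_le hf.norm measurable_const).inter
      (measurableSet_le measurable_norm measurable_const)
  exists_bound := ⟨J, fun x => by
    by_cases h : x ∈ {x | ‖f x‖ ≤ J ∧ ‖x‖ ≤ J}
    · rw [trunc, indicator_of_mem h]; simpa using h.1
    · rw [trunc, indicator_of_notMem h]; simp⟩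
  exists_support := ⟨J, fun x hx => (mem_of_indicator_ne_zero hx).2⟩

theorem trunc_eq_norm (J : ℕ) (f : Rd d → ℂ) (x : Rd d) : trunc J f x = (‖trunc J f x‖ : ℂ) := by
  by_cases h : x ∈ {x | ‖f x‖ ≤ J ∧ ‖x‖ ≤ J}
  · rw [trunc, indicator_of_mem h]; simp
  · rw [trunc, indicator_of_notMem h]; simp

theorem enorm_trunc (J : ℕ) (f : Rd d → ℂ) (x : Rd d) :
    ‖trunc J f x‖ₑ = {x | ‖f x‖ ≤ J ∧ ‖x‖ ≤ J}.indicator (fun x => ‖f x‖ₑ) x := by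
  by_cases h : x ∈ {x | ‖f x‖ ≤ J ∧ ‖x‖ ≤ J}
  · rw [trunc, indicator_of_mem h, indicator_of_mem h, ← ofReal_norm, ← ofReal_norm]; simp
  · rw [trunc, indicator_of_notMem h, indicator_of_notMem h]; simp

theorem enorm_trunc_le (J : ℕ) (f : Rd d → ℂ) (x : Rd d) : ‖trunc J f x‖ₑ ≤ ‖f x‖ₑ := by
  rw [enorm_trunc]
  exact indicator_le_self _ _ _

theorem monotone_enorm_trunc (f : Rd d → ℂ) : Monotone fun J x => ‖trunc J f x‖ₑ := by
  intro J K hJK x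
  simp only [enorm_trunc]
  have : (J : ℝ) ≤ K := by exact_mod_cast hJK
  have hsub : {x | ‖f x‖ ≤ J ∧ ‖x‖ ≤ J} ⊆ {x | ‖f x‖ ≤ K ∧ ‖x‖ ≤ K} :=
    fun y hy => ⟨hy.1.trans this, hy.2.trans this⟩
  exact indicator_le_indicator_of_subset hsub (fun _ => zero_le) _

theorem eventually_enorm_trunc_eq (f : Rd d → ℂ) (x : Rd d) :
    ∀ᶠ J : ℕ in atTop, ‖trunc J f x‖ₑ = ‖f x‖ₑ := by
  filter_upwards [tendsto_natCast_atTop_atTop.eventually_ge_atTop (‖f x‖),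
    tendsto_natCast_atTop_atTop.eventually_ge_atTop (‖x‖)] with J h1 h2
  rw [enorm_trunc, indicator_of_mem]
  exact ⟨h1, h2⟩

theorem iSup_posConv_trunc (μ : Measure (Rd d × Rd d)) [SFinite μ] {f g : Rd d → ℂ}
    (hf : Measurable f) (hg : Measurable g) (s : ℝ) (x : Rd d) :
    ⨆ J, posConv μ s (fun x => ‖trunc J f x‖ₑ) (fun x => ‖trunc J g x‖ₑ) x =
      posConv μ s (fun x => ‖f x‖ₑ) (fun x => ‖g x‖ₑ) x := by
  unfold posConv
  rw [← lintegral_iSup]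
  · refine lintegral_congr fun w => iSup_eq_of_tendsto ?_ ?_
    · exact fun J K h => mul_le_mul' (monotone_enorm_trunc f h _) (monotone_enorm_trunc g h _)
    · refine tendsto_const_nhds.congr' ?_
      filter_upwards [eventually_enorm_trunc_eq f (x - s • w.1),
        eventually_enorm_trunc_eq g (x - s • w.2)] with J h1 h2
      rw [h1, h2]
  · exact fun J => measurable_posConv_right μ (isNice_trunc J hf).measurable.enorm
      (isNice_trunc J hg).measurable.enorm x s
  · exact fun J K h w => mul_le_mul' (monotone_enorm_trunc f h _) (monotone_enorm_trunc g h _)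

theorem eLpNorm_ofReal_rpow {E : Type*} [TopologicalSpace E] [ContinuousENorm E] {p : ℝ}
    (hp : 0 < p) {α : Type*} [MeasurableSpace α] (ν : Measure α) (f : α → E) :
    eLpNorm f (ENNReal.ofReal p) ν ^ p = ∫⁻ x, ‖f x‖ₑ ^ p ∂ν := by
  rw [eLpNorm_eq_lintegral_rpow_enorm_toReal (by simpa using hp) ENNReal.ofReal_ne_top,
    ENNReal.toReal_ofReal hp.le, ← ENNReal.rpow_mul, one_div_mul_cancel hp.ne', ENNReal.rpow_one]

theorem aemeasurable_biSup_posConv (μ : Measure (Rd d × Rd d)) [SFinite μ] {F G : Rd d → ℝ≥0∞}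
    (hF : Measurable F) (hG : Measurable G) {B : Set ℝ} (hB : MeasurableSet B) :
    AEMeasurable (fun x => ⨆ s ∈ B, posConv μ s F G x) volume :=
  aemeasurable_biSup_of_measurable volume (measurable_posConv μ hF hG) hB

/-- The hypothesis alone says nothing where a Bochner integral diverges, since its value there is 0
by default. Applied to truncations of |f| and |g| it bounds genuine positive averages, and monotone
convergence removes the truncation. -/
theorem lintegral_biSup_posConv_rpow_le {μ : Measure (Rd d × Rd d)} [IsFiniteMeasure μ]
    {p q : ℝ≥0∞} {r : ℝ} (hr : 0 < r) {C : ℝ≥0}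
    (hC : ∀ f g : Rd d → ℂ, MemLp f p volume → MemLp g q volume →
      eLpNorm (singleScaleMax μ 1 f g) (ENNReal.ofReal r) volume ≤
        C * eLpNorm f p volume * eLpNorm g q volume)
    {f g : Rd d → ℂ} (hf : Measurable f) (hg : Measurable g) :
    ∫⁻ x, (⨆ s ∈ Icc (1 : ℝ) (2 * 1), posConv μ s (fun x => ‖f x‖ₑ) (fun x => ‖g x‖ₑ) x) ^ r ≤
      (C * eLpNorm f p volume * eLpNorm g q volume) ^ r := by
  set Φ : ℕ → Rd d → ℝ≥0∞ := fun J x => ⨆ s ∈ Icc (1 : ℝ) (2 * 1),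
    posConv μ s (fun x => ‖trunc J f x‖ₑ) (fun x => ‖trunc J g x‖ₑ) x
  have hmono : Monotone Φ := fun J K h x => iSup₂_mono fun s _ =>
    posConv_mono μ (monotone_enorm_trunc f h) (monotone_enorm_trunc g h) s x
  have h1 : ∀ x, (⨆ s ∈ Icc (1 : ℝ) (2 * 1),
      posConv μ s (fun x => ‖f x‖ₑ) (fun x => ‖g x‖ₑ) x) ^ r = ⨆ J, Φ J x ^ r := by
    intro x
    have : (⨆ s ∈ Icc (1 : ℝ) (2 * 1), posConv μ s (fun x => ‖f x‖ₑ) (fun x => ‖g x‖ₑ) x) =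
        ⨆ J, Φ J x := by
      simp_rw [← iSup_posConv_trunc μ hf hg, Φ]
      rw [iSup_comm]
      exact iSup_congr fun s => iSup_comm
    rw [this]
    exact (ENNReal.orderIsoRpow r hr).map_iSup _
  simp_rw [h1]
  rw [lintegral_iSup']
  · refine iSup_le fun J => ?_
    have h2 : Φ J = singleScaleMax μ 1 (trunc J f) (trunc J g) := by
      ext x
      exact iSup_congr fun s => iSup_congr fun _ => (enorm_bilinConv_of_nonneg μ (isNice_trunc J hf)
        (isNice_trunc J hg) (trunc_eq_norm J f) (trunc_eq_norm J g) s x).symm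
    have h3 := eLpNorm_ofReal_rpow hr volume (Φ J)
    simp only [enorm_eq_self] at h3
    rw [← h3, h2]
    refine ENNReal.rpow_le_rpow ((hC _ _ ((isNice_trunc J hf).memLp p)
      ((isNice_trunc J hg).memLp q)).trans ?_) hr.le
    gcongr
    · exact eLpNorm_mono_enorm_ae (ae_of_all _ (enorm_trunc_le J f))
    · exact eLpNorm_mono_enorm_ae (ae_of_all _ (enorm_trunc_le J g))
  · exact fun J => (aemeasurable_biSup_posConv μ (isNice_trunc J hf).measurable.enorm
      (isNice_trunc J hg).measurable.enorm measurableSet_Icc).pow_const r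
  · exact ae_of_all _ fun x J K h => ENNReal.rpow_le_rpow (hmono h x) hr.le

end Basic

end BilinearSparse

/-! ### Absolute convergence almost everywhere and independence of representatives -/

namespace BilinearSparse

open Filter Topology

section Convergence

variable {d : ℕ}

theorem posConv_dilate (μ : Measure (Rd d × Rd d)) {a : ℝ} (ha : a ≠ 0) (t : ℝ)
    (F G : Rd d → ℝ≥0∞) (x : Rd d) :
    posConv μ t F G x = posConv μ (t / a) (fun u => F (a • u)) (fun u => G (a • u)) (a⁻¹ • x) := by
  unfold posConv
  refine lintegral_congr fun w => ?_
  simp only [smul_sub, smul_smul, mul_inv_cancel₀ ha, one_smul, mul_div_cancel₀ t ha]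

theorem memLp_comp_smul {p : ℝ≥0∞} {f : Rd d → ℂ} (hf : MemLp f p volume) {a : ℝ} (ha : a ≠ 0) :
    MemLp (fun u => f (a • u)) p volume := by
  refine MemLp.comp_of_map (f := fun u : Rd d => a • u) ?_ (by fun_prop)
  rw [Measure.map_addHaar_smul volume ha]
  exact hf.smul_measure ENNReal.ofReal_ne_top

/-- Each t > 0 is 2^k s with s in [1,2], and dilation by 2^k reduces scale t to scale s. Only
countably many exceptional null sets arise. -/
theorem ae_forall_pos_of_ae_forall_Icc {f g : Rd d → ℂ} {μ : Measure (Rd d × Rd d)}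
    {P : ℝ≥0∞ → Prop}
    (h : ∀ a : ℝ, a ≠ 0 → ∀ᵐ x : Rd d, ∀ s ∈ Icc (1 : ℝ) (2 * 1),
      P (posConv μ s (fun x => ‖f (a • x)‖ₑ) (fun x => ‖g (a • x)‖ₑ) x)) :
    ∀ᵐ x : Rd d, ∀ t : ℝ, 0 < t →
      P (posConv μ t (fun x => ‖f x‖ₑ) (fun x => ‖g x‖ₑ) x) := by
  have h1 : ∀ᵐ x : Rd d, ∀ k : ℤ, ∀ s ∈ Icc (1 : ℝ) (2 * 1),
      P (posConv μ s (fun x => ‖f ((2 : ℝ) ^ k • x)‖ₑ) (fun x => ‖g ((2 : ℝ) ^ k • x)‖ₑ)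
        (((2 : ℝ) ^ k)⁻¹ • x)) := by
    rw [ae_all_iff]
    intro k
    have hk : (2 : ℝ) ^ k ≠ 0 := by positivity
    exact (Measure.quasiMeasurePreserving_smul volume (inv_ne_zero hk)).ae (h _ hk)
  filter_upwards [h1] with x hx t ht
  obtain ⟨k, hk1, hk2⟩ := exists_mem_Ico_zpow ht (by norm_num : (1 : ℝ) < 2)
  have hk : (0 : ℝ) < 2 ^ k := by positivity
  rw [posConv_dilate μ hk.ne']
  refine hx k (t / 2 ^ k) ⟨(one_le_div hk).2 hk1, (div_le_iff₀ hk).2 ?_⟩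
  rw [zpow_add₀ two_ne_zero, zpow_one] at hk2
  linarith

theorem ae_forall_posConv_lt_top {μ : Measure (Rd d × Rd d)} [IsFiniteMeasure μ]
    {p q : ℝ≥0∞} {r : ℝ} (hr : 0 < r) (hb : SingleScaleBounded μ p q (ENNReal.ofReal r))
    {f g : Rd d → ℂ} (hf : Measurable f) (hg : Measurable g) (hfp : MemLp f p volume)
    (hgq : MemLp g q volume) :
    ∀ᵐ x : Rd d, ∀ t : ℝ, 0 < t →
      posConv μ t (fun x => ‖f x‖ₑ) (fun x => ‖g x‖ₑ) x < ∞ := by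
  obtain ⟨C, hC⟩ := hb
  refine ae_forall_pos_of_ae_forall_Icc (P := fun v => v < ∞) fun a ha => ?_
  have hfa : Measurable fun x => f (a • x) := hf.comp (measurable_const_smul a)
  have hga : Measurable fun x => g (a • x) := hg.comp (measurable_const_smul a)
  have h1 := lintegral_biSup_posConv_rpow_le hr hC hfa hga
  have h2 : (C * eLpNorm (fun x => f (a • x)) p volume * eLpNorm (fun x => g (a • x)) q volume)
      ^ r ≠ ∞ := by
    refine ENNReal.rpow_ne_top_of_nonneg hr.le (ENNReal.mul_ne_top (ENNReal.mul_ne_top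
      ENNReal.coe_ne_top (memLp_comp_smul hfp ha).2.ne) (memLp_comp_smul hgq ha).2.ne)
  have h3 := ae_lt_top' ((aemeasurable_biSup_posConv μ hfa.enorm hga.enorm
    measurableSet_Icc).pow_const r) (h1.trans_lt h2.lt_top).ne
  filter_upwards [h3] with x hx s hs
  have h4 := (ENNReal.rpow_lt_top_iff_of_pos hr).1 hx
  exact (le_biSup (fun s => posConv μ s (fun x => ‖f (a • x)‖ₑ) (fun x => ‖g (a • x)‖ₑ) x)
    hs).trans_lt h4

theorem ae_forall_posConv_eq_zero {μ : Measure (Rd d × Rd d)} [IsFiniteMeasure μ]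
    {p q : ℝ≥0∞} {r : ℝ} (hr : 0 < r) (hb : SingleScaleBounded μ p q (ENNReal.ofReal r))
    {f g : Rd d → ℂ} (hf : Measurable f) (hg : Measurable g)
    (h0 : f =ᵐ[volume] 0 ∨ g =ᵐ[volume] 0) :
    ∀ᵐ x : Rd d, ∀ t : ℝ, 0 < t →
      posConv μ t (fun x => ‖f x‖ₑ) (fun x => ‖g x‖ₑ) x = 0 := by
  obtain ⟨C, hC⟩ := hb
  refine ae_forall_pos_of_ae_forall_Icc (P := fun v => v = 0) fun a ha => ?_
  have hfa : Measurable fun x => f (a • x) := hf.comp (measurable_const_smul a)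
  have hga : Measurable fun x => g (a • x) := hg.comp (measurable_const_smul a)
  have h1 := lintegral_biSup_posConv_rpow_le hr hC hfa hga
  have hz : ∀ {u : Rd d → ℂ} {s : ℝ≥0∞}, u =ᵐ[volume] 0 →
      eLpNorm (fun x => u (a • x)) s volume = 0 := by
    intro u s hu
    have : (fun x => u (a • x)) =ᵐ[volume] 0 :=
      (Measure.quasiMeasurePreserving_smul volume ha).ae hu
    rw [eLpNorm_congr_ae this, eLpNorm_zero]
  have h2 : (C * eLpNorm (fun x => f (a • x)) p volume * eLpNorm (fun x => g (a • x)) q volume)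
      ^ r = 0 := by
    rcases h0 with h0 | h0 <;> simp [hz h0, hr]
  rw [h2, nonpos_iff_eq_zero, lintegral_eq_zero_iff' ((aemeasurable_biSup_posConv μ hfa.enorm
    hga.enorm measurableSet_Icc).pow_const r)] at h1
  filter_upwards [h1] with x hx s hs
  have h4 := (ENNReal.rpow_eq_zero_iff_of_pos hr).1 hx
  exact le_antisymm ((le_biSup (fun s => posConv μ s (fun x => ‖f (a • x)‖ₑ)
    (fun x => ‖g (a • x)‖ₑ) x) hs).trans h4.le) zero_le

/-- Changing `f` and `g` on null sets does not affect the integrands of `L_t(f,g)(x)`, `t > 0`,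
for almost every `x`. -/
theorem ae_forall_ae_eq {μ : Measure (Rd d × Rd d)} [IsFiniteMeasure μ]
    {p q : ℝ≥0∞} {r : ℝ} (hr : 0 < r) (hb : SingleScaleBounded μ p q (ENNReal.ofReal r))
    {f g f' g' : Rd d → ℂ} (hf : f =ᵐ[volume] f') (hg : g =ᵐ[volume] g') :
    ∀ᵐ x : Rd d, ∀ t : ℝ, 0 < t → (fun w : Rd d × Rd d => f (x - t • w.1) * g (x - t • w.2))
      =ᵐ[μ] fun w => f' (x - t • w.1) * g' (x - t • w.2) := by
  obtain ⟨N, hN, hNm, hN0⟩ := exists_measurable_superset_of_null (ae_iff.1 (hf.and hg))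
  -- The averages of the pairs (1_N, 1_{B_j}) and (1_{B_j}, 1_N) vanish at every scale for almost
  -- every x. As the balls B_j exhaust space, neither `x - t y` nor `x - t z` meets N, for
  -- `μ`-almost every (y,z).
  set u : Rd d → ℂ := N.indicator 1
  set v : ℕ → Rd d → ℂ := fun j => (Metric.closedBall (0 : Rd d) j).indicator 1
  have hum : Measurable u := measurable_one.indicator hNm
  have hvm : ∀ j, Measurable (v j) := fun j => measurable_one.indicator measurableSet_closedBall
  have hu0 : u =ᵐ[volume] 0 := 
    (measure_eq_zero_iff_ae_notMem.1 hN0).mono fun x hx => indicator_of_notMem hx _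
  have h1 : ∀ᵐ x : Rd d, ∀ j : ℕ, ∀ t : ℝ, 0 < t →
      posConv μ t (fun x => ‖u x‖ₑ) (fun x => ‖v j x‖ₑ) x = 0 := ae_all_iff.2 fun j =>
    ae_forall_posConv_eq_zero hr hb hum (hvm j) (Or.inl hu0)
  have h2 : ∀ᵐ x : Rd d, ∀ j : ℕ, ∀ t : ℝ, 0 < t →
      posConv μ t (fun x => ‖v j x‖ₑ) (fun x => ‖u x‖ₑ) x = 0 := ae_all_iff.2 fun j =>
    ae_forall_posConv_eq_zero hr hb (hvm j) hum (Or.inr hu0)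
  filter_upwards [h1, h2] with x hx1 hx2 t ht
  have e1 : ∀ᵐ w ∂μ, ∀ j : ℕ, ‖u (x - t • w.1)‖ₑ * ‖v j (x - t • w.2)‖ₑ = 0 :=
    ae_all_iff.2 fun j => (lintegral_eq_zero_iff
      (measurable_posConv_right μ hum.enorm (hvm j).enorm x t)).1 (hx1 j t ht)
  have e2 : ∀ᵐ w ∂μ, ∀ j : ℕ, ‖v j (x - t • w.1)‖ₑ * ‖u (x - t • w.2)‖ₑ = 0 :=
    ae_all_iff.2 fun j => (lintegral_eq_zero_iff
      (measurable_posConv_right μ (hvm j).enorm hum.enorm x t)).1 (hx2 j t ht)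
  have key : ∀ y z : Rd d, (∀ j, ‖u y‖ₑ * ‖v j z‖ₑ = 0) → y ∉ N := by
    intro y z h hy
    obtain ⟨j, hj⟩ := exists_nat_ge ‖z‖
    have := h j
    simp [u, v, hy, hj] at this
  filter_upwards [e1, e2] with w hw1 hw2
  have n1 := key _ _ hw1
  have n2 := key (x - t • w.2) (x - t • w.1) fun j => by rw [mul_comm]; exact hw2 j
  have m1 : f (x - t • w.1) = f' (x - t • w.1) := by
    by_contra hc; exact n1 (hN (fun h => hc h.1))
  have m2 : g (x - t • w.2) = g' (x - t • w.2) := by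
    by_contra hc; exact n2 (hN (fun h => hc h.2))
  rw [m1, m2]

theorem measurable_bilinConv (μ : Measure (Rd d × Rd d)) [SFinite μ] {f g : Rd d → ℂ}
    (hf : Measurable f) (hg : Measurable g) :
    Measurable fun z : Rd d × ℝ => bilinConv μ z.2 f g z.1 := by
  refine (StronglyMeasurable.integral_prod_right'
    (f := fun z : (Rd d × ℝ) × (Rd d × Rd d) =>
      f (z.1.1 - z.1.2 • z.2.1) * g (z.1.1 - z.1.2 • z.2.2)) ?_).measurable
  exact ((hf.comp (by fun_prop)).mul (hg.comp (by fun_prop))).stronglyMeasurable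

theorem fullMax_ae_eq {μ : Measure (Rd d × Rd d)} [IsFiniteMeasure μ]
    {p q : ℝ≥0∞} {r : ℝ} (hr : 0 < r) (hb : SingleScaleBounded μ p q (ENNReal.ofReal r))
    {f g f' g' : Rd d → ℂ} (hf : f =ᵐ[volume] f') (hg : g =ᵐ[volume] g') :
    fullMax μ f g =ᵐ[volume] fullMax μ f' g' := by
  filter_upwards [ae_forall_ae_eq hr hb hf hg] with x hx
  exact iSup_congr fun t => iSup_congr fun ht => by
    rw [bilinConv, bilinConv, integral_congr_ae (hx t ht)]

theorem aemeasurable_fullMax {μ : Measure (Rd d × Rd d)} [IsFiniteMeasure μ]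
    {p q : ℝ≥0∞} {r : ℝ} (hr : 0 < r) (hb : SingleScaleBounded μ p q (ENNReal.ofReal r))
    {f g : Rd d → ℂ} (hf : MemLp f p volume) (hg : MemLp g q volume) :
    AEMeasurable (fullMax μ f g) volume := by
  have h1 := hf.1.aemeasurable
  have h2 := hg.1.aemeasurable
  refine AEMeasurable.congr ?_ (fullMax_ae_eq hr hb h1.ae_eq_mk h2.ae_eq_mk).symm
  exact aemeasurable_biSup_of_measurable volume
    (measurable_bilinConv μ h1.measurable_mk h2.measurable_mk).enorm measurableSet_Ioi

theorem ae_forall_integrable {μ : Measure (Rd d × Rd d)} [IsFiniteMeasure μ]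
    {p q : ℝ≥0∞} {r : ℝ} (hr : 0 < r) (hb : SingleScaleBounded μ p q (ENNReal.ofReal r))
    {f g : Rd d → ℂ} (hf : MemLp f p volume) (hg : MemLp g q volume) :
    ∀ᵐ x : Rd d, ∀ t : ℝ, 0 < t →
      Integrable (fun w : Rd d × Rd d => f (x - t • w.1) * g (x - t • w.2)) μ := by
  have h1 := hf.1.aemeasurable
  have h2 := hg.1.aemeasurable
  filter_upwards [ae_forall_ae_eq hr hb h1.ae_eq_mk h2.ae_eq_mk,
    ae_forall_posConv_lt_top hr hb h1.measurable_mk h2.measurable_mk (hf.ae_eq h1.ae_eq_mk)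
      (hg.ae_eq h2.ae_eq_mk)] with x hx hlt t ht
  refine Integrable.congr ?_ (hx t ht).symm
  refine ⟨((h1.measurable_mk.comp (by fun_prop)).mul
    (h2.measurable_mk.comp (by fun_prop))).aestronglyMeasurable, ?_⟩
  simpa [HasFiniteIntegral, posConv] using hlt t ht

end Convergence

end BilinearSparse

/-! ### From the two-sided continuity estimate to a one-sided one -/

namespace BilinearSparse

open Filter Topology

section OneSided

variable {d : ℕ}

theorem bilinConv_map_swap (μ : Measure (Rd d × Rd d)) (s : ℝ) (f g : Rd d → ℂ) (x : Rd d) :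
    bilinConv (μ.map Prod.swap) s f g x = bilinConv μ s g f x := by
  have h := integral_map_equiv (μ := μ) (MeasurableEquiv.prodComm (α := Rd d) (β := Rd d))
    (fun w : Rd d × Rd d => f (x - s • w.1) * g (x - s • w.2))
  refine h.trans (integral_congr_ae (ae_of_all _ fun w => ?_))
  exact mul_comm _ _

theorem singleScaleMax_map_swap (μ : Measure (Rd d × Rd d)) (t : ℝ) (f g : Rd d → ℂ) :
    singleScaleMax (μ.map Prod.swap) t f g = singleScaleMax μ t g f := by
  ext x
  simp only [singleScaleMax, bilinConv_map_swap]

theorem ContinuityEstimate.swap {μ : Measure (Rd d × Rd d)} {p q r : ℝ}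
    (h : ContinuityEstimate μ p q r) : ContinuityEstimate (μ.map Prod.swap) q p r := by
  obtain ⟨η₁, η₂, h1, h2, C, hC⟩ := h
  refine ⟨η₂, η₁, h2, h1, C, fun t ht y₁ y₂ f g hf hg => ?_⟩
  rw [singleScaleMax_map_swap]
  refine (hC t ht y₂ y₁ g f hg hf).trans (le_of_eq ?_)
  rw [show (d : ℝ) * (1 / r - 1 / p - 1 / q) = d * (1 / r - 1 / q - 1 / p) by ring,
    mul_right_comm (t ^ _) ((‖y₂‖ / t) ^ η₁)]
  exact mul_right_comm _ _ _

/-- A continuity estimate in the second function alone, for functions living at the scale of the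
operator. -/
def OneSidedContinuity (μ : Measure (Rd d × Rd d)) (p q r η D : ℝ) : Prop :=
  ∃ C : ℝ≥0, ∀ t : ℝ, 0 < t → ∀ (y : Rd d) (f g : Rd d → ℂ), IsNice f → IsNice g →
    (∀ u v, f u ≠ 0 → subTranslate y g v ≠ 0 → ‖u - v‖ ≤ D * t) →
      eLpNorm (singleScaleMax μ t f (subTranslate y g)) (ENNReal.ofReal r) volume ≤
        C * ENNReal.ofReal (t ^ ((d : ℝ) * (1 / r - 1 / p - 1 / q)) * (‖y‖ / t) ^ η) *
          eLpNorm f (ENNReal.ofReal p) volume * eLpNorm g (ENNReal.ofReal q) volume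

/-- If f and the difference of g live within distance Dt of each other, translating f by a large
multiple of t puts it out of reach of the averages at scales in [t,2t]. Hence f may be replaced by f
minus this translate, and the factor (|y₁|/t)^η₁ is a constant. -/
theorem ContinuityEstimate.exists_oneSided (hd : 1 ≤ d) {μ : Measure (Rd d × Rd d)}
    [IsFiniteMeasure μ] {p q r R : ℝ} (hR : ∀ᵐ w ∂μ, ‖w.1‖ ≤ R ∧ ‖w.2‖ ≤ R) (hR0 : 0 ≤ R)
    (h : ContinuityEstimate μ p q r) :
    ∃ η : ℝ, 0 < η ∧ ∀ D : ℝ, 0 ≤ D → OneSidedContinuity μ p q r η D := by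
  obtain ⟨η₁, η₂, h1, h2, C, hC⟩ := h
  refine ⟨η₂, h2, fun D hD => ?_⟩
  -- The two points at which f and g are evaluated differ from x by at most 2tR each; together with
  -- Dt this allows a shift of at most (D + 4R)t, and the 1 makes K exceed that.
  set K : ℝ := D + 4 * R + 1
  have hK : 0 < K := by positivity
  refine ⟨C * (K ^ η₁).toNNReal, fun t ht y f g hf hg hsupp => ?_⟩
  set e : Rd d := EuclideanSpace.single ⟨0, hd⟩ 1
  set y₁ : Rd d := (K * t) • e
  have hy₁ : ‖y₁‖ = K * t := by
    simp only [y₁, e, norm_smul, PiLp.norm_single, norm_one, mul_one]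
    exact Real.norm_of_nonneg (by positivity)
  have heq : ∀ x, singleScaleMax μ t f (subTranslate y g) x =
      singleScaleMax μ t (subTranslate y₁ f) (subTranslate y g) x := by
    intro x
    refine iSup_congr fun s => iSup_congr fun hs => ?_
    congr 1
    refine integral_congr_ae ?_
    filter_upwards [hR] with w hw
    have h0 : f (x - s • w.1 - y₁) * subTranslate y g (x - s • w.2) = 0 := by
      by_contra hne
      obtain ⟨ha, hb⟩ := mul_ne_zero_iff.1 hne
      have h3 := hsupp _ _ ha hb
      have hs0 : 0 ≤ s := ht.le.trans hs.1
      have e1 : y₁ = -(x - s • w.1 - y₁ - (x - s • w.2)) - s • w.1 + s • w.2 := by abel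
      have h4 : ‖y₁‖ ≤ D * t + s * ‖w.1‖ + s * ‖w.2‖ := by
        rw [e1]
        refine (norm_add_le _ _).trans (add_le_add ((norm_sub_le _ _).trans (add_le_add ?_ ?_)) ?_)
        · rwa [norm_neg]
        · rw [norm_smul, Real.norm_of_nonneg hs0]
        · rw [norm_smul, Real.norm_of_nonneg hs0]
      have h5 : s * ‖w.1‖ ≤ 2 * t * R := mul_le_mul hs.2 hw.1 (norm_nonneg _) (by positivity)
      have h6 : s * ‖w.2‖ ≤ 2 * t * R := mul_le_mul hs.2 hw.2 (norm_nonneg _) (by positivity)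
      have h7 : K * t = D * t + 4 * R * t + t := by ring
      rw [hy₁] at h4
      linarith
    simp only [subTranslate] at h0 ⊢
    rw [sub_mul, h0, sub_zero]
  rw [show singleScaleMax μ t f (subTranslate y g) =
    singleScaleMax μ t (subTranslate y₁ f) (subTranslate y g) from funext heq]
  refine (hC t ht y₁ y f g (hf.memLp _) (hg.memLp _)).trans (le_of_eq ?_)
  congr 2
  rw [hy₁, mul_div_cancel_right₀ K ht.ne', ENNReal.coe_mul, mul_assoc (C : ℝ≥0∞), mul_right_comm,
    mul_comm _ (K ^ η₁), ENNReal.ofReal_mul (by positivity)]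
  rfl

end OneSided

end BilinearSparse

/-! ### Dyadic grids -/

namespace BilinearSparse

open Filter Topology

/-- A dyadic grid: all dyadic subcubes of the cubes of side `scale` with corners in
`origin + scale • ℤᵈ`. -/
structure Grid (d : ℕ) where
  origin : Fin d → ℝ
  scale : ℝ
  scale_pos : 0 < scale

namespace Grid

variable {d : ℕ} (𝒟 : Grid d)

/-- The side of the cubes of generation `n`. -/
noncomputable def side (n : ℕ) : ℝ := 𝒟.scale / 2 ^ n

theorem side_pos (n : ℕ) : 0 < 𝒟.side n := div_pos 𝒟.scale_pos (by positivity)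

theorem side_add (n j : ℕ) : 𝒟.side (n + j) = 𝒟.side n / 2 ^ j := by
  rw [side, side, pow_add, div_div]

/-- The index of the cube of generation `n` that contains `x`. -/
noncomputable def index (n : ℕ) (x : Rd d) : Fin d → ℤ :=
  fun i => ⌊(x i - 𝒟.origin i) / 𝒟.side n⌋

/-- The cube of generation `n` with index `k`. -/
noncomputable def cube (n : ℕ) (k : Fin d → ℤ) : Cube d where
  corner := WithLp.toLp 2 fun i => 𝒟.origin i + 𝒟.side n * k i
  side := 𝒟.side n
  side_pos := 𝒟.side_pos n

/-- The points of the cube of generation `n` with index `k`. -/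
def cell (n : ℕ) (k : Fin d → ℤ) : Set (Rd d) := 𝒟.index n ⁻¹' {k}

theorem toSet_cube (n : ℕ) (k : Fin d → ℤ) : (𝒟.cube n k).toSet = 𝒟.cell n k := by
  ext x
  have hs := 𝒟.side_pos n
  simp only [Cube.toSet, cube, cell, index, mem_ofPred_eq, mem_preimage, mem_singleton_iff,
    funext_iff, Int.floor_eq_iff, mem_Ico]
  refine forall_congr' fun i => and_congr ?_ ?_
  · rw [le_div_iff₀ hs, mul_comm, le_sub_iff_add_le, add_comm]
  · rw [div_lt_iff₀ hs, add_mul, one_mul, mul_comm, sub_lt_iff_lt_add]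
    constructor <;> intro h <;> linarith

theorem mem_cell {n : ℕ} {k : Fin d → ℤ} {x : Rd d} : x ∈ 𝒟.cell n k ↔ 𝒟.index n x = k := Iff.rfl

theorem measurable_index (n : ℕ) : Measurable (𝒟.index n) :=
  measurable_pi_lambda _ fun i => Int.measurable_floor.comp (by fun_prop)

theorem measurableSet_cell (n : ℕ) (k : Fin d → ℤ) : MeasurableSet (𝒟.cell n k) :=
  𝒟.measurable_index n (measurableSet_singleton k)

theorem floor_eq_of_floor_mul_eq {u v : ℝ} {N : ℕ} (hN : 0 < N) (h : ⌊N * u⌋ = ⌊N * v⌋) :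
    ⌊u⌋ = ⌊v⌋ := by
  have key : ∀ {u v : ℝ}, ⌊N * u⌋ = ⌊N * v⌋ → ⌊u⌋ ≤ ⌊v⌋ := by
    intro u v h
    have hN' : (0 : ℝ) < N := by exact_mod_cast hN
    rw [Int.le_floor]
    have h1 : ((N * ⌊u⌋ : ℤ) : ℝ) ≤ N * u := by
      push_cast
      exact mul_le_mul_of_nonneg_left (Int.floor_le u) hN'.le
    have h2 := Int.le_floor.1 ((Int.le_floor.2 h1).trans h.le)
    push_cast at h2
    exact le_of_mul_le_mul_left h2 hN'
  exact le_antisymm (key h) (key h.symm)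

theorem index_eq_of_le {m n : ℕ} (hmn : m ≤ n) {x y : Rd d} (h : 𝒟.index n x = 𝒟.index n y) :
    𝒟.index m x = 𝒟.index m y := by
  obtain ⟨j, rfl⟩ := Nat.exists_eq_add_of_le hmn
  ext i
  refine floor_eq_of_floor_mul_eq (N := 2 ^ j) (by positivity) ?_
  have h' := congrFun h i
  have e : ∀ a : ℝ, a / 𝒟.side (m + j) = ((2 ^ j : ℕ) : ℝ) * (a / 𝒟.side m) := by
    intro a
    rw [side_add]
    push_cast
    field_simp
  simpa only [index, e] using h'

theorem abs_sub_lt_of_index_eq {n : ℕ} {x y : Rd d} (h : 𝒟.index n x = 𝒟.index n y) (i : Fin d) :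
    |x i - y i| < 𝒟.side n := by
  have h1 := Int.abs_sub_lt_one_of_floor_eq_floor (congrFun h i)
  rw [← sub_div, sub_sub_sub_cancel_right, abs_div, abs_of_pos (𝒟.side_pos n),
    div_lt_one (𝒟.side_pos n)] at h1
  exact h1

theorem norm_le_of_forall_abs_le {z : Rd d} {B : ℝ} (hB : 0 ≤ B) (h : ∀ i, |z i| ≤ B) :
    ‖z‖ ≤ d * B := by
  rw [EuclideanSpace.norm_eq, Real.sqrt_le_iff]
  refine ⟨by positivity, ?_⟩
  have h1 : ∑ i, ‖z i‖ ^ 2 ≤ d * B ^ 2 := by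
    refine (Finset.sum_le_sum fun i _ => pow_le_pow_left₀ (norm_nonneg _) (h i) 2).trans ?_
    simp
  have h2 : (d : ℝ) ≤ (d : ℝ) ^ 2 := by
    exact_mod_cast Nat.le_self_pow two_ne_zero d
  calc ∑ i, ‖z i‖ ^ 2 ≤ d * B ^ 2 := h1
    _ ≤ (d : ℝ) ^ 2 * B ^ 2 := by gcongr
    _ = (d * B) ^ 2 := by ring

theorem norm_sub_le_of_index_eq {n : ℕ} {x y : Rd d} (h : 𝒟.index n x = 𝒟.index n y) :
    ‖x - y‖ ≤ d * 𝒟.side n :=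
  norm_le_of_forall_abs_le (𝒟.side_pos n).le fun i => (𝒟.abs_sub_lt_of_index_eq h i).le

theorem volume_pi_preimage (s : Set (Fin d → ℝ)) (hs : MeasurableSet s) :
    volume {x : Rd d | (fun i => x i) ∈ s} = volume s :=
  (EuclideanSpace.volume_preserving_symm_measurableEquiv_toLp (Fin d)).measure_preimage
    hs.nullMeasurableSet

theorem volume_toSet (Q : Cube d) : volume Q.toSet = ENNReal.ofReal Q.side ^ d := by
  have : Q.toSet = {x : Rd d | (fun i => x i) ∈
      Set.pi univ fun i => Ico (Q.corner i) (Q.corner i + Q.side)} := by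
    ext; simp [Cube.toSet]
  rw [this, volume_pi_preimage _ (MeasurableSet.univ_pi fun _ => measurableSet_Ico),
    volume_pi_pi]
  simp

theorem volume_cell (n : ℕ) (k : Fin d → ℤ) :
    volume (𝒟.cell n k) = ENNReal.ofReal (𝒟.side n) ^ d := by
  rw [← toSet_cube, volume_toSet]; rfl

theorem volume_cell_pos (n : ℕ) (k : Fin d → ℤ) : 0 < volume (𝒟.cell n k) := by
  rw [volume_cell]
  exact pos_iff_ne_zero.2 (pow_ne_zero d (ENNReal.ofReal_pos.2 (𝒟.side_pos n)).ne')

theorem volume_cell_ne_top (n : ℕ) (k : Fin d → ℤ) : volume (𝒟.cell n k) ≠ ∞ := by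
  rw [volume_cell]
  exact ENNReal.pow_ne_top ENNReal.ofReal_ne_top

theorem volume_cell_succ (n : ℕ) (k l : Fin d → ℤ) :
    volume (𝒟.cell n k) = 2 ^ d * volume (𝒟.cell (n + 1) l) := by
  rw [volume_cell, volume_cell, ← mul_pow, side_add, pow_one]
  congr 1
  rw [← ENNReal.ofReal_ofNat, ← ENNReal.ofReal_mul (by norm_num)]
  congr 1
  ring

/-- The box `{y : |yᵢ| < side n}` of differences of points in a common cube. -/
def box (n : ℕ) : Set (Rd d) := {y | ∀ i, |y i| < 𝒟.side n}

theorem box_eq (n : ℕ) : 𝒟.box n = {y : Rd d | (fun i => y i) ∈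
    Set.pi univ fun _ => Ioo (-𝒟.side n) (𝒟.side n)} := by
  ext; simp [box, abs_lt]

theorem measurableSet_box (n : ℕ) : MeasurableSet (𝒟.box n) := by
  have : 𝒟.box n = ⋂ i, {y : Rd d | |y i| < 𝒟.side n} := by ext; simp [box]
  rw [this]
  exact .iInter fun i => measurableSet_lt (by fun_prop) measurable_const

theorem volume_box (n : ℕ) : volume (𝒟.box n) = 2 ^ d * ENNReal.ofReal (𝒟.side n) ^ d := by
  rw [box_eq, volume_pi_preimage _ (MeasurableSet.univ_pi fun _ => measurableSet_Ioo),
    volume_pi_pi]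
  simp only [Real.volume_Ioo, sub_neg_eq_add, ← two_mul, Finset.prod_const, Finset.card_univ,
    Fintype.card_fin]
  rw [ENNReal.ofReal_mul (by norm_num), ENNReal.ofReal_ofNat, mul_pow]

theorem iUnion_cell (n : ℕ) : ⋃ k, 𝒟.cell n k = univ := by
  ext x; simp [mem_cell]

theorem pairwise_disjoint_cell (n : ℕ) : Pairwise (Function.onFun Disjoint (𝒟.cell n)) :=
  fun _ _ h => Disjoint.preimage _ (disjoint_singleton.2 h)

theorem lintegral_eq_tsum_cell (n : ℕ) (ν : Measure (Rd d)) (Φ : Rd d → ℝ≥0∞) :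
    ∫⁻ x, Φ x ∂ν = ∑' k, ∫⁻ x in 𝒟.cell n k, Φ x ∂ν := by
  rw [← lintegral_iUnion (𝒟.measurableSet_cell n) (𝒟.pairwise_disjoint_cell n), iUnion_cell,
    setLIntegral_univ]

end Grid

end BilinearSparse

/-! ### Mean-zero functions as averages of differences -/

namespace BilinearSparse

open Filter Topology

namespace Grid

variable {d : ℕ} (𝒟 : Grid d)

open Classical in
/-- The restriction of `b` to the points `u` for which `u` and `u - y` lie in the same cube of
generation `m`. -/
noncomputable def sameCell (m : ℕ) (b : Rd d → ℂ) (y u : Rd d) : ℂ :=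
  if 𝒟.index m u = 𝒟.index m (u - y) then b u else 0

theorem norm_sameCell_le (m : ℕ) (b : Rd d → ℂ) (y u : Rd d) :
    ‖𝒟.sameCell m b y u‖ ≤ ‖b u‖ := by
  unfold sameCell
  split_ifs <;> simp

theorem measurable_sameCell (m : ℕ) {b : Rd d → ℂ} (hb : Measurable b) {α : Type*}
    [MeasurableSpace α] {y u : α → Rd d} (hy : Measurable y) (hu : Measurable u) :
    Measurable fun z => 𝒟.sameCell m b (y z) (u z) := by
  refine Measurable.ite ?_ (hb.comp hu) measurable_const
  exact measurableSet_eq_fun ((𝒟.measurable_index m).comp hu)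
    ((𝒟.measurable_index m).comp (hu.sub hy))

theorem isNice_sameCell (m : ℕ) {b : Rd d → ℂ} (hb : IsNice b) (y : Rd d) :
    IsNice (𝒟.sameCell m b y) :=
  hb.of_le (𝒟.measurable_sameCell m hb.measurable measurable_const measurable_id)
    (𝒟.norm_sameCell_le m b y)

theorem subTranslate_sameCell (m : ℕ) (b : Rd d → ℂ) (y u : Rd d) :
    subTranslate (-y) (𝒟.sameCell m b y) u = 𝒟.sameCell m b y u - 𝒟.sameCell m b y (u + y) := by
  rw [subTranslate, sub_neg_eq_add]

theorem sameCell_add_ne_zero {m : ℕ} {b : Rd d → ℂ} {y u : Rd d}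
    (h : 𝒟.sameCell m b y (u + y) ≠ 0) : 𝒟.index m (u + y) = 𝒟.index m u ∧ b (u + y) ≠ 0 := by
  unfold sameCell at h
  split_ifs at h with h'
  · exact ⟨by rwa [add_sub_cancel_right] at h', h⟩
  · simp at h

theorem sameCell_ne_zero {m : ℕ} {b : Rd d → ℂ} {y u : Rd d}
    (h : 𝒟.sameCell m b y u ≠ 0) : 𝒟.index m u = 𝒟.index m (u - y) ∧ b u ≠ 0 := by
  unfold sameCell at h
  split_ifs at h with h'
  · exact ⟨h', h⟩
  · simp at h

theorem mem_box_of_subTranslate_ne_zero {m : ℕ} {b : Rd d → ℂ} {y u : Rd d}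
    (h : subTranslate (-y) (𝒟.sameCell m b y) u ≠ 0) : y ∈ 𝒟.box m := by
  rw [subTranslate_sameCell] at h
  by_cases h1 : 𝒟.sameCell m b y u = 0
  · rw [h1, zero_sub, neg_ne_zero] at h
    have := 𝒟.abs_sub_lt_of_index_eq (𝒟.sameCell_add_ne_zero h).1
    intro i
    simpa using this i
  · have := 𝒟.abs_sub_lt_of_index_eq (𝒟.sameCell_ne_zero h1).1
    intro i
    simpa using this i

theorem integral_sameCell (m : ℕ) (b : Rd d → ℂ) (u : Rd d) :
    ∫ y, 𝒟.sameCell m b y u = ((𝒟.side m ^ d : ℝ) : ℂ) * b u := by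
  have h := integral_sub_left_eq_self
    (fun v => (𝒟.cell m (𝒟.index m u)).indicator (fun _ => b u) v) volume u
  rw [integral_indicator_const _ (𝒟.measurableSet_cell m _), measureReal_def, volume_cell,
    ENNReal.toReal_pow, ENNReal.toReal_ofReal (𝒟.side_pos m).le, Complex.real_smul] at h
  rw [← h]
  refine integral_congr_ae (ae_of_all _ fun y => ?_)
  simp only [sameCell, indicator, mem_cell, eq_comm]

theorem integral_sameCell_add (m : ℕ) (b : Rd d → ℂ) (u : Rd d) :
    ∫ y, 𝒟.sameCell m b y (u + y) = ∫ v in 𝒟.cell m (𝒟.index m u), b v := by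
  rw [← integral_indicator (𝒟.measurableSet_cell m _),
    ← integral_add_left_eq_self ((𝒟.cell m (𝒟.index m u)).indicator b) u]
  refine integral_congr_ae (ae_of_all _ fun y => ?_)
  simp only [sameCell, indicator, mem_cell, add_sub_cancel_right]

theorem integrable_of_box {m : ℕ} {φ : Rd d → ℂ} (hφ : Measurable φ) {C : ℝ}
    (hC : ∀ y, ‖φ y‖ ≤ C) (hbox : ∀ y, φ y ≠ 0 → y ∈ 𝒟.box m) : Integrable φ volume := by
  have hfin : volume (𝒟.box m) ≠ ∞ := by
    rw [volume_box]
    exact ENNReal.mul_ne_top (by simp) (ENNReal.pow_ne_top ENNReal.ofReal_ne_top)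
  have h : Integrable ((𝒟.box m).indicator fun _ => C) volume :=
    (integrable_indicator_iff (𝒟.measurableSet_box m)).2 (integrableOn_const hfin)
  refine h.mono hφ.aestronglyMeasurable (ae_of_all _ fun y => ?_)
  by_cases hy : φ y = 0
  · simp [hy]
  · rw [indicator_of_mem (hbox y hy)]
    exact (hC y).trans (le_abs_self C)

theorem integrable_sameCell (m : ℕ) {b : Rd d → ℂ} (hb : IsNice b) (u : Rd d) :
    Integrable (fun y => 𝒟.sameCell m b y u) volume := by
  refine 𝒟.integrable_of_box (m := m) (C := ‖b u‖)
    (𝒟.measurable_sameCell m hb.measurable measurable_id measurable_const)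
    (fun y => 𝒟.norm_sameCell_le m b y u) fun y hy i => ?_
  simpa using 𝒟.abs_sub_lt_of_index_eq (𝒟.sameCell_ne_zero hy).1 i

theorem integrable_sameCell_add (m : ℕ) {b : Rd d → ℂ} (hb : IsNice b) (u : Rd d) :
    Integrable (fun y => 𝒟.sameCell m b y (u + y)) volume := by
  obtain ⟨C, hC⟩ := hb.exists_bound
  refine 𝒟.integrable_of_box (m := m) (C := C)
    (𝒟.measurable_sameCell m hb.measurable measurable_id (measurable_const_add u))
    (fun y => (𝒟.norm_sameCell_le m b y _).trans (hC _)) fun y hy i => ?_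
  simpa using 𝒟.abs_sub_lt_of_index_eq (𝒟.sameCell_add_ne_zero hy).1 i

/-- A function with mean zero on each cube of generation `m` is an average of differences. -/
theorem integral_subTranslate_sameCell (m : ℕ) {b : Rd d → ℂ} (hb : IsNice b)
    (hb0 : ∀ k, ∫ v in 𝒟.cell m k, b v = 0) (u : Rd d) :
    ∫ y, subTranslate (-y) (𝒟.sameCell m b y) u = ((𝒟.side m ^ d : ℝ) : ℂ) * b u := by
  simp_rw [subTranslate_sameCell]
  rw [integral_sub (𝒟.integrable_sameCell m hb u) (𝒟.integrable_sameCell_add m hb u),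
    integral_sameCell, integral_sameCell_add, hb0, sub_zero]

theorem measurable_subTranslate_sameCell (m : ℕ) {b : Rd d → ℂ} (hb : Measurable b) {α : Type*}
    [MeasurableSpace α] {y u : α → Rd d} (hy : Measurable y) (hu : Measurable u) :
    Measurable fun z => subTranslate (-y z) (𝒟.sameCell m b (y z)) (u z) := by
  simp_rw [subTranslate_sameCell]
  exact (𝒟.measurable_sameCell m hb hy hu).sub (𝒟.measurable_sameCell m hb hy (hu.add hy))

/-- Fubini applied to the representation of b as an average of differences; the integrand is bounded
and vanishes unless y lies in the box, so it is integrable for the product measure. -/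
theorem integral_bilinConv_sameCell (μ : Measure (Rd d × Rd d)) [IsFiniteMeasure μ] (m : ℕ)
    {f b : Rd d → ℂ} (hf : IsNice f) (hb : IsNice b)
    (hb0 : ∀ k, ∫ v in 𝒟.cell m k, b v = 0) (s : ℝ) (x : Rd d) :
    ∫ y, bilinConv μ s f (subTranslate (-y) (𝒟.sameCell m b y)) x =
      ((𝒟.side m ^ d : ℝ) : ℂ) * bilinConv μ s f b x := by
  obtain ⟨C, hC⟩ := hf.exists_bound
  obtain ⟨B, hB⟩ := hb.exists_bound
  have hC0 : 0 ≤ C := (norm_nonneg _).trans (hC 0)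
  have hint : Integrable (Function.uncurry fun (y : Rd d) (w : Rd d × Rd d) =>
      f (x - s • w.1) * subTranslate (-y) (𝒟.sameCell m b y) (x - s • w.2))
      (volume.prod μ) := by
    have hfin : (volume.prod μ) (𝒟.box m ×ˢ univ) ≠ ∞ := by
      rw [Measure.prod_prod, volume_box]
      exact ENNReal.mul_ne_top (ENNReal.mul_ne_top (by simp)
        (ENNReal.pow_ne_top ENNReal.ofReal_ne_top)) (measure_ne_top μ _)
    have h : Integrable ((𝒟.box m ×ˢ (univ : Set (Rd d × Rd d))).indicator fun _ => C * (B + B))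
        (volume.prod μ) :=
      (integrable_indicator_iff ((𝒟.measurableSet_box m).prod .univ)).2 (integrableOn_const hfin)
    refine h.mono ?_ (ae_of_all _ fun z => ?_)
    · refine Measurable.aestronglyMeasurable (Measurable.mul (hf.measurable.comp (by fun_prop)) ?_)
      exact 𝒟.measurable_subTranslate_sameCell m hb.measurable measurable_fst (by fun_prop)
    · rcases z with ⟨y, w⟩
      simp only [Function.uncurry]
      by_cases hy : subTranslate (-y) (𝒟.sameCell m b y) (x - s • w.2) = 0
      · simp [hy]
      · rw [indicator_of_mem (show (y, w) ∈ 𝒟.box m ×ˢ univ from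
          ⟨𝒟.mem_box_of_subTranslate_ne_zero hy, mem_univ _⟩), norm_mul]
        refine (mul_le_mul (hC _) ?_ (norm_nonneg _) hC0).trans (le_abs_self _)
        rw [subTranslate_sameCell]
        exact (norm_sub_le _ _).trans (add_le_add ((𝒟.norm_sameCell_le m b y _).trans (hB _))
          ((𝒟.norm_sameCell_le m b y _).trans (hB _)))
  unfold bilinConv
  rw [integral_integral_swap hint, ← integral_const_mul]
  refine integral_congr_ae (ae_of_all _ fun w => ?_)
  simp only
  rw [integral_const_mul, 𝒟.integral_subTranslate_sameCell m hb hb0]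
  ring

/-- Triangle inequality in the averaged representation of b. The differences vanish identically when
y is outside the box. -/
theorem singleScaleMax_le_lintegral_box (μ : Measure (Rd d × Rd d)) [IsFiniteMeasure μ] (m : ℕ)
    {f b : Rd d → ℂ} (hf : IsNice f) (hb : IsNice b)
    (hb0 : ∀ k, ∫ v in 𝒟.cell m k, b v = 0) (t : ℝ) (x : Rd d) :
    ENNReal.ofReal (𝒟.side m) ^ d * singleScaleMax μ t f b x ≤
      ∫⁻ y in 𝒟.box m, singleScaleMax μ t f (subTranslate (-y) (𝒟.sameCell m b y)) x := by
  simp only [singleScaleMax]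
  rw [ENNReal.mul_iSup]
  refine iSup_le fun s => ?_
  rw [ENNReal.mul_iSup]
  refine iSup_le fun hs => ?_
  have h1 : ENNReal.ofReal (𝒟.side m) ^ d * ‖bilinConv μ s f b x‖ₑ =
      ‖∫ y, bilinConv μ s f (subTranslate (-y) (𝒟.sameCell m b y)) x‖ₑ := by
    rw [𝒟.integral_bilinConv_sameCell μ m hf hb hb0, enorm_mul]
    congr 1
    rw [← ofReal_norm, Complex.norm_real, Real.norm_of_nonneg (pow_pos (𝒟.side_pos m) d).le,
      ENNReal.ofReal_pow (𝒟.side_pos m).le]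
  rw [h1]
  refine (enorm_integral_le_lintegral_enorm _).trans ?_
  rw [← lintegral_indicator (𝒟.measurableSet_box m)]
  refine lintegral_mono fun y => ?_
  by_cases hy : y ∈ 𝒟.box m
  · rw [indicator_of_mem hy]
    exact le_biSup (fun s => ‖bilinConv μ s f (subTranslate (-y) (𝒟.sameCell m b y)) x‖ₑ) hs
  · have h0 : subTranslate (-y) (𝒟.sameCell m b y) = 0 := by
      ext u
      by_contra h
      exact hy (𝒟.mem_box_of_subTranslate_ne_zero h)
    simp [bilinConv, h0]

theorem aemeasurable_singleScaleMax_sameCell (μ : Measure (Rd d × Rd d)) [IsFiniteMeasure μ]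
    (m : ℕ) {f b : Rd d → ℂ} (hf : Measurable f) (hb : Measurable b) (t : ℝ)
    (ν : Measure (Rd d × Rd d)) [SFinite ν] :
    AEMeasurable (fun z : Rd d × Rd d =>
      singleScaleMax μ t f (subTranslate (-z.2) (𝒟.sameCell m b z.2)) z.1) ν := by
  refine aemeasurable_biSup_of_measurable ν (Φ := fun z : (Rd d × Rd d) × ℝ =>
    ‖bilinConv μ z.2 f (subTranslate (-z.1.2) (𝒟.sameCell m b z.1.2)) z.1.1‖ₑ) ?_
    measurableSet_Icc
  refine Measurable.enorm (StronglyMeasurable.integral_prod_right'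
    (f := fun z : ((Rd d × Rd d) × ℝ) × (Rd d × Rd d) => f (z.1.1.1 - z.1.2 • z.2.1) *
      subTranslate (-z.1.1.2) (𝒟.sameCell m b z.1.1.2) (z.1.1.1 - z.1.2 • z.2.2)) ?_).measurable
  refine ((hf.comp (by fun_prop)).mul ?_).stronglyMeasurable
  exact 𝒟.measurable_subTranslate_sameCell m hb (by fun_prop) (by fun_prop)

theorem lintegral_rpow_le {α : Type*} [MeasurableSpace α] (ν : Measure α) {r : ℝ} (hr : 1 < r)
    {Φ : α → ℝ≥0∞} (hΦ : AEMeasurable Φ ν) :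
    (∫⁻ y, Φ y ∂ν) ^ r ≤ ν univ ^ (r - 1) * ∫⁻ y, Φ y ^ r ∂ν := by
  have hr0 : 0 < r := one_pos.trans hr
  have hconj : r.HolderConjugate (r / (r - 1)) := Real.HolderConjugate.conjExponent hr
  have h := ENNReal.lintegral_mul_le_Lp_mul_Lq ν hconj hΦ (aemeasurable_const (b := (1 : ℝ≥0∞)))
  simp only [Pi.mul_apply, mul_one, ENNReal.one_rpow, lintegral_one, one_div_div] at h
  refine (ENNReal.rpow_le_rpow h hr0.le).trans (le_of_eq ?_)
  rw [ENNReal.mul_rpow_of_nonneg _ _ hr0.le, ← ENNReal.rpow_mul, ← ENNReal.rpow_mul,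
    one_div_mul_cancel hr0.ne', ENNReal.rpow_one, div_mul_cancel₀ _ hr0.ne', mul_comm]

/-- With V the volume of a cell, Hölder in y over a box of volume 2^d V costs (2^d V)^(r-1), and
integrating the bound M over the box costs another 2^d V. Dividing by V^r leaves (2^d)^r,
independent of the generation. -/
theorem lintegral_singleScaleMax_rpow_le (μ : Measure (Rd d × Rd d)) [IsFiniteMeasure μ] (m : ℕ)
    {f b : Rd d → ℂ} (hf : IsNice f) (hb : IsNice b)
    (hb0 : ∀ k, ∫ v in 𝒟.cell m k, b v = 0) (t : ℝ) {r : ℝ} (hr : 1 < r) {M : ℝ≥0∞}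
    (hM : ∀ y ∈ 𝒟.box m,
      ∫⁻ x, singleScaleMax μ t f (subTranslate (-y) (𝒟.sameCell m b y)) x ^ r ≤ M) :
    ∫⁻ x, singleScaleMax μ t f b x ^ r ≤ (2 ^ d : ℝ≥0∞) ^ r * M := by
  have hr0 : 0 < r := one_pos.trans hr
  set V : ℝ≥0∞ := ENNReal.ofReal (𝒟.side m) ^ d
  have hV0 : V ≠ 0 := pow_ne_zero d (ENNReal.ofReal_pos.2 (𝒟.side_pos m)).ne'
  have hVt : V ≠ ∞ := ENNReal.pow_ne_top ENNReal.ofReal_ne_top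
  set Φ : Rd d → Rd d → ℝ≥0∞ := fun x y =>
    singleScaleMax μ t f (subTranslate (-y) (𝒟.sameCell m b y)) x
  have hΦ : ∀ ν : Measure (Rd d × Rd d), SFinite ν → AEMeasurable (Function.uncurry Φ) ν :=
    fun ν _ => 𝒟.aemeasurable_singleScaleMax_sameCell μ m hf.measurable hb.measurable t ν
  have hΦx : ∀ x, AEMeasurable (Φ x) (volume.restrict (𝒟.box m)) := by
    intro x
    refine aemeasurable_biSup_of_measurable _ (Φ := fun z : Rd d × ℝ =>
      ‖bilinConv μ z.2 f (subTranslate (-z.1) (𝒟.sameCell m b z.1)) x‖ₑ) ?_ measurableSet_Icc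
    refine Measurable.enorm (StronglyMeasurable.integral_prod_right'
      (f := fun z : (Rd d × ℝ) × (Rd d × Rd d) => f (x - z.1.2 • z.2.1) *
        subTranslate (-z.1.1) (𝒟.sameCell m b z.1.1) (x - z.1.2 • z.2.2)) ?_).measurable
    refine ((hf.measurable.comp (by fun_prop)).mul ?_).stronglyMeasurable
    exact 𝒟.measurable_subTranslate_sameCell m hb.measurable (by fun_prop) (by fun_prop)
  have hpt : ∀ x, V ^ r * singleScaleMax μ t f b x ^ r ≤
      (2 ^ d * V) ^ (r - 1) * ∫⁻ y in 𝒟.box m, Φ x y ^ r := by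
    intro x
    rw [← ENNReal.mul_rpow_of_nonneg _ _ hr0.le]
    refine (ENNReal.rpow_le_rpow (𝒟.singleScaleMax_le_lintegral_box μ m hf hb hb0 t x)
      hr0.le).trans ((lintegral_rpow_le _ hr (hΦx x)).trans_eq ?_)
    rw [Measure.restrict_apply_univ, volume_box]
  have hmain : V ^ r * ∫⁻ x, singleScaleMax μ t f b x ^ r ≤ (2 ^ d * V) ^ r * M := by
    rw [← lintegral_const_mul' _ _ (ENNReal.rpow_ne_top_of_nonneg hr0.le hVt)]
    refine (lintegral_mono hpt).trans ?_
    rw [lintegral_const_mul' _ _ (ENNReal.rpow_ne_top_of_nonneg (by linarith)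
      (ENNReal.mul_ne_top (by simp) hVt)),
      lintegral_lintegral_swap ((hΦ _ inferInstance).pow_const r)]
    have h2 : ∫⁻ y in 𝒟.box m, ∫⁻ x, Φ x y ^ r ≤ M * (2 ^ d * V) := by
      refine (setLIntegral_mono measurable_const hM).trans (le_of_eq ?_)
      rw [setLIntegral_const, volume_box]
    refine (mul_le_mul_right h2 _).trans (le_of_eq ?_)
    rw [mul_comm M, ← mul_assoc]
    congr 1
    nth_rewrite 2 [← ENNReal.rpow_one (2 ^ d * V)]
    rw [← ENNReal.rpow_add _ _ (mul_ne_zero (by simp) hV0) (ENNReal.mul_ne_top (by simp) hVt)]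
    congr 1
    ring
  rw [ENNReal.mul_rpow_of_nonneg _ _ hr0.le, mul_comm ((2 ^ d : ℝ≥0∞) ^ r), mul_assoc] at hmain
  exact (ENNReal.mul_le_mul_iff_right (ENNReal.rpow_pos (pos_iff_ne_zero.2 hV0) hVt).ne'
    (ENNReal.rpow_ne_top_of_nonneg hr0.le hVt)).1 hmain

end Grid

end BilinearSparse

/-! ### Geometric decay for functions with cancellation on small subcubes -/

namespace BilinearSparse

open Filter Topology

variable {d : ℕ}

/-- Decay in `j` of `L_{⋆}` on pairs of functions living in a cube of the scale of the operator, if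
the second function has mean zero on all subcubes that are `j` generations younger. -/
def LocalDecay (μ : Measure (Rd d × Rd d)) (p q r δ : ℝ) (C θ : ℝ≥0) : Prop :=
  ∀ (𝒟 : Grid d) (n j : ℕ) (k : Fin d → ℤ) (f b : Rd d → ℂ),
    IsNice f → IsNice b → (∀ x, f x ≠ 0 → x ∈ 𝒟.cell n k) → (∀ x, b x ≠ 0 → x ∈ 𝒟.cell n k) →
    (∀ l, ∫ v in 𝒟.cell (n + j) l, b v = 0) →
      ∫⁻ x, singleScaleMax μ (δ * 𝒟.side n) f b x ^ r ≤
        (C * θ ^ j * ENNReal.ofReal (𝒟.side n) ^ ((d : ℝ) * (1 / r - 1 / p - 1 / q)) *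
          eLpNorm f (ENNReal.ofReal p) volume * eLpNorm b (ENNReal.ofReal q) volume) ^ r

/-- Mean zero on cells of generation n + j makes b an average of differences with |y| ≤ d · side(n)
· 2^(-j). At scale δ · side(n) the continuity factor is thus at most (d/δ)^η 2^(-ηj). The separation
constant d/δ appears because the diameter bound d · side(n) of a cell equals (d/δ) times the scale.
-/
theorem OneSidedContinuity.exists_localDecay {μ : Measure (Rd d × Rd d)} [IsFiniteMeasure μ]
    {p q r η δ : ℝ} (hr : 1 < r) (hη : 0 < η) (hδ : 0 < δ)
    (h : OneSidedContinuity μ p q r η (d / δ)) :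
    ∃ C θ : ℝ≥0, θ < 1 ∧ LocalDecay μ p q r δ C θ := by
  obtain ⟨C, hC⟩ := h
  have hr0 : 0 < r := one_pos.trans hr
  set a : ℝ := (d : ℝ) * (1 / r - 1 / p - 1 / q)
  set θ : ℝ≥0 := ⟨2 ^ (-η), by positivity⟩
  set C₁ : ℝ≥0 := ⟨δ ^ a * (d / δ) ^ η, by positivity⟩
  refine ⟨2 ^ d * (C * C₁), θ, ?_, fun 𝒟 n j k f b hf hb hfs hbs hb0 => ?_⟩
  · exact NNReal.coe_lt_coe.1 (Real.rpow_lt_one_of_one_lt_of_neg one_lt_two (neg_neg_of_pos hη))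
  have hs := 𝒟.side_pos n
  set M : ℝ≥0∞ := C * C₁ * θ ^ j * ENNReal.ofReal (𝒟.side n) ^ a *
    eLpNorm f (ENNReal.ofReal p) volume * eLpNorm b (ENNReal.ofReal q) volume
  have key := 𝒟.lintegral_singleScaleMax_rpow_le μ (n + j) hf hb hb0 (δ * 𝒟.side n) hr
    (M := M ^ r) fun y hy => ?_
  · refine key.trans (le_of_eq ?_)
    rw [← ENNReal.mul_rpow_of_nonneg _ _ hr0.le]
    congr 1
    simp only [M, ENNReal.coe_mul, ENNReal.coe_pow, ENNReal.coe_ofNat]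
    ring
  -- A translation pairing points of one small cell never leaves the ambient cube, so the
  -- differences are still supported there.
  have hcell : ∀ v, subTranslate (-y) (𝒟.sameCell (n + j) b y) v ≠ 0 → v ∈ 𝒟.cell n k := by
    intro v hv
    rw [𝒟.subTranslate_sameCell] at hv
    by_cases h1 : 𝒟.sameCell (n + j) b y v = 0
    · rw [h1, zero_sub, neg_ne_zero] at hv
      obtain ⟨h2, h3⟩ := 𝒟.sameCell_add_ne_zero hv
      rw [𝒟.mem_cell, ← 𝒟.index_eq_of_le (Nat.le_add_right n j) h2]
      exact hbs _ h3
    · exact hbs _ (𝒟.sameCell_ne_zero h1).2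
  have h1 := hC (δ * 𝒟.side n) (by positivity) (-y) f (𝒟.sameCell (n + j) b y) hf
    (𝒟.isNice_sameCell _ hb y) fun u v hu hv => by
      have h2 := 𝒟.norm_sub_le_of_index_eq (n := n) (x := u) (y := v)
        ((𝒟.mem_cell.1 (hfs u hu)).trans (𝒟.mem_cell.1 (hcell v hv)).symm)
      refine h2.trans (le_of_eq ?_)
      field_simp
  have h3 := eLpNorm_ofReal_rpow hr0 volume (singleScaleMax μ (δ * 𝒟.side n) f
    (subTranslate (-y) (𝒟.sameCell (n + j) b y)))
  simp only [enorm_eq_self] at h3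
  rw [← h3]
  refine ENNReal.rpow_le_rpow (h1.trans ?_) hr0.le
  simp only [M]
  gcongr ?_ * _ * ?_
  · rw [mul_assoc (C : ℝ≥0∞), mul_assoc (C : ℝ≥0∞)]
    gcongr
    have h4 : ‖-y‖ / (δ * 𝒟.side n) ≤ d / δ * (2 ^ j)⁻¹ := by
      rw [norm_neg, div_le_iff₀ (by positivity)]
      refine (Grid.norm_le_of_forall_abs_le (𝒟.side_pos (n + j)).le fun i => (hy i).le).trans
        (le_of_eq ?_)
      rw [𝒟.side_add]
      field_simp
    have h5 : (δ * 𝒟.side n) ^ a * (‖-y‖ / (δ * 𝒟.side n)) ^ η ≤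
        δ ^ a * (d / δ) ^ η * (2 ^ (-η)) ^ j * 𝒟.side n ^ a := by
      have h6 : (‖-y‖ / (δ * 𝒟.side n)) ^ η ≤ (d / δ) ^ η * (2 ^ (-η)) ^ j := by
        refine (Real.rpow_le_rpow (by positivity) h4 hη.le).trans (le_of_eq ?_)
        rw [Real.mul_rpow (by positivity) (by positivity)]
        congr 1
        rw [Real.inv_rpow (by positivity), ← Real.rpow_natCast, ← Real.rpow_mul (by norm_num),
          ← Real.rpow_natCast, ← Real.rpow_mul (by norm_num), ← Real.rpow_neg (by norm_num)]
        congr 1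
        ring
      rw [Real.mul_rpow hδ.le hs.le]
      calc _ ≤ δ ^ a * 𝒟.side n ^ a * ((d / δ) ^ η * (2 ^ (-η)) ^ j) := by gcongr
        _ = _ := by ring
    refine (ENNReal.ofReal_le_ofReal h5).trans (le_of_eq ?_)
    rw [ENNReal.ofReal_mul (by positivity), ENNReal.ofReal_mul (by positivity),
      ENNReal.ofReal_pow (by positivity), ENNReal.ofReal_rpow_of_pos hs]
    congr 2
    · exact ENNReal.ofReal_eq_coe_nnreal (by positivity)
    · exact congrArg (· ^ j) (ENNReal.ofReal_eq_coe_nnreal (by positivity))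
  · exact eLpNorm_mono_enorm_ae (ae_of_all _ fun u => enorm_le_iff_norm_le.2
      (𝒟.norm_sameCell_le _ b y u))

end BilinearSparse

/-! ### Stopping times and summation over scales at a fixed generation gap -/

namespace BilinearSparse

open Filter Topology

variable {d : ℕ}

theorem aemeasurable_singleScaleMax (μ : Measure (Rd d × Rd d)) [SFinite μ] {f g : Rd d → ℂ}
    (hf : Measurable f) (hg : Measurable g) (t : ℝ) :
    AEMeasurable (singleScaleMax μ t f g) volume :=
  aemeasurable_biSup_of_measurable volume (measurable_bilinConv μ hf hg).enorm measurableSet_Icc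

theorem singleScaleMax_add_right_le (μ : Measure (Rd d × Rd d)) [IsFiniteMeasure μ]
    {f g h : Rd d → ℂ} (hf : IsNice f) (hg : IsNice g) (hh : IsNice h) (t : ℝ) (x : Rd d) :
    singleScaleMax μ t f (fun u => g u + h u) x ≤
      singleScaleMax μ t f g x + singleScaleMax μ t f h x := by
  refine iSup₂_le fun s hs => ?_
  have h1 : bilinConv μ s f (fun u => g u + h u) x = bilinConv μ s f g x + bilinConv μ s f h x := by
    unfold bilinConv
    rw [← integral_add (hf.integrable_mul hg μ s x) (hf.integrable_mul hh μ s x)]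
    simp only [mul_add]
  rw [h1]
  exact (enorm_add_le _ _).trans (add_le_add
    (le_biSup (fun s => ‖bilinConv μ s f g x‖ₑ) hs) (le_biSup (fun s => ‖bilinConv μ s f h x‖ₑ) hs))

theorem singleScaleMax_zero_right (μ : Measure (Rd d × Rd d)) (f : Rd d → ℂ) (t : ℝ) (x : Rd d) :
    singleScaleMax μ t f (fun _ => 0) x = 0 := by
  simp [singleScaleMax, bilinConv]

theorem IsNice.zero : IsNice (fun _ : Rd d => (0 : ℂ)) where
  measurable := measurable_const
  exists_bound := ⟨0, by simp⟩
  exists_support := ⟨0, by simp⟩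

theorem IsNice.sum {ι : Type*} (s : Finset ι) {g : ι → Rd d → ℂ} (hg : ∀ i, IsNice (g i)) :
    IsNice fun u => ∑ i ∈ s, g i u := by
  classical
  induction s using Finset.induction_on with
  | empty => simpa using IsNice.zero
  | insert i s hi ih => simpa only [Finset.sum_insert hi] using (hg i).add ih

theorem singleScaleMax_sum_right_le (μ : Measure (Rd d × Rd d)) [IsFiniteMeasure μ]
    {ι : Type*} (s : Finset ι) {f : Rd d → ℂ} {g : ι → Rd d → ℂ} (hf : IsNice f)
    (hg : ∀ i, IsNice (g i)) (t : ℝ) (x : Rd d) :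
    singleScaleMax μ t f (fun u => ∑ i ∈ s, g i u) x ≤ ∑ i ∈ s, singleScaleMax μ t f (g i) x := by
  classical
  induction s using Finset.induction_on with
  | empty => simp [singleScaleMax_zero_right]
  | insert i s hi ih =>
    simp only [Finset.sum_insert hi]
    exact (singleScaleMax_add_right_le μ hf (hg i) (IsNice.sum s hg) t x).trans
      (add_le_add le_rfl ih)

namespace Grid

variable (𝒟 : Grid d)

/-- Stopping times with values in `(n₀, N]`: the cube of generation `κ x` around `x` determines
whether one stops there. -/
structure IsStopping (n₀ N : ℕ) (κ : Rd d → ℕ) : Prop where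
  lt : ∀ x, n₀ < κ x
  le : ∀ x, κ x ≤ N
  eq : ∀ x y, 𝒟.index (κ x) y = 𝒟.index (κ x) x → κ y = κ x

variable {𝒟}

/-- Had y stopped at generation n or earlier, its stopping cube would contain x and x would have
stopped there too. -/
theorem IsStopping.lt_of_index_eq {n₀ N : ℕ} {κ : Rd d → ℕ} (hκ : 𝒟.IsStopping n₀ N κ) {n : ℕ}
    {x y : Rd d} (h : 𝒟.index n x = 𝒟.index n y) (hx : n < κ x) : n < κ y := by
  by_contra! hy
  have := hκ.eq y x (𝒟.index_eq_of_le hy h)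
  omega

theorem measurableSet_of_index_invariant (n : ℕ) {E : Set (Rd d)}
    (hE : ∀ x y, 𝒟.index n x = 𝒟.index n y → x ∈ E → y ∈ E) : MeasurableSet E := by
  have : E = 𝒟.index n ⁻¹' (𝒟.index n '' E) := by
    ext y
    exact ⟨fun h => ⟨y, h, rfl⟩, fun ⟨x, hx, hxy⟩ => hE x y hxy hx⟩
  rw [this]
  exact 𝒟.measurable_index n (to_countable _).measurableSet

theorem IsStopping.measurableSet_eq {n₀ N : ℕ} {κ : Rd d → ℕ} (hκ : 𝒟.IsStopping n₀ N κ) (m : ℕ) :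
    MeasurableSet {x | κ x = m} :=
  measurableSet_of_index_invariant (𝒟 := 𝒟) m fun x y hxy (hx : κ x = m) => by
    have := hκ.eq x y (by rw [hx, hxy])
    exact this.trans hx

theorem IsStopping.measurableSet_lt {n₀ N : ℕ} {κ : Rd d → ℕ} (hκ : 𝒟.IsStopping n₀ N κ) (m : ℕ) :
    MeasurableSet {x | m < κ x} :=
  measurableSet_of_index_invariant (𝒟 := 𝒟) m fun _ _ hxy hx => hκ.lt_of_index_eq hxy hx

theorem aemeasurable_of_cell (n : ℕ) {Φ : (Fin d → ℤ) → Rd d → ℝ≥0∞}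
    (h : ∀ k, AEMeasurable (Φ k) volume) :
    AEMeasurable (fun x => Φ (𝒟.index n x) x) volume := by
  rw [← Measure.restrict_univ (μ := volume), ← 𝒟.iUnion_cell n, aemeasurable_iUnion_iff]
  intro k
  refine ((h k).mono_measure Measure.restrict_le_self).congr ?_
  filter_upwards [ae_restrict_mem (𝒟.measurableSet_cell n k)] with x hx
  rw [𝒟.mem_cell.1 hx]

theorem IsStopping.aemeasurable_biSup {n₀ N : ℕ} {κ : Rd d → ℕ} (hκ : 𝒟.IsStopping n₀ N κ)
    {Φ : ℕ → Rd d → ℝ≥0∞} (h : ∀ n, AEMeasurable (Φ n) volume) :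
    AEMeasurable (fun x => ⨆ n ∈ Ico n₀ (κ x), Φ n x) volume := by
  refine AEMeasurable.iSup fun n => ?_
  by_cases hn : n₀ ≤ n
  · have : (fun x => ⨆ (_ : n ∈ Ico n₀ (κ x)), Φ n x) = {x | n < κ x}.indicator (Φ n) := by
      ext x
      by_cases hx : n < κ x <;> simp [hn, hx]
    rw [this]
    exact (h n).indicator (hκ.measurableSet_lt n)
  · simp [hn]

theorem isNice_indicator_cell {f : Rd d → ℂ} (hf : IsNice f) (n : ℕ) (k : Fin d → ℤ) :
    IsNice ((𝒟.cell n k).indicator f) := hf.indicator (𝒟.measurableSet_cell n k)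

theorem lintegral_enorm_indicator_rpow {f : Rd d → ℂ} {E : Set (Rd d)} (hE : MeasurableSet E)
    {p : ℝ} (hp : 0 < p) : ∫⁻ x, ‖E.indicator f x‖ₑ ^ p = ∫⁻ x in E, ‖f x‖ₑ ^ p := by
  rw [← lintegral_indicator hE]
  refine lintegral_congr fun x => ?_
  by_cases hx : x ∈ E <;> simp [hx, hp]

theorem eLpNorm_indicator_eq {f : Rd d → ℂ} {E : Set (Rd d)} (hE : MeasurableSet E)
    {p : ℝ} (hp : 0 < p) :
    eLpNorm (E.indicator f) (ENNReal.ofReal p) volume = (∫⁻ x in E, ‖f x‖ₑ ^ p) ^ (1 / p) := by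
  rw [← lintegral_enorm_indicator_rpow hE hp, ← eLpNorm_ofReal_rpow hp, ← ENNReal.rpow_mul,
    mul_one_div_cancel hp.ne', ENNReal.rpow_one]

/-- Scale-invariant form of the exponent count behind the sparse bound on one cube. -/
theorem rpow_exponent_count {s A X Y α β : ℝ≥0∞} (hs0 : s ≠ 0) (hst : s ≠ ∞) {p q r : ℝ}
    (hp : 0 < p) (hq : 0 < q) (hqr : q ≤ r) (hY : Y ≤ α ^ p * s ^ d) (hX : X ≤ β ^ q * s ^ d) :
    (A * s ^ ((d : ℝ) * (1 / r - 1 / p - 1 / q)) * Y ^ (1 / p) * X ^ (1 / q)) ^ r ≤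
      A ^ r * α ^ r * β ^ (r - q) * X := by
  have hr : 0 < r := hq.trans_le hqr
  have hY' : Y ^ (1 / p) ≤ α * s ^ (d / p : ℝ) := by
    refine (ENNReal.rpow_le_rpow hY (by positivity)).trans (le_of_eq ?_)
    rw [ENNReal.mul_rpow_of_nonneg _ _ (by positivity), ← ENNReal.rpow_mul, mul_one_div_cancel hp.ne',
      ENNReal.rpow_one, ← ENNReal.rpow_natCast, ← ENNReal.rpow_mul, mul_one_div]
  -- One power of X is kept, to be summed later over disjoint pieces; the remaining exponent (r-q)/q
  -- is nonnegative because q ≤ r and is spent on the bound by β.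
  have hX' : (X ^ (1 / q)) ^ r ≤ X * (β ^ (r - q) * s ^ (d * (r - q) / q : ℝ)) := by
    rw [← ENNReal.rpow_mul, show 1 / q * r = 1 + (r - q) / q by field_simp; ring,
      ENNReal.rpow_add_of_nonneg _ _ zero_le_one (div_nonneg (sub_nonneg.2 hqr) hq.le),
      ENNReal.rpow_one]
    gcongr
    refine (ENNReal.rpow_le_rpow hX (div_nonneg (sub_nonneg.2 hqr) hq.le)).trans (le_of_eq ?_)
    rw [ENNReal.mul_rpow_of_nonneg _ _ (div_nonneg (sub_nonneg.2 hqr) hq.le), ← ENNReal.rpow_mul,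
      mul_div_cancel₀ _ hq.ne', ← ENNReal.rpow_natCast, ← ENNReal.rpow_mul, mul_div_assoc]
  rw [ENNReal.mul_rpow_of_nonneg _ _ hr.le, ENNReal.mul_rpow_of_nonneg _ _ hr.le,
    ENNReal.mul_rpow_of_nonneg _ _ hr.le]
  calc A ^ r * (s ^ ((d : ℝ) * (1 / r - 1 / p - 1 / q))) ^ r * (Y ^ (1 / p)) ^ r * (X ^ (1 / q)) ^ r
      ≤ A ^ r * (s ^ ((d : ℝ) * (1 / r - 1 / p - 1 / q))) ^ r * (α * s ^ (d / p : ℝ)) ^ r *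
        (X * (β ^ (r - q) * s ^ (d * (r - q) / q : ℝ))) := by gcongr
    _ = A ^ r * α ^ r * β ^ (r - q) * X * (s ^ ((d : ℝ) * (1 / r - 1 / p - 1 / q) * r) *
        s ^ (d / p * r : ℝ) * s ^ (d * (r - q) / q : ℝ)) := by
      rw [ENNReal.mul_rpow_of_nonneg _ _ hr.le, ← ENNReal.rpow_mul, ← ENNReal.rpow_mul]
      ring
    _ = _ := by
      rw [← ENNReal.rpow_add _ _ hs0 hst, ← ENNReal.rpow_add _ _ hs0 hst]
      have : (d : ℝ) * (1 / r - 1 / p - 1 / q) * r + d / p * r + d * (r - q) / q = 0 := by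
        field_simp
        ring
      rw [this, ENNReal.rpow_zero, mul_one]

/-- Restricting to {κ = m} keeps whole stopping cubes: a cell of generation m is either a stopping
cube inside the given cube, where b has mean zero, or disjoint from the restricted set. -/
theorem setIntegral_indicator_stopping {n₀ N : ℕ} {κ : Rd d → ℕ} (hκ : 𝒟.IsStopping n₀ N κ)
    {b : Rd d → ℂ} {n m : ℕ} (hnm : n ≤ m) {k : Fin d → ℤ}
    (hb : ∀ x ∈ 𝒟.cell n k, ∫ v in 𝒟.cell (κ x) (𝒟.index (κ x) x), b v = 0) (l : Fin d → ℤ) :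
    ∫ v in 𝒟.cell m l, (𝒟.cell n k ∩ {x | κ x = m}).indicator b v = 0 := by
  by_cases h : ∃ x ∈ 𝒟.cell m l, x ∈ 𝒟.cell n k ∧ κ x = m
  · obtain ⟨x, hxl, hxk, hx⟩ := h
    rw [mem_cell] at hxl hxk
    rw [← hb x hxk, hx, hxl]
    refine setIntegral_congr_fun (𝒟.measurableSet_cell m l) fun v hv => ?_
    have hv' : 𝒟.index m v = 𝒟.index m x := (𝒟.mem_cell.1 hv).trans hxl.symm
    have h1 : v ∈ 𝒟.cell n k ∩ {x | κ x = m} := by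
      refine ⟨(𝒟.index_eq_of_le hnm hv').trans hxk, ?_⟩
      have := hκ.eq x v (by rw [hx, hv'])
      exact this.trans hx
    exact indicator_of_mem h1 b
  · push Not at h
    rw [← integral_zero (Rd d) ℂ (μ := volume.restrict (𝒟.cell m l))]
    refine setIntegral_congr_fun (𝒟.measurableSet_cell m l) fun v hv => ?_
    exact indicator_of_notMem (fun h1 => h v hv h1.1 h1.2) b

/-- The estimate for the part of a bad function that is `j` generations younger than the cube. -/
theorem IsStopping.lintegral_biSup_rpow_le {μ : Measure (Rd d × Rd d)} [SFinite μ] {p q r δ : ℝ}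
    (hp : 0 < p) (hq : 0 < q) (hqr : q ≤ r) {C θ : ℝ≥0}
    (hC : LocalDecay μ p q r δ C θ)
    {n₀ N : ℕ} {κ : Rd d → ℕ} (hκ : 𝒟.IsStopping n₀ N κ) {k₀ : Fin d → ℤ} {f b : Rd d → ℂ}
    (hf : IsNice f) (hb : IsNice b) {α β : ℝ≥0∞}
    (hα : ∀ x ∈ 𝒟.cell n₀ k₀, ∀ n ∈ Ico n₀ (κ x),
      ∫⁻ v in 𝒟.cell n (𝒟.index n x), ‖f v‖ₑ ^ p ≤ α ^ p * ENNReal.ofReal (𝒟.side n) ^ d)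
    (hβ : ∀ x ∈ 𝒟.cell n₀ k₀, ∀ n ∈ Ico n₀ (κ x),
      ∫⁻ v in 𝒟.cell n (𝒟.index n x), ‖b v‖ₑ ^ q ≤ β ^ q * ENNReal.ofReal (𝒟.side n) ^ d)
    (hb0 : ∀ x ∈ 𝒟.cell n₀ k₀, ∫ v in 𝒟.cell (κ x) (𝒟.index (κ x) x), b v = 0) (j : ℕ) :
    ∫⁻ x in 𝒟.cell n₀ k₀, (⨆ n ∈ Ico n₀ (κ x), singleScaleMax μ (δ * 𝒟.side n)
      ((𝒟.cell n (𝒟.index n x)).indicator f)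
      ((𝒟.cell n (𝒟.index n x) ∩ {x | κ x = n + j}).indicator b) x) ^ r ≤
      (C * θ ^ j * α * β) ^ r * ENNReal.ofReal (𝒟.side n₀) ^ d := by
  have hr : 0 < r := hq.trans_le hqr
  set A : ℝ≥0∞ := C * θ ^ j
  set S : ℕ → (Fin d → ℤ) → Rd d → ℝ≥0∞ := fun n k => singleScaleMax μ (δ * 𝒟.side n)
      ((𝒟.cell n k).indicator f) ((𝒟.cell n k ∩ {x | κ x = n + j}).indicator b)
  set K : ℝ≥0∞ := A ^ r * α ^ r * β ^ (r - q)
  set Q₀ := 𝒟.cell n₀ k₀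
  have hQ₀ : MeasurableSet Q₀ := 𝒟.measurableSet_cell _ _
  -- one cube
  have hcube : ∀ n k, n₀ ≤ n → ∀ x₀ ∈ 𝒟.cell n k, x₀ ∈ Q₀ → n < κ x₀ →
      ∫⁻ x, S n k x ^ r ≤ K * ∫⁻ v in 𝒟.cell n k, Q₀.indicator
        ({x | κ x = n + j}.indicator fun v => ‖b v‖ₑ ^ q) v := by
    intro n k hn x₀ hx₀ hx₀Q hx₀κ
    rw [𝒟.mem_cell] at hx₀
    subst hx₀
    have hE : MeasurableSet (𝒟.cell n (𝒟.index n x₀) ∩ {x | κ x = n + j}) :=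
      (𝒟.measurableSet_cell _ _).inter (hκ.measurableSet_eq _)
    have hsub : ∀ x ∈ 𝒟.cell n (𝒟.index n x₀), x ∈ Q₀ := fun x hx =>
      (𝒟.index_eq_of_le hn hx).trans hx₀Q
    refine (hC 𝒟 n j (𝒟.index n x₀) _ _ (isNice_indicator_cell hf _ _) (hb.indicator hE)
      (fun x hx => mem_of_indicator_ne_zero hx) (fun x hx => (mem_of_indicator_ne_zero hx).1)
      (fun l => setIntegral_indicator_stopping hκ (Nat.le_add_right n j)
        (fun x hx => hb0 x (hsub x hx)) l)).trans ?_
    rw [eLpNorm_indicator_eq (𝒟.measurableSet_cell _ _) hp, eLpNorm_indicator_eq hE hq]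
    refine (rpow_exponent_count (ENNReal.ofReal_pos.2 (𝒟.side_pos n)).ne' ENNReal.ofReal_ne_top
      hp hq hqr (hα x₀ hx₀Q n ⟨hn, hx₀κ⟩) ((lintegral_mono_set inter_subset_left).trans
        (hβ x₀ hx₀Q n ⟨hn, hx₀κ⟩))).trans (le_of_eq ?_)
    congr 1
    rw [inter_comm, ← Measure.restrict_restrict (hκ.measurableSet_eq _),
      ← lintegral_indicator (hκ.measurableSet_eq _)]
    refine setLIntegral_congr_fun (𝒟.measurableSet_cell _ _) fun v hv => ?_
    exact (indicator_of_mem (hsub v hv) _).symm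
  -- one generation
  have hgen : ∀ n, n₀ ≤ n → ∫⁻ x in Q₀, {x | n < κ x}.indicator
      (fun x => S n (𝒟.index n x) x ^ r) x ≤
      K * ∫⁻ v in Q₀, {x | κ x = n + j}.indicator (fun v => ‖b v‖ₑ ^ q) v := by
    intro n hn
    rw [← lintegral_indicator hQ₀, ← lintegral_indicator hQ₀, 𝒟.lintegral_eq_tsum_cell n,
      𝒟.lintegral_eq_tsum_cell n volume (Q₀.indicator _), ← ENNReal.tsum_mul_left]
    refine ENNReal.tsum_le_tsum fun k => ?_
    by_cases h : ∃ x₀ ∈ 𝒟.cell n k, x₀ ∈ Q₀ ∧ n < κ x₀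
    · obtain ⟨x₀, h1, h2, h3⟩ := h
      refine le_trans ?_ (hcube n k hn x₀ h1 h2 h3)
      refine le_trans (setLIntegral_mono' (𝒟.measurableSet_cell _ _) fun x hx => ?_)
        (setLIntegral_le_lintegral _ _)
      refine (indicator_le_self _ _ x).trans ((indicator_le_self _ _ x).trans (le_of_eq ?_))
      rw [𝒟.mem_cell.1 hx]
    · push Not at h
      refine le_trans (le_of_eq ?_) zero_le
      rw [← lintegral_zero (μ := volume.restrict (𝒟.cell n k))]
      refine setLIntegral_congr_fun (𝒟.measurableSet_cell _ _) fun x hx => ?_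
      by_cases hxQ : x ∈ Q₀
      · rw [indicator_of_mem hxQ]
        exact indicator_of_notMem (show x ∉ {x | n < κ x} from not_lt.2 (h x hx hxQ)) _
      · exact indicator_of_notMem hxQ _
  -- the sum over all generations
  obtain ⟨x₀, hx₀⟩ : Q₀.Nonempty := nonempty_of_measure_ne_zero (𝒟.volume_cell_pos n₀ k₀).ne'
  have htot : ∑ n ∈ Finset.Ico n₀ N, ∫⁻ v in Q₀, {x | κ x = n + j}.indicator
      (fun v => ‖b v‖ₑ ^ q) v ≤ β ^ q * ENNReal.ofReal (𝒟.side n₀) ^ d := by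
    have h1 := hβ x₀ hx₀ n₀ ⟨le_rfl, hκ.lt x₀⟩
    rw [𝒟.mem_cell.1 hx₀] at h1
    refine le_trans ?_ h1
    rw [← lintegral_finsetSum' _ fun n _ => ((hb.measurable.enorm.pow_const q).indicator
      (hκ.measurableSet_eq _)).aemeasurable]
    refine lintegral_mono fun v => ?_
    -- For fixed j the sets {κ = n + j} are disjoint in n, so the pieces of b at all scales together
    -- cost only one integral of |b|^q.
    by_cases hv : ∃ n ∈ Finset.Ico n₀ N, κ v = n + j
    · obtain ⟨n, hn, hvn⟩ := hv
      rw [Finset.sum_eq_single_of_mem n hn]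
      · exact indicator_le_self _ _ v
      · intro n' _ hne
        have hv' : v ∉ {x | κ x = n' + j} := fun h => hne (by
          have h' : κ v = n' + j := h
          omega)
        exact indicator_of_notMem hv' _
    · push Not at hv
      rw [Finset.sum_eq_zero fun n hn => indicator_of_notMem
        (show v ∉ {x | κ x = n + j} from hv n hn) _]
      exact zero_le
  calc _ ≤ ∫⁻ x in Q₀, ∑ n ∈ Finset.Ico n₀ N, {x | n < κ x}.indicator
        (fun x => S n (𝒟.index n x) x ^ r) x := by
        refine lintegral_mono fun x => ?_
        -- The r-th power of the supremum is dominated by the sum of the r-th powers.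
        have h1 : ∀ n ∈ Ico n₀ (κ x), S n (𝒟.index n x) x ≤ (∑ n ∈ Finset.Ico n₀ N,
            {x | n < κ x}.indicator (fun x => S n (𝒟.index n x) x ^ r) x) ^ r⁻¹ := by
          intro n hn
          rw [ENNReal.le_rpow_inv_iff hr]
          refine le_trans (le_of_eq ?_) (Finset.single_le_sum (fun _ _ => zero_le)
            (Finset.mem_Ico.2 ⟨hn.1, hn.2.trans_le (hκ.le x)⟩))
          exact (indicator_of_mem (show x ∈ {x | n < κ x} from hn.2)
            (fun x => S n (𝒟.index n x) x ^ r)).symm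
        have h2 := iSup₂_le h1
        rwa [ENNReal.le_rpow_inv_iff hr] at h2
    _ = ∑ n ∈ Finset.Ico n₀ N, ∫⁻ x in Q₀, {x | n < κ x}.indicator
        (fun x => S n (𝒟.index n x) x ^ r) x := by
        refine lintegral_finsetSum' _ fun n _ => AEMeasurable.restrict ?_
        refine AEMeasurable.indicator ?_ (hκ.measurableSet_lt n)
        refine (aemeasurable_of_cell n fun k => ?_).pow_const r
        exact aemeasurable_singleScaleMax μ (isNice_indicator_cell hf n k).measurable
          (hb.indicator ((𝒟.measurableSet_cell n k).inter (hκ.measurableSet_eq _))).measurable _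
    _ ≤ ∑ n ∈ Finset.Ico n₀ N, K * ∫⁻ v in Q₀, {x | κ x = n + j}.indicator
        (fun v => ‖b v‖ₑ ^ q) v :=
        Finset.sum_le_sum fun n hn => hgen n (Finset.mem_Ico.1 hn).1
    _ ≤ K * (β ^ q * ENNReal.ofReal (𝒟.side n₀) ^ d) := by
        rw [← Finset.mul_sum]
        gcongr
    _ = _ := by
        rw [ENNReal.mul_rpow_of_nonneg _ _ hr.le, ENNReal.mul_rpow_of_nonneg _ _ hr.le]
        simp only [K]
        rw [← mul_assoc, mul_assoc (A ^ r * α ^ r), ← ENNReal.rpow_add_of_nonneg _ _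
          (sub_nonneg.2 hqr) hq.le, sub_add_cancel]

end Grid

end BilinearSparse

/-! ### Summation over generation gaps; averages over stopping cubes -/

namespace BilinearSparse

open Filter Topology

variable {d : ℕ}

namespace Grid

variable {𝒟 : Grid d}

/-- The estimate for a bad function in the second argument. -/
theorem IsStopping.lintegral_biSup_mul_le {μ : Measure (Rd d × Rd d)} [IsFiniteMeasure μ]
    {p q r δ : ℝ} (hp : 0 < p) (hq : 0 < q) (hqr : q ≤ r) (hr : 1 < r) {C θ : ℝ≥0}
    (hC : LocalDecay μ p q r δ C θ)
    {n₀ N : ℕ} {κ : Rd d → ℕ} (hκ : 𝒟.IsStopping n₀ N κ) {k₀ : Fin d → ℤ} {f b : Rd d → ℂ}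
    (hf : IsNice f) (hb : IsNice b) {α β : ℝ≥0∞}
    (hα : ∀ x ∈ 𝒟.cell n₀ k₀, ∀ n ∈ Ico n₀ (κ x),
      ∫⁻ v in 𝒟.cell n (𝒟.index n x), ‖f v‖ₑ ^ p ≤ α ^ p * ENNReal.ofReal (𝒟.side n) ^ d)
    (hβ : ∀ x ∈ 𝒟.cell n₀ k₀, ∀ n ∈ Ico n₀ (κ x),
      ∫⁻ v in 𝒟.cell n (𝒟.index n x), ‖b v‖ₑ ^ q ≤ β ^ q * ENNReal.ofReal (𝒟.side n) ^ d)
    (hb0 : ∀ x ∈ 𝒟.cell n₀ k₀, ∫ v in 𝒟.cell (κ x) (𝒟.index (κ x) x), b v = 0)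
    {H : Rd d → ℝ≥0∞} (hH : AEMeasurable H volume) :
    ∫⁻ x in 𝒟.cell n₀ k₀, (⨆ n ∈ Ico n₀ (κ x), singleScaleMax μ (δ * 𝒟.side n)
      ((𝒟.cell n (𝒟.index n x)).indicator f) ((𝒟.cell n (𝒟.index n x)).indicator b) x) * H x ≤
      C * (1 - θ : ℝ≥0∞)⁻¹ * (α * β * (ENNReal.ofReal (𝒟.side n₀) ^ d) ^ (1 / r) *
        (∫⁻ x in 𝒟.cell n₀ k₀, H x ^ (r / (r - 1))) ^ (1 / (r / (r - 1)))) := by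
  have hr0 : 0 < r := one_pos.trans hr
  set Q₀ := 𝒟.cell n₀ k₀
  have hQ₀ : MeasurableSet Q₀ := 𝒟.measurableSet_cell _ _
  set T : ℕ → Rd d → ℝ≥0∞ := fun j x => ⨆ n ∈ Ico n₀ (κ x), singleScaleMax μ (δ * 𝒟.side n)
      ((𝒟.cell n (𝒟.index n x)).indicator f)
      ((𝒟.cell n (𝒟.index n x) ∩ {x | κ x = n + j}).indicator b) x
  have hE : ∀ n k j, MeasurableSet (𝒟.cell n k ∩ {x | κ x = n + j}) := fun n k j =>
    (𝒟.measurableSet_cell n k).inter (hκ.measurableSet_eq _)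
  have hTm : ∀ j, AEMeasurable (T j) volume := by
    intro j
    refine hκ.aemeasurable_biSup fun n => ?_
    exact aemeasurable_of_cell n (Φ := fun k => singleScaleMax μ (δ * 𝒟.side n)
      ((𝒟.cell n k).indicator f) ((𝒟.cell n k ∩ {x | κ x = n + j}).indicator b)) fun k =>
      aemeasurable_singleScaleMax μ (isNice_indicator_cell hf n k).measurable
        (hb.indicator (hE n k j)).measurable _
  have hsplit : ∀ x, (⨆ n ∈ Ico n₀ (κ x), singleScaleMax μ (δ * 𝒟.side n)
      ((𝒟.cell n (𝒟.index n x)).indicator f) ((𝒟.cell n (𝒟.index n x)).indicator b) x) ≤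
      ∑ j ∈ Finset.range (N + 1), T j x := by
    intro x
    refine iSup₂_le fun n hn => ?_
    -- Every point u of the cube has n < κ u ≤ N, so b splits according to the gap j = κ u - n,
    -- which is at most N.
    have hsum : (𝒟.cell n (𝒟.index n x)).indicator b = fun u => ∑ j ∈ Finset.range (N + 1),
        (𝒟.cell n (𝒟.index n x) ∩ {x | κ x = n + j}).indicator b u := by
      ext u
      by_cases hu : u ∈ 𝒟.cell n (𝒟.index n x)
      · have h1 : n < κ u := hκ.lt_of_index_eq (𝒟.mem_cell.1 hu).symm hn.2
        have h2 := hκ.le u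
        have h3 : u ∈ 𝒟.cell n (𝒟.index n x) ∩ {x | κ x = n + (κ u - n)} :=
          ⟨hu, show κ u = n + (κ u - n) by omega⟩
        rw [Finset.sum_eq_single_of_mem (κ u - n) (Finset.mem_range.2 (by omega)),
          indicator_of_mem hu, indicator_of_mem h3]
        intro j _ hj
        refine indicator_of_notMem (fun h => hj ?_) _
        have h3 : κ u = n + j := h.2
        omega
      · rw [indicator_of_notMem hu, Finset.sum_eq_zero]
        exact fun j _ => indicator_of_notMem (fun h => hu h.1) _
    rw [hsum]
    refine (singleScaleMax_sum_right_le μ _ (isNice_indicator_cell hf _ _)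
      (fun j => hb.indicator (hE _ _ j)) _ x).trans (Finset.sum_le_sum fun j _ => ?_)
    exact le_biSup (fun n => singleScaleMax μ (δ * 𝒟.side n)
      ((𝒟.cell n (𝒟.index n x)).indicator f)
      ((𝒟.cell n (𝒟.index n x) ∩ {x | κ x = n + j}).indicator b) x) hn
  set W : ℝ≥0∞ := α * β * (ENNReal.ofReal (𝒟.side n₀) ^ d) ^ (1 / r) *
        (∫⁻ x in Q₀, H x ^ (r / (r - 1))) ^ (1 / (r / (r - 1)))
  have hj : ∀ j, ∫⁻ x in Q₀, T j x * H x ≤ C * W * θ ^ j := by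
    intro j
    have h1 := ENNReal.lintegral_mul_le_Lp_mul_Lq (volume.restrict Q₀)
      (Real.HolderConjugate.conjExponent hr) (hTm j).restrict hH.restrict
    refine h1.trans ?_
    have h2 := hκ.lintegral_biSup_rpow_le hp hq hqr hC hf hb hα hβ hb0 j
    have h3 : (∫⁻ x in Q₀, T j x ^ r) ^ (1 / r) ≤
        C * θ ^ j * α * β * (ENNReal.ofReal (𝒟.side n₀) ^ d) ^ (1 / r) := by
      refine (ENNReal.rpow_le_rpow h2 (by positivity)).trans (le_of_eq ?_)
      rw [ENNReal.mul_rpow_of_nonneg _ _ (by positivity), ← ENNReal.rpow_mul,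
        mul_one_div_cancel hr0.ne', ENNReal.rpow_one]
    refine (mul_le_mul_left h3 _).trans (le_of_eq ?_)
    simp only [W, Real.conjExponent]
    ring
  calc _ ≤ ∫⁻ x in Q₀, ∑ j ∈ Finset.range (N + 1), T j x * H x := by
        refine lintegral_mono fun x => ?_
        rw [← Finset.sum_mul]
        exact mul_le_mul_left (hsplit x) _
    _ = ∑ j ∈ Finset.range (N + 1), ∫⁻ x in Q₀, T j x * H x :=
        lintegral_finsetSum' _ fun j _ => ((hTm j).mul hH).restrict
    _ ≤ ∑ j ∈ Finset.range (N + 1), C * W * θ ^ j := Finset.sum_le_sum fun j _ => hj j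
    _ ≤ ∑' j, C * W * (θ : ℝ≥0∞) ^ j := ENNReal.sum_le_tsum _
    _ = _ := by
        rw [ENNReal.tsum_mul_left, ENNReal.tsum_geometric]
        ring

/-- The average of `g` over the cube of generation `n` around `x`. -/
noncomputable def avg (𝒟 : Grid d) (n : ℕ) (g : Rd d → ℂ) (x : Rd d) : ℂ :=
  ((𝒟.side n ^ d)⁻¹ : ℝ) • ∫ v in 𝒟.cell n (𝒟.index n x), g v

theorem measurable_avg (n : ℕ) (g : Rd d → ℂ) : Measurable (𝒟.avg n g) := by
  have : Measurable fun k : Fin d → ℤ => ((𝒟.side n ^ d)⁻¹ : ℝ) • ∫ v in 𝒟.cell n k, g v :=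
    measurable_of_countable _
  exact this.comp (𝒟.measurable_index n)

theorem IsStopping.measurable {n₀ N : ℕ} {κ : Rd d → ℕ} (hκ : 𝒟.IsStopping n₀ N κ) :
    Measurable κ :=
  measurable_to_countable' fun m => hκ.measurableSet_eq m

theorem IsStopping.measurable_avg {n₀ N : ℕ} {κ : Rd d → ℕ} (hκ : 𝒟.IsStopping n₀ N κ)
    (g : Rd d → ℂ) : Measurable fun x => 𝒟.avg (κ x) g x := by
  have h : Measurable fun z : Rd d × ℕ => 𝒟.avg z.2 g z.1 :=
    measurable_from_prod_countable_left fun n => Grid.measurable_avg n g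
  exact h.comp (measurable_id.prodMk hκ.measurable)

theorem volumeReal_cell (n : ℕ) (k : Fin d → ℤ) : volume.real (𝒟.cell n k) = 𝒟.side n ^ d := by
  rw [measureReal_def, volume_cell, ENNReal.toReal_pow, ENNReal.toReal_ofReal (𝒟.side_pos n).le]

theorem norm_avg_le (n : ℕ) {g : Rd d → ℂ} {B : ℝ} (hB : ∀ x, ‖g x‖ ≤ B) (x : Rd d) :
    ‖𝒟.avg n g x‖ ≤ B := by
  have hV : 0 < 𝒟.side n ^ d := pow_pos (𝒟.side_pos n) d
  have h := norm_setIntegral_le_of_norm_le_const (f := g)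
    (𝒟.volume_cell_ne_top n (𝒟.index n x)).lt_top (fun v _ => hB v)
  rw [volumeReal_cell] at h
  rw [avg, norm_smul, Real.norm_of_nonneg (inv_nonneg.2 hV.le), inv_mul_le_iff₀ hV, mul_comm]
  exact h

theorem enorm_avg_rpow_le (n : ℕ) {g : Rd d → ℂ} (hg : Measurable g) {q : ℝ} (hq : 1 < q)
    (x : Rd d) : ‖𝒟.avg n g x‖ₑ ^ q * ENNReal.ofReal (𝒟.side n) ^ d ≤
      ∫⁻ v in 𝒟.cell n (𝒟.index n x), ‖g v‖ₑ ^ q := by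
  have hq0 : 0 < q := one_pos.trans hq
  have hs := 𝒟.side_pos n
  set V : ℝ≥0∞ := ENNReal.ofReal (𝒟.side n) ^ d
  have hV0 : V ≠ 0 := pow_ne_zero d (ENNReal.ofReal_pos.2 hs).ne'
  have hVt : V ≠ ∞ := ENNReal.pow_ne_top ENNReal.ofReal_ne_top
  have h1 : ‖𝒟.avg n g x‖ₑ = V⁻¹ * ‖∫ v in 𝒟.cell n (𝒟.index n x), g v‖ₑ := by
    rw [avg, enorm_smul]
    congr 1
    rw [← ofReal_norm, Real.norm_of_nonneg (by positivity), ENNReal.ofReal_inv_of_pos (by positivity),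
      ENNReal.ofReal_pow hs.le]
  have h2 := (ENNReal.rpow_le_rpow (enorm_integral_le_lintegral_enorm (μ := volume.restrict
    (𝒟.cell n (𝒟.index n x))) g) hq0.le).trans (lintegral_rpow_le _ hq hg.enorm.aemeasurable)
  rw [Measure.restrict_apply_univ, volume_cell] at h2
  rw [h1, ENNReal.mul_rpow_of_nonneg _ _ hq0.le]
  calc _ ≤ V⁻¹ ^ q * (V ^ (q - 1) * ∫⁻ v in 𝒟.cell n (𝒟.index n x), ‖g v‖ₑ ^ q) * V := by gcongr
    _ = (V⁻¹ ^ q * (V ^ (q - 1) * V ^ (1 : ℝ))) * ∫⁻ v in 𝒟.cell n (𝒟.index n x), ‖g v‖ₑ ^ q := by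
      rw [ENNReal.rpow_one]; ring
    _ = _ := by
      rw [← ENNReal.rpow_add _ _ hV0 hVt, sub_add_cancel, ← ENNReal.mul_rpow_of_nonneg _ _ hq0.le,
        ENNReal.inv_mul_cancel hV0 hVt, ENNReal.one_rpow, one_mul]

/-- The dyadic parent of a stopping cube has not been stopped, so its q-average is at most β.
Passing to the child costs a factor 2^d inside the q-th root, and 2^d ≤ (2^d)^q. -/
theorem IsStopping.enorm_avg_le {n₀ N : ℕ} {κ : Rd d → ℕ} (hκ : 𝒟.IsStopping n₀ N κ)
    {k₀ : Fin d → ℤ} {g : Rd d → ℂ} (hg : Measurable g) {q : ℝ} (hq : 1 < q) {β : ℝ≥0∞}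
    (hβ : ∀ x ∈ 𝒟.cell n₀ k₀, ∀ n ∈ Ico n₀ (κ x),
      ∫⁻ v in 𝒟.cell n (𝒟.index n x), ‖g v‖ₑ ^ q ≤ β ^ q * ENNReal.ofReal (𝒟.side n) ^ d)
    {x : Rd d} (hx : x ∈ 𝒟.cell n₀ k₀) : ‖𝒟.avg (κ x) g x‖ₑ ≤ 2 ^ d * β := by
  have hq0 : 0 < q := one_pos.trans hq
  obtain ⟨m, hm⟩ := Nat.exists_eq_succ_of_ne_zero (hκ.lt x).ne_bot
  rw [Nat.succ_eq_add_one] at hm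
  have hlt := hκ.lt x
  have h1 := hβ x hx m ⟨by omega, by omega⟩
  have h2 := enorm_avg_rpow_le (𝒟 := 𝒟) (κ x) hg hq x
  have h3 : ∫⁻ v in 𝒟.cell (κ x) (𝒟.index (κ x) x), ‖g v‖ₑ ^ q ≤
      ∫⁻ v in 𝒟.cell m (𝒟.index m x), ‖g v‖ₑ ^ q :=
    lintegral_mono_set fun v hv => 𝒟.index_eq_of_le (by omega) (𝒟.mem_cell.1 hv)
  have h4 : ENNReal.ofReal (𝒟.side m) ^ d = 2 ^ d * ENNReal.ofReal (𝒟.side (κ x)) ^ d := by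
    rw [← 𝒟.volume_cell m 0, hm, ← 𝒟.volume_cell (m + 1) 0, 𝒟.volume_cell_succ]
  have h5 := h2.trans (h3.trans h1)
  rw [h4, ← mul_assoc] at h5
  have h6 := (ENNReal.mul_le_mul_iff_left (pow_ne_zero d (ENNReal.ofReal_pos.2
    (𝒟.side_pos _)).ne') (ENNReal.pow_ne_top ENNReal.ofReal_ne_top)).1 h5
  rw [← ENNReal.rpow_le_rpow_iff hq0, ENNReal.mul_rpow_of_nonneg _ _ hq0.le, mul_comm]
  refine h6.trans ?_
  gcongr
  exact ENNReal.le_rpow_self_of_one_le (one_le_pow₀ (by norm_num)) hq.le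

theorem IsNice.bddOn_cell {g : Rd d → ℂ} (hg : Measurable g) {B : ℝ} (hB : ∀ x, ‖g x‖ ≤ B) (n : ℕ)
    (k : Fin d → ℤ) : IsNice ((𝒟.cell n k).indicator g) where
  measurable := hg.indicator (𝒟.measurableSet_cell n k)
  exists_bound := ⟨B, fun x => (norm_indicator_le_norm_self g x).trans (hB x)⟩
  exists_support := by
    by_cases h : ∃ x₀, x₀ ∈ 𝒟.cell n k
    · obtain ⟨x₀, hx₀⟩ := h
      refine ⟨d * 𝒟.side n + ‖x₀‖, fun x hx => ?_⟩
      have h1 := 𝒟.norm_sub_le_of_index_eq ((𝒟.mem_cell.1 (mem_of_indicator_ne_zero hx)).trans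
        (𝒟.mem_cell.1 hx₀).symm)
      have h2 := norm_le_norm_sub_add x x₀
      linarith
    · push Not at h
      exact ⟨0, fun x hx => absurd (mem_of_indicator_ne_zero hx) (h x)⟩

end Grid

end BilinearSparse

/-! ### Calderón–Zygmund decomposition on one cube -/

namespace BilinearSparse

open Filter Topology

variable {d : ℕ}

theorem enorm_indicator_le {E : Set (Rd d)} (f : Rd d → ℂ) (x : Rd d) :
    ‖E.indicator f x‖ₑ ≤ ‖f x‖ₑ := enorm_le_iff_norm_le.2 (norm_indicator_le_norm_self f x)

theorem singleScaleMax_le_of_bounded (μ : Measure (Rd d × Rd d)) {f g : Rd d → ℂ} {A B : ℝ≥0∞}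
    (hf : ∀ x, ‖f x‖ₑ ≤ A) (hg : ∀ x, ‖g x‖ₑ ≤ B) (t : ℝ) (x : Rd d) :
    singleScaleMax μ t f g x ≤ A * B * μ univ := by
  refine iSup₂_le fun s _ => (enorm_bilinConv_le μ s f g x).trans ?_
  refine (lintegral_mono fun w => mul_le_mul' (hf _) (hg _)).trans (le_of_eq ?_)
  rw [lintegral_const]

namespace Grid

variable {𝒟 : Grid d}

/-- The function `g` averaged over the stopping cubes in the cube of generation `n₀` and index
`k₀`. -/
noncomputable def goodPart (𝒟 : Grid d) (n₀ : ℕ) (k₀ : Fin d → ℤ) (κ : Rd d → ℕ) (g : Rd d → ℂ) :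
    Rd d → ℂ :=
  (𝒟.cell n₀ k₀).indicator fun x => 𝒟.avg (κ x) g x

/-- The complement of the good part in the cube of generation `n₀` and index `k₀`. -/
noncomputable def badPart (𝒟 : Grid d) (n₀ : ℕ) (k₀ : Fin d → ℤ) (κ : Rd d → ℕ) (g : Rd d → ℂ) :
    Rd d → ℂ :=
  (𝒟.cell n₀ k₀).indicator fun x => g x - 𝒟.avg (κ x) g x

section GoodBad

variable {n₀ N : ℕ} {κ : Rd d → ℕ} (hκ : 𝒟.IsStopping n₀ N κ) {k₀ : Fin d → ℤ} {g : Rd d → ℂ}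
  (hg : IsNice g)

include hκ hg

theorem isNice_goodPart : IsNice (𝒟.goodPart n₀ k₀ κ g) := by
  obtain ⟨B, hB⟩ := hg.exists_bound
  exact IsNice.bddOn_cell (hκ.measurable_avg g) (fun x => norm_avg_le _ hB x) n₀ k₀

theorem isNice_badPart : IsNice (𝒟.badPart n₀ k₀ κ g) := by
  obtain ⟨B, hB⟩ := hg.exists_bound
  exact IsNice.bddOn_cell (hg.measurable.sub (hκ.measurable_avg g)) (B := B + B)
    (fun x => (norm_sub_le _ _).trans (add_le_add (hB x) (norm_avg_le _ hB x))) n₀ k₀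

/-- On a stopping cube κ is constant, so what is subtracted from g there is exactly its mean. -/
theorem integral_badPart {x : Rd d} (hx : x ∈ 𝒟.cell n₀ k₀) :
    ∫ v in 𝒟.cell (κ x) (𝒟.index (κ x) x), 𝒟.badPart n₀ k₀ κ g v = 0 := by
  have h1 : ∫ v in 𝒟.cell (κ x) (𝒟.index (κ x) x), 𝒟.badPart n₀ k₀ κ g v =
      ∫ v in 𝒟.cell (κ x) (𝒟.index (κ x) x), (g v - 𝒟.avg (κ x) g x) := by
    refine setIntegral_congr_fun (𝒟.measurableSet_cell _ _) fun v hv => ?_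
    have hv' : 𝒟.index (κ x) v = 𝒟.index (κ x) x := hv
    have h2 : v ∈ 𝒟.cell n₀ k₀ := (𝒟.index_eq_of_le (hκ.lt x).le hv').trans hx
    rw [badPart, indicator_of_mem h2, hκ.eq x v hv', avg, avg, hv']
  have hV : (𝒟.side (κ x) ^ d : ℝ) ≠ 0 := (pow_pos (𝒟.side_pos _) d).ne'
  rw [h1, integral_sub hg.integrable.integrableOn
    (integrableOn_const (𝒟.volume_cell_ne_top _ _)), setIntegral_const, volumeReal_cell, avg,
    smul_smul, mul_inv_cancel₀ hV, one_smul, sub_self]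

variable {q : ℝ} (hq : 1 < q) {β : ℝ≥0∞}
  (hβ : ∀ x ∈ 𝒟.cell n₀ k₀, ∀ n ∈ Ico n₀ (κ x),
    ∫⁻ v in 𝒟.cell n (𝒟.index n x), ‖g v‖ₑ ^ q ≤ β ^ q * ENNReal.ofReal (𝒟.side n) ^ d)

include hq hβ

theorem enorm_goodPart_le (x : Rd d) : ‖𝒟.goodPart n₀ k₀ κ g x‖ₑ ≤ 2 ^ d * β := by
  by_cases hx : x ∈ 𝒟.cell n₀ k₀
  · rw [goodPart, indicator_of_mem hx]
    exact hκ.enorm_avg_le hg.measurable hq hβ hx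
  · rw [goodPart, indicator_of_notMem hx]
    simp

theorem lintegral_goodPart_le (n : ℕ) (k : Fin d → ℤ) :
    ∫⁻ v in 𝒟.cell n k, ‖𝒟.goodPart n₀ k₀ κ g v‖ₑ ^ q ≤
      (2 ^ d * β) ^ q * ENNReal.ofReal (𝒟.side n) ^ d := by
  refine (lintegral_mono fun v => ENNReal.rpow_le_rpow (enorm_goodPart_le hκ hg hq hβ v)
    (by linarith)).trans (le_of_eq ?_)
  rw [lintegral_const, Measure.restrict_apply_univ, volume_cell]

theorem lintegral_badPart_le : ∀ x ∈ 𝒟.cell n₀ k₀, ∀ n ∈ Ico n₀ (κ x),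
    ∫⁻ v in 𝒟.cell n (𝒟.index n x), ‖𝒟.badPart n₀ k₀ κ g v‖ₑ ^ q ≤
      (2 * (2 ^ d * β)) ^ q * ENNReal.ofReal (𝒟.side n) ^ d := by
  intro x hx n hn
  have hq0 : 0 < q := one_pos.trans hq
  set V : ℝ≥0∞ := ENNReal.ofReal (𝒟.side n) ^ d
  have hpt : ∀ v ∈ 𝒟.cell n (𝒟.index n x), ‖𝒟.badPart n₀ k₀ κ g v‖ₑ ^ q ≤
      2 ^ (q - 1) * (‖g v‖ₑ ^ q + (2 ^ d * β) ^ q) := by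
    intro v hv
    have hv' : v ∈ 𝒟.cell n₀ k₀ := (𝒟.index_eq_of_le hn.1 hv).trans hx
    rw [badPart, indicator_of_mem hv']
    refine (ENNReal.rpow_le_rpow (enorm_sub_le.trans (add_le_add_right
      (hκ.enorm_avg_le hg.measurable hq hβ hv') _)) hq0.le).trans ?_
    exact ENNReal.rpow_add_le_mul_rpow_add_rpow _ _ hq.le
  have h2t : (2 : ℝ≥0∞) ^ (q - 1) ≠ ∞ :=
    ENNReal.rpow_ne_top_of_nonneg (by linarith) (by simp)
  refine (setLIntegral_mono' (𝒟.measurableSet_cell _ _) hpt).trans ?_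
  rw [lintegral_const_mul' _ _ h2t, lintegral_add_right _ measurable_const, lintegral_const,
    Measure.restrict_apply_univ, volume_cell]
  have hβ' : β ≤ 2 ^ d * β := le_mul_of_one_le_left zero_le (one_le_pow₀ (by norm_num))
  calc 2 ^ (q - 1) * ((∫⁻ v in 𝒟.cell n (𝒟.index n x), ‖g v‖ₑ ^ q) + (2 ^ d * β) ^ q * V)
      ≤ 2 ^ (q - 1) * ((2 ^ d * β) ^ q * V + (2 ^ d * β) ^ q * V) := by
        gcongr
        exact (hβ x hx n hn).trans (by gcongr)
    _ = (2 ^ (q - 1) * 2 ^ (1 : ℝ)) * ((2 ^ d * β) ^ q * V) := by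
        rw [ENNReal.rpow_one]; ring
    _ = _ := by
        rw [← ENNReal.rpow_add _ _ (by simp) (by simp), sub_add_cancel,
          ENNReal.mul_rpow_of_nonneg 2 _ hq0.le, mul_assoc]

end GoodBad

/-- The sparse estimate on one cube, for the scales above the stopping cubes. -/
def StoppedBound (μ : Measure (Rd d × Rd d)) (p q r δ : ℝ) (C : ℝ≥0) : Prop :=
  ∀ (𝒟 : Grid d) (n₀ N : ℕ) (κ : Rd d → ℕ), 𝒟.IsStopping n₀ N κ →
    ∀ (k₀ : Fin d → ℤ) (f g : Rd d → ℂ), IsNice f → IsNice g → ∀ α β : ℝ≥0∞,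
      (∀ x ∈ 𝒟.cell n₀ k₀, ∀ n ∈ Ico n₀ (κ x),
        ∫⁻ v in 𝒟.cell n (𝒟.index n x), ‖f v‖ₑ ^ p ≤ α ^ p * ENNReal.ofReal (𝒟.side n) ^ d) →
      (∀ x ∈ 𝒟.cell n₀ k₀, ∀ n ∈ Ico n₀ (κ x),
        ∫⁻ v in 𝒟.cell n (𝒟.index n x), ‖g v‖ₑ ^ q ≤ β ^ q * ENNReal.ofReal (𝒟.side n) ^ d) →
      ∀ H : Rd d → ℝ≥0∞, AEMeasurable H volume →
        ∫⁻ x in 𝒟.cell n₀ k₀, (⨆ n ∈ Ico n₀ (κ x), singleScaleMax μ (δ * 𝒟.side n)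
          ((𝒟.cell n (𝒟.index n x)).indicator f) ((𝒟.cell n (𝒟.index n x)).indicator g) x) * H x ≤
          C * (α * β * (ENNReal.ofReal (𝒟.side n₀) ^ d) ^ (1 / r) *
            (∫⁻ x in 𝒟.cell n₀ k₀, H x ^ (r / (r - 1))) ^ (1 / (r / (r - 1))))

/-- Only three pairs are needed: (f,b), (a,G) and (F,G). In the first, f need not be split, since
its averages over the cubes above the stopping cubes are controlled anyway. The second is the first
with the arguments exchanged, hence the decay hypothesis for the swapped measure. The third is
bounded pointwise. -/
theorem exists_stoppedBound {μ : Measure (Rd d × Rd d)} [IsFiniteMeasure μ]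
    {p q r δ : ℝ} (hp : 1 < p) (hq : 1 < q) (hpr : p ≤ r) (hqr : q ≤ r) {C₁ θ₁ C₂ θ₂ : ℝ≥0}
    (h₁ : LocalDecay μ p q r δ C₁ θ₁) (h₂ : LocalDecay (μ.map Prod.swap) q p r δ C₂ θ₂)
    (hθ₁ : θ₁ < 1) (hθ₂ : θ₂ < 1) : ∃ C : ℝ≥0, StoppedBound μ p q r δ C := by
  have hr : 1 < r := hp.trans_le hpr
  have hp0 : 0 < p := one_pos.trans hp
  have hq0 : 0 < q := one_pos.trans hq
  have hr0 : 0 < r := one_pos.trans hr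
  have : IsFiniteMeasure (μ.map Prod.swap) := inferInstance
  set K₁ : ℝ≥0∞ := C₁ * (1 - θ₁ : ℝ≥0∞)⁻¹
  set K₂ : ℝ≥0∞ := C₂ * (1 - θ₂ : ℝ≥0∞)⁻¹
  have hK : ∀ (C θ : ℝ≥0), θ < 1 → (C * (1 - θ : ℝ≥0∞)⁻¹ : ℝ≥0∞) ≠ ∞ := fun C θ h =>
    ENNReal.mul_ne_top ENNReal.coe_ne_top (ENNReal.inv_ne_top.2
      (tsub_pos_of_lt (by exact_mod_cast h)).ne')
  set D : ℝ≥0∞ := 2 ^ d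
  have hD : D ≠ ∞ := by simp [D]
  -- The bad functions have averages at most 2D times the thresholds and the good functions are
  -- bounded by D times them; the summands belong to (f,b), (a,G) and (F,G).
  set K : ℝ≥0∞ := K₁ * (2 * D) + K₂ * (2 * D * D) + D * D * μ univ
  have hKt : K ≠ ∞ := by
    have := hK C₁ θ₁ hθ₁
    have := hK C₂ θ₂ hθ₂
    have := measure_ne_top μ univ
    finiteness
  refine ⟨K.toNNReal, fun 𝒟 n₀ N κ hκ k₀ f g hf hg α β hα hβ H hH => ?_⟩
  rw [ENNReal.coe_toNNReal hKt]
  set Q₀ := 𝒟.cell n₀ k₀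
  have hQ₀ : MeasurableSet Q₀ := 𝒟.measurableSet_cell _ _
  set F := 𝒟.goodPart n₀ k₀ κ f
  set G := 𝒟.goodPart n₀ k₀ κ g
  set a := 𝒟.badPart n₀ k₀ κ f
  set b := 𝒟.badPart n₀ k₀ κ g
  have hF : IsNice F := isNice_goodPart hκ hf
  have hG : IsNice G := isNice_goodPart hκ hg
  have ha : IsNice a := isNice_badPart hκ hf
  have hb : IsNice b := isNice_badPart hκ hg
  let T : (Rd d → ℂ) → (Rd d → ℂ) → Rd d → ℝ≥0∞ := fun u v x =>
    ⨆ n ∈ Ico n₀ (κ x), singleScaleMax μ (δ * 𝒟.side n)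
      ((𝒟.cell n (𝒟.index n x)).indicator u) ((𝒟.cell n (𝒟.index n x)).indicator v) x
  have hTm : ∀ u v, IsNice u → IsNice v → AEMeasurable (T u v) volume := by
    intro u v hu hv
    refine hκ.aemeasurable_biSup fun n => ?_
    exact aemeasurable_of_cell n (Φ := fun k => singleScaleMax μ (δ * 𝒟.side n)
      ((𝒟.cell n k).indicator u) ((𝒟.cell n k).indicator v)) fun k =>
      aemeasurable_singleScaleMax μ (isNice_indicator_cell hu n k).measurable
        (isNice_indicator_cell hv n k).measurable _
  set W : ℝ≥0∞ := (ENNReal.ofReal (𝒟.side n₀) ^ d) ^ (1 / r) *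
    (∫⁻ x in Q₀, H x ^ (r / (r - 1))) ^ (1 / (r / (r - 1)))
  have hdec : ∀ (u : Rd d → ℂ) (n : ℕ) (x : Rd d), n₀ ≤ n → x ∈ Q₀ →
      (𝒟.cell n (𝒟.index n x)).indicator u = fun y =>
        (𝒟.cell n (𝒟.index n x)).indicator (𝒟.badPart n₀ k₀ κ u) y +
        (𝒟.cell n (𝒟.index n x)).indicator (𝒟.goodPart n₀ k₀ κ u) y := by
    intro u n x hn hx
    ext y
    by_cases hy : y ∈ 𝒟.cell n (𝒟.index n x)
    · have hy' : y ∈ 𝒟.cell n₀ k₀ := (𝒟.index_eq_of_le hn hy).trans hx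
      simp only [indicator_of_mem hy, badPart, goodPart, indicator_of_mem hy', sub_add_cancel]
    · simp only [indicator_of_notMem hy, add_zero]
  have hsplit : ∀ x ∈ Q₀, T f g x ≤ T f b x + T a G x + T F G x := by
    intro x hx
    refine iSup₂_le fun n hn => ?_
    have hc : ∀ {u : Rd d → ℂ}, IsNice u → IsNice ((𝒟.cell n (𝒟.index n x)).indicator u) :=
      fun hu => isNice_indicator_cell hu _ _
    have e1 : singleScaleMax μ (δ * 𝒟.side n) ((𝒟.cell n (𝒟.index n x)).indicator f)
        ((𝒟.cell n (𝒟.index n x)).indicator g) x ≤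
        singleScaleMax μ (δ * 𝒟.side n) ((𝒟.cell n (𝒟.index n x)).indicator f)
          ((𝒟.cell n (𝒟.index n x)).indicator b) x +
        singleScaleMax μ (δ * 𝒟.side n) ((𝒟.cell n (𝒟.index n x)).indicator f)
          ((𝒟.cell n (𝒟.index n x)).indicator G) x := by
      conv_lhs => rw [hdec g n x hn.1 hx]
      exact singleScaleMax_add_right_le μ (hc hf) (hc hb) (hc hG) _ x
    have e2 : singleScaleMax μ (δ * 𝒟.side n) ((𝒟.cell n (𝒟.index n x)).indicator f)
        ((𝒟.cell n (𝒟.index n x)).indicator G) x ≤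
        singleScaleMax μ (δ * 𝒟.side n) ((𝒟.cell n (𝒟.index n x)).indicator a)
          ((𝒟.cell n (𝒟.index n x)).indicator G) x +
        singleScaleMax μ (δ * 𝒟.side n) ((𝒟.cell n (𝒟.index n x)).indicator F)
          ((𝒟.cell n (𝒟.index n x)).indicator G) x := by
      simp only [← singleScaleMax_map_swap μ]
      conv_lhs => rw [hdec f n x hn.1 hx]
      exact singleScaleMax_add_right_le _ (hc hG) (hc ha) (hc hF) _ x
    have hle : ∀ u v, singleScaleMax μ (δ * 𝒟.side n) ((𝒟.cell n (𝒟.index n x)).indicator u)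
        ((𝒟.cell n (𝒟.index n x)).indicator v) x ≤ T u v x := fun u v =>
      le_biSup (fun n => singleScaleMax μ (δ * 𝒟.side n) ((𝒟.cell n (𝒟.index n x)).indicator u)
        ((𝒟.cell n (𝒟.index n x)).indicator v) x) hn
    refine e1.trans ((add_le_add (hle f b) (e2.trans (add_le_add (hle a G) (hle F G)))).trans ?_)
    rw [add_assoc]
  have b1 : ∫⁻ x in Q₀, T f b x * H x ≤ K₁ * (2 * D) * (α * β * W) := by
    refine (hκ.lintegral_biSup_mul_le hp0 hq0 hqr hr h₁ hf hb hα (lintegral_badPart_le hκ hg hq hβ)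
      (fun x hx => integral_badPart hκ hg hx) hH).trans (le_of_eq ?_)
    simp only [W, K₁, D]
    ring
  have b2 : ∫⁻ x in Q₀, T a G x * H x ≤ K₂ * (2 * D * D) * (α * β * W) := by
    simp only [T, ← singleScaleMax_map_swap μ]
    refine (hκ.lintegral_biSup_mul_le hq0 hp0 hpr hr h₂ hG ha
      (fun x hx n hn => lintegral_goodPart_le hκ hg hq hβ _ _) (lintegral_badPart_le hκ hf hp hα)
      (fun x hx => integral_badPart hκ hf hx) hH).trans (le_of_eq ?_)
    simp only [W, K₂, D]
    ring
  have b3 : ∫⁻ x in Q₀, T F G x * H x ≤ D * D * μ univ * (α * β * W) := by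
    have hT : ∀ x, T F G x ≤ D * α * (D * β) * μ univ := fun x => iSup₂_le fun n _ =>
      singleScaleMax_le_of_bounded μ
        (fun y => (enorm_indicator_le _ y).trans (enorm_goodPart_le hκ hf hp hα y))
        (fun y => (enorm_indicator_le _ y).trans (enorm_goodPart_le hκ hg hq hβ y)) _ x
    have hol : ∫⁻ x in Q₀, H x ≤ W := by
      have h := ENNReal.lintegral_mul_le_Lp_mul_Lq (volume.restrict Q₀)
        (Real.HolderConjugate.conjExponent hr) (aemeasurable_const (b := (1 : ℝ≥0∞))) hH.restrict
      simp only [Pi.mul_apply, one_mul, ENNReal.one_rpow, lintegral_one,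
        Measure.restrict_apply_univ, Q₀, volume_cell] at h
      exact h
    calc ∫⁻ x in Q₀, T F G x * H x ≤ ∫⁻ x in Q₀, D * α * (D * β) * μ univ * H x :=
          lintegral_mono fun x => mul_le_mul_left (hT x) _
      _ = D * α * (D * β) * μ univ * ∫⁻ x in Q₀, H x := lintegral_const_mul'' _ hH.restrict
      _ ≤ D * α * (D * β) * μ univ * W := by gcongr
      _ = _ := by ring
  calc ∫⁻ x in Q₀, T f g x * H x
      ≤ ∫⁻ x in Q₀, (T f b x * H x + T a G x * H x) + T F G x * H x := by
        refine setLIntegral_mono' hQ₀ fun x hx => ?_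
        rw [← add_mul, ← add_mul]
        exact mul_le_mul_left (hsplit x hx) _
    _ = (∫⁻ x in Q₀, T f b x * H x) + (∫⁻ x in Q₀, T a G x * H x) +
        ∫⁻ x in Q₀, T F G x * H x := by
        have m1 : AEMeasurable (fun x => T F G x * H x) (volume.restrict Q₀) :=
          ((hTm F G hF hG).mul hH).restrict
        have m2 : AEMeasurable (fun x => T a G x * H x) (volume.restrict Q₀) :=
          ((hTm a G ha hG).mul hH).restrict
        rw [lintegral_add_right' _ m1, lintegral_add_right' _ m2]
    _ ≤ K₁ * (2 * D) * (α * β * W) + K₂ * (2 * D * D) * (α * β * W) +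
        D * D * μ univ * (α * β * W) := add_le_add (add_le_add b1 b2) b3
    _ = K * (α * β * W) := by simp only [K]; ring
    _ = _ := by simp only [W]; ring

end Grid

end BilinearSparse

/-! ### Assembling sparse families; first stopping times -/

namespace BilinearSparse

open Filter Topology

variable {d : ℕ}

theorem Cube.toSet_nonempty (Q : Cube d) : Q.toSet.Nonempty :=
  ⟨Q.corner, fun _ => ⟨le_rfl, lt_add_of_pos_right _ Q.side_pos⟩⟩

/-- Cubes are nonempty, so one lying in two disjoint regions is impossible: each cube belongs to a
single family and inherits its distinguished part without ambiguity. -/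
theorem IsSparse.iUnion {ι : Type*} {γ : ℝ} {S : ι → Set (Cube d)} {U : ι → Set (Rd d)}
    (hU : Pairwise (Function.onFun Disjoint U)) (hS : ∀ i, IsSparse γ (S i))
    (hSU : ∀ i, ∀ Q ∈ S i, Q.toSet ⊆ U i) : IsSparse γ (⋃ i, S i) := by
  choose F hF hFd using hS
  have huniq : ∀ {i j : ι} {Q : Cube d}, Q ∈ S i → Q ∈ S j → i = j := by
    intro i j Q hi hj
    by_contra hne
    obtain ⟨x, hx⟩ := Q.toSet_nonempty
    exact Set.disjoint_left.1 (hU hne) (hSU i Q hi hx) (hSU j Q hj hx)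
  have hFeq : ∀ {i : ι} {Q : Cube d}, Q ∈ S i → (⋃ j, ⋃ (_ : Q ∈ S j), F j Q) = F i Q := by
    intro i Q hi
    ext x
    simp only [mem_iUnion]
    constructor
    · rintro ⟨j, hj, hx⟩
      rwa [huniq hi hj]
    · exact fun hx => ⟨i, hi, hx⟩
  refine ⟨fun Q => ⋃ j, ⋃ (_ : Q ∈ S j), F j Q, fun Q hQ => ?_, fun Q hQ Q' hQ' hne => ?_⟩
  · obtain ⟨i, hi⟩ := mem_iUnion.1 hQ
    simp only [hFeq hi]
    exact hF i Q hi
  · obtain ⟨i, hi⟩ := mem_iUnion.1 hQ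
    obtain ⟨j, hj⟩ := mem_iUnion.1 hQ'
    simp only [Function.onFun]
    rw [hFeq hi, hFeq hj]
    by_cases hij : i = j
    · subst hij
      exact hFd i hi hj hne
    · exact (hU hij).mono ((hF i Q hi).2.1.trans (hSU i Q hi))
        ((hF j Q' hj).2.1.trans (hSU j Q' hj))

theorem sparseForm_iUnion {ι : Type*} {S : ι → Set (Cube d)} {U : ι → Set (Rd d)}
    (hU : Pairwise (Function.onFun Disjoint U)) (hSU : ∀ i, ∀ Q ∈ S i, Q.toSet ⊆ U i)
    (p q s : ℝ) (f g h : Rd d → ℂ) :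
    sparseForm (⋃ i, S i) p q s f g h = ∑' i, sparseForm (S i) p q s f g h := by
  refine ENNReal.tsum_biUnion (f := fun Q : Cube d =>
    volume Q.toSet * cubeAvg f Q p * cubeAvg g Q q * cubeAvg h Q s) fun i _ j _ hij => ?_
  refine Set.disjoint_left.2 fun Q hi hj => ?_
  obtain ⟨x, hx⟩ := Q.toSet_nonempty
  exact Set.disjoint_left.1 (hU hij) (hSU i Q hi hx) (hSU j Q hj hx)

/-- The new cube receives its complement of Ω, which is disjoint from every part already assigned
because those lie in Ω. -/
theorem IsSparse.insert {γ : ℝ} {S : Set (Cube d)} (hS : IsSparse γ S) {Q₀ : Cube d}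
    {Ω : Set (Rd d)} (hm : MeasurableSet (Q₀.toSet \ Ω)) (hSΩ : ∀ Q ∈ S, Q.toSet ⊆ Ω)
    (hΩ : ENNReal.ofReal γ * volume Q₀.toSet ≤ volume (Q₀.toSet \ Ω)) (hQ₀ : Q₀ ∉ S) :
    IsSparse γ (insert Q₀ S) := by
  classical
  obtain ⟨F, hF, hFd⟩ := hS
  have hne : ∀ {Q}, Q ∈ S → Q ≠ Q₀ := fun hQ h => hQ₀ (h ▸ hQ)
  have hdisj : ∀ {Q}, Q ∈ S → Disjoint (Q₀.toSet \ Ω) (F Q) := fun {Q} hQ =>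
    disjoint_sdiff_left.mono_right ((hF Q hQ).2.1.trans (hSΩ Q hQ))
  refine ⟨fun Q => if Q = Q₀ then Q₀.toSet \ Ω else F Q, fun Q hQ => ?_,
    fun Q hQ Q' hQ' hQQ' => ?_⟩
  · rcases hQ with rfl | hQ
    · simp only [if_pos]
      exact ⟨hm, sdiff_subset, hΩ⟩
    · simp only [if_neg (hne hQ)]
      exact hF Q hQ
  · simp only [Function.onFun]
    rcases hQ with rfl | hQ <;> rcases hQ' with rfl | hQ'
    · exact absurd rfl hQQ'
    · rw [if_pos rfl, if_neg (hne hQ')]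
      exact hdisj hQ'
    · rw [if_pos rfl, if_neg (hne hQ)]
      exact (hdisj hQ).symm
    · rw [if_neg (hne hQ), if_neg (hne hQ')]
      exact hFd hQ hQ' hQQ'

theorem sparseForm_insert {S : Set (Cube d)} {Q₀ : Cube d} (hQ₀ : Q₀ ∉ S)
    (p q s : ℝ) (f g h : Rd d → ℂ) :
    sparseForm (insert Q₀ S) p q s f g h =
      volume Q₀.toSet * cubeAvg f Q₀ p * cubeAvg g Q₀ q * cubeAvg h Q₀ s +
        sparseForm S p q s f g h := by
  unfold sparseForm
  rw [Set.insert_eq, ENNReal.summable.tsum_union_disjoint (f := fun Q : Cube d =>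
    volume Q.toSet * cubeAvg f Q p * cubeAvg g Q q * cubeAvg h Q s)
    (disjoint_singleton_left.2 hQ₀) ENNReal.summable, tsum_singleton Q₀ (f := fun Q : Cube d =>
    volume Q.toSet * cubeAvg f Q p * cubeAvg g Q q * cubeAvg h Q s)]

theorem isSparse_empty (γ : ℝ) : IsSparse γ (∅ : Set (Cube d)) :=
  ⟨fun _ => ∅, by simp, by simp⟩

namespace Grid

variable (𝒟 : Grid d)

/-- The cubes at which one stops at the points of `E`. -/
def stops (κ : Rd d → ℕ) (E : Set (Rd d)) : Set (ℕ × (Fin d → ℤ)) :=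
  {P | ∃ x ∈ E, κ x = P.1 ∧ 𝒟.index P.1 x = P.2}

variable {𝒟}

theorem IsStopping.pairwise_disjoint_stops {n₀ N : ℕ} {κ : Rd d → ℕ} (hκ : 𝒟.IsStopping n₀ N κ)
    (E : Set (Rd d)) :
    Pairwise (Function.onFun Disjoint fun P : 𝒟.stops κ E => 𝒟.cell P.1.1 P.1.2) := by
  rintro ⟨⟨m, k⟩, x, hx, hxm, hxk⟩ ⟨⟨m', k'⟩, x', hx', hxm', hxk'⟩ hne
  refine Set.disjoint_left.2 fun v hv hv' => hne ?_
  simp only at hxm hxk hxm' hxk' hv hv'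
  rw [mem_cell] at hv hv'
  have h1 := hκ.eq x v (by rw [hxm, hv, hxk])
  have h2 := hκ.eq x' v (by rw [hxm', hv', hxk'])
  have hm : m = m' := by omega
  subst hm
  have hk : k = k' := hv.symm.trans hv'
  subst hk
  rfl

theorem iUnion_stops {κ : Rd d → ℕ} {E : Set (Rd d)}
    (hE : ∀ x ∈ E, ∀ y, 𝒟.index (κ x) y = 𝒟.index (κ x) x → y ∈ E) :
    ⋃ P : 𝒟.stops κ E, 𝒟.cell P.1.1 P.1.2 = E := by
  ext v
  simp only [mem_iUnion]
  constructor
  · rintro ⟨⟨⟨m, k⟩, x, hx, hxm, hxk⟩, hv⟩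
    simp only at hxm hxk hv
    rw [mem_cell] at hv
    exact hE x hx v (by rw [hxm, hv, hxk])
  · exact fun hv => ⟨⟨(κ v, 𝒟.index (κ v) v), v, hv, rfl, rfl⟩, rfl⟩

theorem IsStopping.lintegral_stops {n₀ N : ℕ} {κ : Rd d → ℕ} (hκ : 𝒟.IsStopping n₀ N κ)
    {E : Set (Rd d)} (hE : ∀ x ∈ E, ∀ y, 𝒟.index (κ x) y = 𝒟.index (κ x) x → y ∈ E)
    (Φ : Rd d → ℝ≥0∞) :
    ∫⁻ x in E, Φ x = ∑' P : 𝒟.stops κ E, ∫⁻ x in 𝒟.cell P.1.1 P.1.2, Φ x := by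
  conv_lhs => rw [← iUnion_stops hE]
  exact lintegral_iUnion (fun P => 𝒟.measurableSet_cell _ _) (hκ.pairwise_disjoint_stops E) _

theorem IsStopping.mul_volume_le {n₀ N : ℕ} {κ : Rd d → ℕ} (hκ : 𝒟.IsStopping n₀ N κ)
    {E : Set (Rd d)} (hE : ∀ x ∈ E, ∀ y, 𝒟.index (κ x) y = 𝒟.index (κ x) x → y ∈ E)
    {Φ : Rd d → ℝ≥0∞} {c : ℝ≥0∞}
    (hc : ∀ x ∈ E, c * ENNReal.ofReal (𝒟.side (κ x)) ^ d ≤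
      ∫⁻ v in 𝒟.cell (κ x) (𝒟.index (κ x) x), Φ v) :
    c * volume E ≤ ∫⁻ x in E, Φ x := by
  rw [← setLIntegral_one, hκ.lintegral_stops hE, hκ.lintegral_stops hE, ← ENNReal.tsum_mul_left]
  refine ENNReal.tsum_le_tsum fun P => ?_
  obtain ⟨⟨m, k⟩, x, hx, hxm, hxk⟩ := P
  simp only at hxm hxk
  subst hxm hxk
  rw [setLIntegral_one, volume_cell]
  exact hc x hx

/-- The contribution of the cube of generation `n` around `x` to the maximal function. -/
noncomputable def localMax (𝒟 : Grid d) (μ : Measure (Rd d × Rd d)) (δ : ℝ) (f g : Rd d → ℂ)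
    (n : ℕ) (x : Rd d) : ℝ≥0∞ :=
  singleScaleMax μ (δ * 𝒟.side n) ((𝒟.cell n (𝒟.index n x)).indicator f)
    ((𝒟.cell n (𝒟.index n x)).indicator g) x

theorem aemeasurable_localMax (μ : Measure (Rd d × Rd d)) [SFinite μ] (δ : ℝ) {f g : Rd d → ℂ}
    (hf : IsNice f) (hg : IsNice g) (n : ℕ) : AEMeasurable (𝒟.localMax μ δ f g n) volume :=
  aemeasurable_of_cell n (Φ := fun k => singleScaleMax μ (δ * 𝒟.side n)
    ((𝒟.cell n k).indicator f) ((𝒟.cell n k).indicator g)) fun k =>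
    aemeasurable_singleScaleMax μ (isNice_indicator_cell hf n k).measurable
      (isNice_indicator_cell hg n k).measurable _

theorem cubeAvg_cube_rpow_mul (f : Rd d → ℂ) (n : ℕ) (k : Fin d → ℤ) {p : ℝ} (hp : 0 < p) :
    cubeAvg f (𝒟.cube n k) p ^ p * ENNReal.ofReal (𝒟.side n) ^ d =
      ∫⁻ v in 𝒟.cell n k, ‖f v‖ₑ ^ p := by
  rw [cubeAvg, toSet_cube, ← ENNReal.rpow_mul, one_div_mul_cancel hp.ne', ENNReal.rpow_one,
    mul_right_comm, ← 𝒟.volume_cell n k, ENNReal.inv_mul_cancel (𝒟.volume_cell_pos n k).ne'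
      (𝒟.volume_cell_ne_top n k), one_mul]

theorem lintegral_rpow_one_div (h : Rd d → ℂ) (n : ℕ) (k : Fin d → ℤ) {s : ℝ} (hs : 0 < s) :
    (∫⁻ x in 𝒟.cell n k, ‖h x‖ₑ ^ s) ^ (1 / s) =
      cubeAvg h (𝒟.cube n k) s * (ENNReal.ofReal (𝒟.side n) ^ d) ^ (1 / s) := by
  rw [← cubeAvg_cube_rpow_mul h n k hs, ENNReal.mul_rpow_of_nonneg _ _ (by positivity),
    ← ENNReal.rpow_mul, mul_one_div_cancel hs.ne', ENNReal.rpow_one]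

section StoppingTime

variable (𝒟) (n₀ N : ℕ) (B : ℕ → (Fin d → ℤ) → Prop)

/-- The first generation after `n₀`, but at most `N`, with a cube satisfying `B` around `x`. -/
noncomputable def firstStop (x : Rd d) : ℕ := sInf {m | n₀ < m ∧ (N ≤ m ∨ B m (𝒟.index m x))}

variable {n₀ N B}

theorem firstStop_mem (h : n₀ < N) (x : Rd d) : n₀ < 𝒟.firstStop n₀ N B x ∧
    (N ≤ 𝒟.firstStop n₀ N B x ∨ B (𝒟.firstStop n₀ N B x) (𝒟.index (𝒟.firstStop n₀ N B x) x)) :=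
  Nat.sInf_mem (s := {m | n₀ < m ∧ (N ≤ m ∨ B m (𝒟.index m x))}) ⟨N, h, Or.inl le_rfl⟩

theorem firstStop_le {x : Rd d} {m : ℕ} (hm : n₀ < m) (h : N ≤ m ∨ B m (𝒟.index m x)) :
    𝒟.firstStop n₀ N B x ≤ m :=
  Nat.sInf_le (s := {m | n₀ < m ∧ (N ≤ m ∨ B m (𝒟.index m x))}) ⟨hm, h⟩

theorem isStopping_firstStop (h : n₀ < N) : 𝒟.IsStopping n₀ N (𝒟.firstStop n₀ N B) where
  lt x := (𝒟.firstStop_mem h x).1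
  le x := 𝒟.firstStop_le h (Or.inl le_rfl)
  eq x y hxy := by
    have hx := 𝒟.firstStop_mem (B := B) h x
    have hy := 𝒟.firstStop_mem (B := B) h y
    rw [← hxy] at hx
    -- The stopping condition sees only the index of the cube, so y satisfies it at the generation
    -- where x stops. By nestedness the reverse comparison follows.
    have hle := 𝒟.firstStop_le hx.1 hx.2
    rw [𝒟.index_eq_of_le hle hxy] at hy
    exact le_antisymm hle (𝒟.firstStop_le hy.1 hy.2)

theorem firstStop_spec (h : n₀ < N) {x : Rd d} (hx : 𝒟.firstStop n₀ N B x < N) :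
    B (𝒟.firstStop n₀ N B x) (𝒟.index (𝒟.firstStop n₀ N B x) x) :=
  (𝒟.firstStop_mem h x).2.resolve_left (not_le.2 hx)

theorem not_of_lt_firstStop {x : Rd d} {m : ℕ} (hm : n₀ < m)
    (hmx : m < 𝒟.firstStop n₀ N B x) : ¬ B m (𝒟.index m x) := fun hB =>
  absurd (𝒟.firstStop_le hm (Or.inr hB)) (not_le.2 hmx)

end StoppingTime

end Grid

end BilinearSparse

/-! ### The recursive construction of the sparse family -/

namespace BilinearSparse

open Filter Topology

variable {d : ℕ}

theorem IsNice.lintegral_rpow_lt_top {f : Rd d → ℂ} (hf : IsNice f) {p : ℝ} (hp : 0 < p) :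
    ∫⁻ x, ‖f x‖ₑ ^ p < ∞ := by
  rw [← eLpNorm_ofReal_rpow hp]
  exact ENNReal.rpow_lt_top_of_nonneg hp.le (hf.memLp _).2.ne

namespace Grid

variable {𝒟 : Grid d}

/-- Weak-type estimate by summation over the disjoint stopping cubes; A ≤ A^p since A ≥ 1. A
vanishing average on the top cube is treated separately: then no subcube can exceed the threshold.
-/
theorem IsStopping.mul_volume_stop_le {n₀ N : ℕ} {κ : Rd d → ℕ} (hκ : 𝒟.IsStopping n₀ N κ)
    {k₀ : Fin d → ℤ} {f : Rd d → ℂ} (hf : IsNice f) {p : ℝ} (hp : 1 < p) {A : ℝ≥0∞} (hA : 1 ≤ A)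
    {E : Set (Rd d)} (hE : ∀ x ∈ E, ∀ y, 𝒟.index (κ x) y = 𝒟.index (κ x) x → y ∈ E)
    (hEQ : E ⊆ 𝒟.cell n₀ k₀)
    (hlt : ∀ x ∈ E, (A * cubeAvg f (𝒟.cube n₀ k₀) p) ^ p * ENNReal.ofReal (𝒟.side (κ x)) ^ d <
      ∫⁻ v in 𝒟.cell (κ x) (𝒟.index (κ x) x), ‖f v‖ₑ ^ p) :
    A * volume E ≤ volume (𝒟.cell n₀ k₀) := by
  have hp0 : 0 < p := one_pos.trans hp
  set a := cubeAvg f (𝒟.cube n₀ k₀) p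
  have ha : a ^ p * volume (𝒟.cell n₀ k₀) = ∫⁻ v in 𝒟.cell n₀ k₀, ‖f v‖ₑ ^ p := by
    rw [volume_cell]
    exact cubeAvg_cube_rpow_mul f n₀ k₀ hp0
  have h1 := hκ.mul_volume_le hE (fun x hx => (hlt x hx).le)
  by_cases h0 : a ^ p = 0
  · have : E = ∅ := by
      rw [eq_empty_iff_forall_notMem]
      intro x hx
      have h2 : ∫⁻ v in 𝒟.cell (κ x) (𝒟.index (κ x) x), ‖f v‖ₑ ^ p ≤
          ∫⁻ v in 𝒟.cell n₀ k₀, ‖f v‖ₑ ^ p := lintegral_mono_set fun v hv =>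
        (𝒟.index_eq_of_le (hκ.lt x).le (𝒟.mem_cell.1 hv)).trans (hEQ hx)
      rw [← ha, h0, zero_mul] at h2
      exact absurd ((hlt x hx).trans_le h2) not_lt_zero
    simp [this]
  · have hat : a ^ p ≠ ∞ := by
      intro h
      rw [h, ENNReal.top_mul (𝒟.volume_cell_pos n₀ k₀).ne'] at ha
      exact ((setLIntegral_le_lintegral _ _).trans_lt (hf.lintegral_rpow_lt_top hp0)).ne ha.symm
    have h2 : a ^ p * (A ^ p * volume E) ≤ a ^ p * volume (𝒟.cell n₀ k₀) := by
      rw [ha]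
      refine le_trans (le_of_eq ?_) (h1.trans (lintegral_mono_set hEQ))
      rw [ENNReal.mul_rpow_of_nonneg _ _ hp0.le]
      ring
    refine le_trans ?_ ((ENNReal.mul_le_mul_iff_right h0 hat).1 h2)
    gcongr
    exact ENNReal.le_rpow_self_of_one_le hA hp.le

/-- Induction on the number j of generations between the cube and the finest generation N. The
stopped bound handles the generations before κ(x); later ones occur only on stopping cubes of
generation below N, where the inductive hypothesis gives families inside disjoint cubes. -/
theorem exists_isSparse_lintegral_le {μ : Measure (Rd d × Rd d)} [IsFiniteMeasure μ]
    {p q r δ : ℝ} (hp : 1 < p) (hq : 1 < q) (hr : 1 < r) {C : ℝ≥0}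
    (hC : StoppedBound μ p q r δ C) {γ : ℝ} (hγ0 : 0 < γ) (hγ1 : γ < 1) (𝒟 : Grid d) (N : ℕ)
    {f g h : Rd d → ℂ} (hf : IsNice f) (hg : IsNice g) (hh : AEMeasurable (fun x => ‖h x‖ₑ) volume)
    (j : ℕ) : ∀ (n₀ : ℕ) (k₀ : Fin d → ℤ), n₀ + j = N →
      ∃ S : Set (Cube d), IsSparse γ S ∧ (∀ Q ∈ S, Q.toSet ⊆ 𝒟.cell n₀ k₀) ∧
        ∫⁻ x in 𝒟.cell n₀ k₀, (⨆ n ∈ Ico n₀ N, 𝒟.localMax μ δ f g n x) * ‖h x‖ₑ ≤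
          C * ENNReal.ofReal (2 / (1 - γ)) ^ 2 * sparseForm S p q (r / (r - 1)) f g h := by
  have hp0 : 0 < p := one_pos.trans hp
  have hq0 : 0 < q := one_pos.trans hq
  have hr0 : 0 < r := one_pos.trans hr
  have hconj : r.HolderConjugate (r / (r - 1)) := Real.HolderConjugate.conjExponent hr
  induction j using Nat.strong_induction_on with
  | _ j ih =>
  intro n₀ k₀ hj
  rcases Nat.eq_zero_or_pos j with rfl | hjpos
  · refine ⟨∅, isSparse_empty γ, by simp, ?_⟩
    have : Ico n₀ N = ∅ := by simp [← hj]
    simp [this]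
  have hN : n₀ < N := by omega
  have h1γ : 0 < 1 - γ := by linarith
  -- The cubes selected for f and those selected for g each cover at most |Q|/A; together this is
  -- 2|Q|/A = (1-γ)|Q|.
  set A : ℝ≥0∞ := ENNReal.ofReal (2 / (1 - γ))
  have hA : 1 ≤ A := by
    rw [ENNReal.one_le_ofReal, le_div_iff₀ h1γ]
    linarith
  set Q₀ := 𝒟.cell n₀ k₀
  have hQ₀ : MeasurableSet Q₀ := 𝒟.measurableSet_cell _ _
  set V : ℝ≥0∞ := ENNReal.ofReal (𝒟.side n₀) ^ d
  have hV : volume Q₀ = V := 𝒟.volume_cell n₀ k₀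
  have hV0 : V ≠ 0 := hV ▸ (𝒟.volume_cell_pos n₀ k₀).ne'
  have hVt : V ≠ ∞ := hV ▸ 𝒟.volume_cell_ne_top n₀ k₀
  set α : ℝ≥0∞ := A * cubeAvg f (𝒟.cube n₀ k₀) p
  set β : ℝ≥0∞ := A * cubeAvg g (𝒟.cube n₀ k₀) q
  set Bf : ℕ → (Fin d → ℤ) → Prop := fun m k =>
    α ^ p * ENNReal.ofReal (𝒟.side m) ^ d < ∫⁻ v in 𝒟.cell m k, ‖f v‖ₑ ^ p
  set Bg : ℕ → (Fin d → ℤ) → Prop := fun m k =>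
    β ^ q * ENNReal.ofReal (𝒟.side m) ^ d < ∫⁻ v in 𝒟.cell m k, ‖g v‖ₑ ^ q
  set κ : Rd d → ℕ := 𝒟.firstStop n₀ N fun m k => Bf m k ∨ Bg m k
  have hκ : 𝒟.IsStopping n₀ N κ := 𝒟.isStopping_firstStop hN
  -- The stopping rule never tests generation n₀ itself; there the bound holds because A ≥ 1.
  have htop : ∀ {u : Rd d → ℂ} {s : ℝ} (_ : 0 < s), ∫⁻ v in Q₀, ‖u v‖ₑ ^ s ≤
      (A * cubeAvg u (𝒟.cube n₀ k₀) s) ^ s * V := by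
    intro u s hs
    rw [← cubeAvg_cube_rpow_mul u n₀ k₀ hs]
    gcongr
    exact le_mul_of_one_le_left zero_le hA
  have hα : ∀ x ∈ Q₀, ∀ n ∈ Ico n₀ (κ x),
      ∫⁻ v in 𝒟.cell n (𝒟.index n x), ‖f v‖ₑ ^ p ≤ α ^ p * ENNReal.ofReal (𝒟.side n) ^ d := by
    intro x hx n hn
    rcases hn.1.eq_or_lt with rfl | hlt
    · rw [𝒟.mem_cell.1 hx]
      exact htop hp0
    · exact not_lt.1 fun hB => 𝒟.not_of_lt_firstStop hlt hn.2 (Or.inl hB)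
  have hβ : ∀ x ∈ Q₀, ∀ n ∈ Ico n₀ (κ x),
      ∫⁻ v in 𝒟.cell n (𝒟.index n x), ‖g v‖ₑ ^ q ≤ β ^ q * ENNReal.ofReal (𝒟.side n) ^ d := by
    intro x hx n hn
    rcases hn.1.eq_or_lt with rfl | hlt
    · rw [𝒟.mem_cell.1 hx]
      exact htop hq0
    · exact not_lt.1 fun hB => 𝒟.not_of_lt_firstStop hlt hn.2 (Or.inr hB)
  -- Outside Ω one stops only because generation N is reached, so no scale is left over there.
  set Ω : Set (Rd d) := {x | x ∈ Q₀ ∧ κ x < N}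
  have hΩm : MeasurableSet Ω := hQ₀.inter (measurableSet_lt hκ.measurable measurable_const)
  have hstay : ∀ x ∈ Q₀, ∀ y, 𝒟.index (κ x) y = 𝒟.index (κ x) x → y ∈ Q₀ := fun x hx y hy =>
    (𝒟.index_eq_of_le (hκ.lt x).le hy).trans hx
  have hΩ : ∀ x ∈ Ω, ∀ y, 𝒟.index (κ x) y = 𝒟.index (κ x) x → y ∈ Ω := fun x hx y hy =>
    ⟨hstay x hx.1 y hy, by rw [hκ.eq x y hy]; exact hx.2⟩
  -- the stopping cubes cover a small part of the cube
  have hΩvol : volume Ω ≤ ENNReal.ofReal (1 - γ) * V := by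
    have key : ∀ (u : Rd d → ℂ) (s : ℝ), IsNice u → 1 < s → A * volume {x | x ∈ Q₀ ∧
        (A * cubeAvg u (𝒟.cube n₀ k₀) s) ^ s * ENNReal.ofReal (𝒟.side (κ x)) ^ d <
          ∫⁻ v in 𝒟.cell (κ x) (𝒟.index (κ x) x), ‖u v‖ₑ ^ s} ≤ V := by
      intro u s hu hs
      rw [← hV]
      refine hκ.mul_volume_stop_le hu hs hA (fun x hx y hy => ⟨hstay x hx.1 y hy, ?_⟩)
        (fun x hx => hx.1) (fun x hx => hx.2)
      rw [hκ.eq x y hy, hy]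
      exact hx.2
    have hsub : Ω ⊆ {x | x ∈ Q₀ ∧ Bf (κ x) (𝒟.index (κ x) x)} ∪
        {x | x ∈ Q₀ ∧ Bg (κ x) (𝒟.index (κ x) x)} := by
      intro x hx
      rcases 𝒟.firstStop_spec hN hx.2 with h | h
      · exact Or.inl ⟨hx.1, h⟩
      · exact Or.inr ⟨hx.1, h⟩
    have h2 : A * volume Ω ≤ 2 * V := by
      refine (mul_le_mul_right ((measure_mono hsub).trans (measure_union_le _ _)) A).trans ?_
      rw [mul_add, two_mul]
      exact add_le_add (key f p hf hp) (key g q hg hq)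
    have h3 : ENNReal.ofReal ((1 - γ) / 2) * A = 1 := by
      rw [← ENNReal.ofReal_mul (by positivity), ← ENNReal.ofReal_one]
      congr 1
      field_simp
    calc volume Ω = ENNReal.ofReal ((1 - γ) / 2) * (A * volume Ω) := by
          rw [← mul_assoc, h3, one_mul]
      _ ≤ ENNReal.ofReal ((1 - γ) / 2) * (2 * V) := by gcongr
      _ = _ := by
          rw [← mul_assoc, ← ENNReal.ofReal_ofNat, ← ENNReal.ofReal_mul (by positivity)]
          congr 2
          ring
  have hdiff : ENNReal.ofReal γ * V ≤ volume (Q₀ \ Ω) := by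
    have h2 : ENNReal.ofReal γ * V + ENNReal.ofReal (1 - γ) * V ≤
        volume (Q₀ \ Ω) + ENNReal.ofReal (1 - γ) * V := by
      calc _ = volume Q₀ := by
            rw [← add_mul, ← ENNReal.ofReal_add hγ0.le h1γ.le, add_sub_cancel, ENNReal.ofReal_one,
              one_mul, hV]
        _ ≤ volume ((Q₀ \ Ω) ∪ Ω) := measure_mono fun x hx => by
            by_cases hxΩ : x ∈ Ω
            · exact Or.inr hxΩ
            · exact Or.inl ⟨hx, hxΩ⟩
        _ ≤ volume (Q₀ \ Ω) + volume Ω := measure_union_le _ _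
        _ ≤ _ := by gcongr
    exact (ENNReal.add_le_add_iff_right (ENNReal.mul_ne_top ENNReal.ofReal_ne_top hVt)).1 h2
  -- the families of the stopping cubes
  have hih : ∀ P : 𝒟.stops κ Ω, ∃ S : Set (Cube d), IsSparse γ S ∧
      (∀ Q ∈ S, Q.toSet ⊆ 𝒟.cell P.1.1 P.1.2) ∧
        ∫⁻ x in 𝒟.cell P.1.1 P.1.2, (⨆ n ∈ Ico P.1.1 N, 𝒟.localMax μ δ f g n x) * ‖h x‖ₑ ≤
          C * A ^ 2 * sparseForm S p q (r / (r - 1)) f g h := by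
    rintro ⟨⟨m, k⟩, x, hx, hxm, hxk⟩
    have h1 := hκ.lt x
    have h2 := hx.2
    simp only at hxm
    exact ih (N - m) (by omega) m k (by omega)
  choose S hS hSsub hSle using hih
  have hdisj := hκ.pairwise_disjoint_stops Ω
  have hSΩ : ∀ Q ∈ ⋃ P, S P, Q.toSet ⊆ Ω := by
    intro Q hQ
    obtain ⟨P, hP⟩ := mem_iUnion.1 hQ
    refine (hSsub P Q hP).trans ?_
    conv_rhs => rw [← iUnion_stops hΩ]
    exact subset_iUnion (fun P : 𝒟.stops κ Ω => 𝒟.cell P.1.1 P.1.2) P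
  have hpos : 0 < volume (Q₀ \ Ω) := by
    refine lt_of_lt_of_le (pos_iff_ne_zero.2 (mul_ne_zero ?_ hV0)) hdiff
    exact (ENNReal.ofReal_pos.2 hγ0).ne'
  -- All later cubes lie in Ω, which misses a set of positive measure in the top cube; the top cube
  -- is therefore counted once.
  have hnot : 𝒟.cube n₀ k₀ ∉ ⋃ P, S P := by
    intro hmem
    have := hSΩ _ hmem
    rw [toSet_cube] at this
    rw [Set.sdiff_eq_empty.2 this, measure_empty] at hpos
    exact lt_irrefl _ hpos
  refine ⟨insert (𝒟.cube n₀ k₀) (⋃ P, S P), ?_, ?_, ?_⟩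
  · refine (IsSparse.iUnion hdisj hS hSsub).insert (Ω := Ω) ?_ hSΩ ?_ hnot
    · rw [toSet_cube]
      exact hQ₀.diff hΩm
    · rw [toSet_cube, hV]
      exact hdiff
  · rintro Q (rfl | hQ)
    · rw [toSet_cube]
    · exact (hSΩ Q hQ).trans fun x hx => hx.1
  rw [sparseForm_insert hnot, sparseForm_iUnion hdisj hSsub, mul_add, toSet_cube, hV,
    ← ENNReal.tsum_mul_left]
  have hmeas : AEMeasurable (fun x => (⨆ n ∈ Ico n₀ (κ x), 𝒟.localMax μ δ f g n x) * ‖h x‖ₑ)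
      (volume.restrict Q₀) :=
    ((hκ.aemeasurable_biSup fun n => aemeasurable_localMax μ δ hf hg n).mul hh).restrict
  calc ∫⁻ x in Q₀, (⨆ n ∈ Ico n₀ N, 𝒟.localMax μ δ f g n x) * ‖h x‖ₑ
      ≤ ∫⁻ x in Q₀, (⨆ n ∈ Ico n₀ (κ x), 𝒟.localMax μ δ f g n x) * ‖h x‖ₑ +
        Ω.indicator (fun x => (⨆ n ∈ Ico (κ x) N, 𝒟.localMax μ δ f g n x) * ‖h x‖ₑ) x := by
        refine setLIntegral_mono' hQ₀ fun x hx => ?_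
        by_cases hxΩ : x ∈ Ω
        · rw [indicator_of_mem hxΩ, ← add_mul]
          refine mul_le_mul_left (iSup₂_le fun n hn => ?_) _
          rcases lt_or_ge n (κ x) with hlt | hge
          · exact (le_biSup (fun n => 𝒟.localMax μ δ f g n x)
              (show n ∈ Ico n₀ (κ x) from ⟨hn.1, hlt⟩)).trans le_self_add
          · exact (le_biSup (fun n => 𝒟.localMax μ δ f g n x)
              (show n ∈ Ico (κ x) N from ⟨hge, hn.2⟩)).trans le_add_self
        · rw [indicator_of_notMem hxΩ, add_zero]
          have : κ x = N := le_antisymm (hκ.le x) (not_lt.1 fun hlt => hxΩ ⟨hx, hlt⟩)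
          rw [this]
    _ = (∫⁻ x in Q₀, (⨆ n ∈ Ico n₀ (κ x), 𝒟.localMax μ δ f g n x) * ‖h x‖ₑ) +
        ∫⁻ x in Q₀, Ω.indicator
          (fun x => (⨆ n ∈ Ico (κ x) N, 𝒟.localMax μ δ f g n x) * ‖h x‖ₑ) x :=
        lintegral_add_left' hmeas _
    _ ≤ _ := by
        refine add_le_add ?_ ?_
        · refine (hC 𝒟 n₀ N κ hκ k₀ f g hf hg α β hα hβ _ hh).trans (le_of_eq ?_)
          rw [lintegral_rpow_one_div h n₀ k₀ hconj.symm.pos]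
          have hexp : V ^ (1 / r) * V ^ (1 / (r / (r - 1))) = V := by
            rw [← ENNReal.rpow_add _ _ hV0 hVt, one_div, one_div, hconj.inv_add_inv_eq_one,
              ENNReal.rpow_one]
          calc _ = C * A ^ 2 * ((V ^ (1 / r) * V ^ (1 / (r / (r - 1)))) *
                cubeAvg f (𝒟.cube n₀ k₀) p * cubeAvg g (𝒟.cube n₀ k₀) q *
                cubeAvg h (𝒟.cube n₀ k₀) (r / (r - 1))) := by
                simp only [α, β, V]
                ring
            _ = _ := by rw [hexp]
        · refine (setLIntegral_le_lintegral _ _).trans ?_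
          rw [lintegral_indicator hΩm, hκ.lintegral_stops hΩ]
          refine ENNReal.tsum_le_tsum fun P => le_trans (le_of_eq ?_) (hSle P)
          refine setLIntegral_congr_fun (𝒟.measurableSet_cell _ _) fun v hv => ?_
          obtain ⟨⟨m, k⟩, x, hx, hxm, hxk⟩ := P
          simp only at hxm hxk hv ⊢
          rw [𝒟.mem_cell] at hv
          rw [hκ.eq x v (by rw [hxm, hv, hxk]), hxm]

end Grid

end BilinearSparse

/-! ### The one-third trick and the reduction of the maximal function to grids -/

namespace BilinearSparse

open Filter Topology

variable {d : ℕ}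

/-- If α is at least ℓ/6 from the endpoints of its interval, no shift is needed. Otherwise, as 3
does not divide 2^n, the shift by 2^n ℓ/3 is congruent to ℓ/3 or 2ℓ/3 modulo ℓ and carries α that
far from the lattice. -/
theorem exists_third_shift (n : ℕ) {ℓ : ℝ} (hℓ : 0 < ℓ) (α : ℝ) :
    ∃ b : Bool, ∀ β : ℝ, |β - α| < ℓ / 6 →
      ⌊(β - if b then 2 ^ n * ℓ / 3 else 0) / ℓ⌋ = ⌊(α - if b then 2 ^ n * ℓ / 3 else 0) / ℓ⌋ := by
  have hclose : ∀ β : ℝ, |β - α| < ℓ / 6 → |β / ℓ - α / ℓ| < 1 / 6 := by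
    intro β h
    rw [← sub_div, abs_div, abs_of_pos hℓ, div_lt_iff₀ hℓ]
    linarith
  set u := α / ℓ
  have h0 := Int.floor_le u
  have h1 := Int.lt_floor_add_one u
  by_cases hmid : ⌊u⌋ + 1 / 6 ≤ u ∧ u ≤ ⌊u⌋ + 5 / 6
  · refine ⟨false, fun β hβ => ?_⟩
    have h2 := abs_lt.1 (hclose β hβ)
    simp only [Bool.false_eq_true, if_false, sub_zero]
    rw [Int.floor_eq_iff]
    constructor <;> linarith [hmid.1, hmid.2]
  · refine ⟨true, fun β hβ => ?_⟩
    have h2 := abs_lt.1 (hclose β hβ)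
    have e : ∀ a : ℝ, (a - 2 ^ n * ℓ / 3) / ℓ = a / ℓ - 2 ^ n / 3 := by
      intro a
      field_simp
    simp only [if_true, e]
    change ⌊β / ℓ - 2 ^ n / 3⌋ = ⌊u - 2 ^ n / 3⌋
    have hmod : ∃ K : ℕ, (2 : ℝ) ^ n = 3 * K + 1 ∨ (2 : ℝ) ^ n = 3 * K + 2 := by
      have h3 : ¬ 3 ∣ 2 ^ n := fun h => by
        have := Nat.Prime.dvd_of_dvd_pow Nat.prime_three h
        omega
      refine ⟨2 ^ n / 3, ?_⟩
      have : 2 ^ n = 3 * (2 ^ n / 3) + 1 ∨ 2 ^ n = 3 * (2 ^ n / 3) + 2 := by omega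
      exact this.imp (fun h => by exact_mod_cast h) (fun h => by exact_mod_cast h)
    obtain ⟨K, hK⟩ := hmod
    -- With K = ⌊2^n/3⌋, a point just above a lattice point falls into the previous interval after
    -- the shift, whence the extra -1; a point just below the next one does not.
    obtain ⟨z, hz⟩ : ∃ z : ℤ, ∀ v : ℝ, |v - u| < 1 / 6 →
        (z : ℝ) ≤ v - 2 ^ n / 3 ∧ v - 2 ^ n / 3 < z + 1 := by
      rcases not_and_or.1 hmid with h | h
      · refine ⟨⌊u⌋ - K - 1, fun v hv => ?_⟩
        have hv := abs_lt.1 hv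
        push_cast
        rcases hK with hK | hK <;> rw [hK] <;> constructor <;> linarith
      · refine ⟨⌊u⌋ - K, fun v hv => ?_⟩
        have hv := abs_lt.1 hv
        push_cast
        rcases hK with hK | hK <;> rw [hK] <;> constructor <;> linarith
    rw [Int.floor_eq_iff.2 (hz _ (hclose β hβ)), Int.floor_eq_iff.2 (hz u (by simp))]

theorem sparseForm_mono (S : Set (Cube d)) {p q : ℝ} (hp : 0 < p) (hq : 0 < q) (s : ℝ)
    {f f' g g' : Rd d → ℂ} (h : Rd d → ℂ) (hf : ∀ᵐ x, ‖f x‖ₑ ≤ ‖f' x‖ₑ)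
    (hg : ∀ᵐ x, ‖g x‖ₑ ≤ ‖g' x‖ₑ) : sparseForm S p q s f g h ≤ sparseForm S p q s f' g' h := by
  have key : ∀ {p : ℝ} (_ : 0 < p) {f f' : Rd d → ℂ} (_ : ∀ᵐ x, ‖f x‖ₑ ≤ ‖f' x‖ₑ) (Q : Cube d),
      cubeAvg f Q p ≤ cubeAvg f' Q p := by
    intro p hp f f' hf Q
    refine ENNReal.rpow_le_rpow (mul_le_mul_right (lintegral_mono_ae ?_) _) (by positivity)
    filter_upwards [ae_restrict_of_ae hf] with x hx
    exact ENNReal.rpow_le_rpow hx hp.le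
  refine ENNReal.tsum_le_tsum fun Q => ?_
  gcongr
  · exact key hp hf Q
  · exact key hq hg Q

namespace Grid

theorem lintegral_biSup_localMax_le {μ : Measure (Rd d × Rd d)} [IsFiniteMeasure μ]
    {p q r δ : ℝ} (hp : 1 < p) (hq : 1 < q) (hr : 1 < r) {C : ℝ≥0}
    (hC : StoppedBound μ p q r δ C) {γ : ℝ} (hγ0 : 0 < γ) (hγ1 : γ < 1) (𝒟 : Grid d) (N : ℕ)
    {f g h : Rd d → ℂ} (hf : IsNice f) (hg : IsNice g)
    (hh : AEMeasurable (fun x => ‖h x‖ₑ) volume) :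
    ∫⁻ x, (⨆ n ∈ Ico 0 N, 𝒟.localMax μ δ f g n x) * ‖h x‖ₑ ≤
      C * ENNReal.ofReal (2 / (1 - γ)) ^ 2 * ⨆ (S : Set (Cube d)) (_ : IsSparse γ S),
        sparseForm S p q (r / (r - 1)) f g h := by
  choose S hS hSU hle using fun k => exists_isSparse_lintegral_le hp hq hr hC hγ0 hγ1 𝒟 N hf hg hh
    N 0 k (zero_add N)
  rw [𝒟.lintegral_eq_tsum_cell 0]
  refine (ENNReal.tsum_le_tsum hle).trans ?_
  rw [ENNReal.tsum_mul_left, ← sparseForm_iUnion (𝒟.pairwise_disjoint_cell 0) hSU]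
  refine mul_le_mul_right ?_ _
  exact le_iSup₂_of_le (⋃ k, S k) (IsSparse.iUnion (𝒟.pairwise_disjoint_cell 0) hS hSU) le_rfl

/-- The translates by thirds of the dyadic grid of top scale `2 ^ M`. -/
noncomputable def shifted (M : ℕ) (e : Fin d → Bool) : Grid d where
  origin i := if e i then 2 ^ M / 3 else 0
  scale := 2 ^ M
  scale_pos := by positivity

/-- The choice is made in each coordinate separately. At generation n the side is ℓ = 2^M/2^n, so
the shift 2^n ℓ/3 is 2^M/3 for every n, and the same 2^d grids serve all generations. -/
theorem exists_shifted_index_eq (M n : ℕ) (x : Rd d) : ∃ e : Fin d → Bool, ∀ y : Rd d,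
    (∀ i, |y i - x i| < (2 ^ M / 2 ^ n) / 6) →
      (shifted M e).index n y = (shifted M e).index n x := by
  have hℓ : (0 : ℝ) < 2 ^ M / 2 ^ n := by positivity
  choose e he using fun i => exists_third_shift n hℓ (x i)
  refine ⟨e, fun y hy => funext fun i => ?_⟩
  have h := he i (y i) (hy i)
  have h2 : (2 : ℝ) ^ n * (2 ^ M / 2 ^ n) / 3 = 2 ^ M / 3 := by field_simp
  rw [h2] at h
  exact h

theorem enorm_bilinConv_le_localMax {μ : Measure (Rd d × Rd d)} (𝒟 : Grid d) {δ s : ℝ} {n : ℕ}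
    {x : Rd d} (hs : s ∈ Icc (δ * 𝒟.side n) (2 * (δ * 𝒟.side n)))
    (hx : ∀ᵐ w ∂μ, 𝒟.index n (x - s • w.1) = 𝒟.index n x ∧ 𝒟.index n (x - s • w.2) = 𝒟.index n x)
    (f g : Rd d → ℂ) : ‖bilinConv μ s f g x‖ₑ ≤ 𝒟.localMax μ δ f g n x := by
  have h : bilinConv μ s f g x = bilinConv μ s ((𝒟.cell n (𝒟.index n x)).indicator f)
      ((𝒟.cell n (𝒟.index n x)).indicator g) x := by
    refine integral_congr_ae ?_
    filter_upwards [hx] with w hw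
    rw [indicator_of_mem (𝒟.mem_cell.2 hw.1), indicator_of_mem (𝒟.mem_cell.2 hw.2)]
  rw [h]
  exact le_biSup (fun s => ‖bilinConv μ s ((𝒟.cell n (𝒟.index n x)).indicator f)
    ((𝒟.cell n (𝒟.index n x)).indicator g) x‖ₑ) hs

theorem exists_scale {δ s : ℝ} (hδ : 0 < δ) {J : ℕ} (hs : s ∈ Icc (δ / 2 ^ J) (δ * 2 ^ J)) :
    ∃ n < 2 * J + 2, s ∈ Icc (δ * (2 ^ J / 2 ^ n)) (2 * (δ * (2 ^ J / 2 ^ n))) := by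
  have hs0 : 0 < s := lt_of_lt_of_le (by positivity) hs.1
  have h1 : 1 ≤ δ * 2 ^ J / s := (one_le_div hs0).2 hs.2
  obtain ⟨n, hn1, hn2⟩ := exists_nat_pow_near h1 one_lt_two
  rw [le_div_iff₀ hs0] at hn1
  rw [div_lt_iff₀ hs0] at hn2
  have hn : n ≤ 2 * J := by
    have h3 : (2 : ℝ) ^ n * (δ / 2 ^ J) ≤ δ * 2 ^ J :=
      (mul_le_mul_of_nonneg_left hs.1 (by positivity)).trans hn1
    rw [mul_div_assoc', div_le_iff₀ (by positivity), mul_comm, mul_assoc,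
      mul_le_mul_iff_right₀ hδ, ← pow_add] at h3
    have := (pow_le_pow_iff_right₀ (one_lt_two : (1 : ℝ) < 2)).1 h3
    omega
  -- Here 2^n ≤ δ 2^J / s < 2^(n+1), so s lies between δ times the side at generation n + 1 and
  -- twice that.
  refine ⟨n + 1, by omega, ?_, ?_⟩
  · rw [mul_div_assoc', div_le_iff₀ (by positivity), mul_comm s]
    exact hn2.le
  · rw [pow_succ, show 2 * (δ * ((2 : ℝ) ^ J / (2 ^ n * 2))) = δ * 2 ^ J / 2 ^ n by field_simp,
      le_div_iff₀ (by positivity), mul_comm]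
    exact hn1

/-- At a scale s at most 2δ times the side, the points `x - s y` and `x - s z` are within 2δR < 1/6
of a side of x in each coordinate; some shifted grid puts them in the cube of x, and the sum over
all grids bounds its contribution. -/
theorem biSup_enorm_bilinConv_le_sum {μ : Measure (Rd d × Rd d)} {R δ : ℝ}
    (hR : ∀ᵐ w ∂μ, ‖w.1‖ ≤ R ∧ ‖w.2‖ ≤ R) (hδ : 0 < δ) (hδR : 2 * δ * R < 1 / 6) (J : ℕ)
    (f g : Rd d → ℂ) (x : Rd d) :
    ⨆ s ∈ Icc (δ / 2 ^ J) (δ * 2 ^ J), ‖bilinConv μ s f g x‖ₑ ≤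
      ∑ e : Fin d → Bool, ⨆ n ∈ Ico 0 (2 * J + 2), (shifted J e).localMax μ δ f g n x := by
  refine iSup₂_le fun s hs => ?_
  obtain ⟨n, hn, hsn⟩ := exists_scale hδ hs
  obtain ⟨e, he⟩ := exists_shifted_index_eq J n x
  have hℓ : (0 : ℝ) < 2 ^ J / 2 ^ n := by positivity
  have hs0 : 0 < s := lt_of_lt_of_le (by positivity) hsn.1
  have hnear : ∀ v : Rd d, ‖v‖ ≤ R → (shifted J e).index n (x - s • v) =
      (shifted J e).index n x := by
    intro v hv
    refine he _ fun i => ?_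
    have h1 : |(x - s • v) i - x i| = s * |v i| := by
      simp [abs_mul, abs_of_pos hs0]
    have h2 : |v i| ≤ R := (PiLp.norm_apply_le v i).trans hv
    rw [h1]
    calc s * |v i| ≤ 2 * (δ * (2 ^ J / 2 ^ n)) * R :=
          mul_le_mul hsn.2 h2 (abs_nonneg _) (by positivity)
      _ = 2 * δ * R * (2 ^ J / 2 ^ n) := by ring
      _ < 1 / 6 * (2 ^ J / 2 ^ n) := mul_lt_mul_of_pos_right hδR hℓ
      _ = _ := by ring
  have h3 : ‖bilinConv μ s f g x‖ₑ ≤ (shifted J e).localMax μ δ f g n x := by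
    refine enorm_bilinConv_le_localMax _ hsn ?_ f g
    filter_upwards [hR] with w hw
    exact ⟨hnear _ hw.1, hnear _ hw.2⟩
  refine (h3.trans (le_biSup (fun n => (shifted J e).localMax μ δ f g n x)
    (show n ∈ Ico 0 (2 * J + 2) from ⟨n.zero_le, hn⟩))).trans ?_
  exact Finset.single_le_sum
    (f := fun e => ⨆ n ∈ Ico 0 (2 * J + 2), (shifted J e).localMax μ δ f g n x)
    (fun _ _ => zero_le) (Finset.mem_univ e)

theorem lintegral_biSup_bilinConv_le {μ : Measure (Rd d × Rd d)} [IsFiniteMeasure μ]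
    {p q r R δ : ℝ} (hp : 1 < p) (hq : 1 < q) (hr : 1 < r) {C : ℝ≥0}
    (hC : StoppedBound μ p q r δ C) {γ : ℝ} (hγ0 : 0 < γ) (hγ1 : γ < 1)
    (hR : ∀ᵐ w ∂μ, ‖w.1‖ ≤ R ∧ ‖w.2‖ ≤ R) (hδ : 0 < δ) (hδR : 2 * δ * R < 1 / 6) (J : ℕ)
    {f g h : Rd d → ℂ} (hf : IsNice f) (hg : IsNice g)
    (hh : AEMeasurable (fun x => ‖h x‖ₑ) volume) :
    ∫⁻ x, (⨆ s ∈ Icc (δ / 2 ^ J) (δ * 2 ^ J), ‖bilinConv μ s f g x‖ₑ) * ‖h x‖ₑ ≤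
      2 ^ d * (C * ENNReal.ofReal (2 / (1 - γ)) ^ 2) *
        ⨆ (S : Set (Cube d)) (_ : IsSparse γ S), sparseForm S p q (r / (r - 1)) f g h := by
  calc _ ≤ ∫⁻ x, ∑ e : Fin d → Bool,
        (⨆ n ∈ Ico 0 (2 * J + 2), (shifted J e).localMax μ δ f g n x) * ‖h x‖ₑ := by
        refine lintegral_mono fun x => ?_
        rw [← Finset.sum_mul]
        exact mul_le_mul_left (biSup_enorm_bilinConv_le_sum hR hδ hδR J f g x) _
    _ = ∑ e : Fin d → Bool, ∫⁻ x,
        (⨆ n ∈ Ico 0 (2 * J + 2), (shifted J e).localMax μ δ f g n x) * ‖h x‖ₑ :=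
        lintegral_finsetSum' _ fun e _ => (AEMeasurable.biSup _ (to_countable _) fun n _ =>
          aemeasurable_localMax μ δ hf hg n).mul hh
    _ ≤ ∑ _e : Fin d → Bool, C * ENNReal.ofReal (2 / (1 - γ)) ^ 2 *
        ⨆ (S : Set (Cube d)) (_ : IsSparse γ S), sparseForm S p q (r / (r - 1)) f g h :=
        Finset.sum_le_sum fun e _ => lintegral_biSup_localMax_le hp hq hr hC hγ0 hγ1 _ _ hf hg hh
    _ = _ := by
        rw [Finset.sum_const, nsmul_eq_mul, ← mul_assoc]
        simp

end Grid

/-! ### Passage to all scales and to general functions -/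

/-- One parameter J governs both the truncation and the window of scales. Positive averages grow
with the truncation, so J can always be enlarged until the window contains a given t. -/
theorem fullMax_le_iSup (μ : Measure (Rd d × Rd d)) [IsFiniteMeasure μ] {δ : ℝ} (hδ : 0 < δ)
    {f g : Rd d → ℂ} (hf : Measurable f) (hg : Measurable g) (x : Rd d) :
    fullMax μ f g x ≤ ⨆ J : ℕ, ⨆ s ∈ Icc (δ / 2 ^ J) (δ * 2 ^ J),
      ‖bilinConv μ s (trunc J f) (trunc J g) x‖ₑ := by
  refine iSup₂_le fun t (ht : 0 < t) => (enorm_bilinConv_le μ t f g x).trans ?_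
  rw [← iSup_posConv_trunc μ hf hg]
  refine iSup_le fun J => ?_
  obtain ⟨K₁, hK₁⟩ := pow_unbounded_of_one_lt (δ / t) (one_lt_two : (1 : ℝ) < 2)
  obtain ⟨K₂, hK₂⟩ := pow_unbounded_of_one_lt (t / δ) (one_lt_two : (1 : ℝ) < 2)
  set K := max J (max K₁ K₂)
  have hJK : J ≤ K := le_max_left _ _
  have hpow : ∀ {k : ℕ}, k ≤ K → (2 : ℝ) ^ k ≤ 2 ^ K := fun h =>
    pow_le_pow_right₀ one_le_two h
  have h1 := hK₁.le.trans (hpow (k := K₁) (by simp [K]))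
  have h2 := hK₂.le.trans (hpow (k := K₂) (by simp [K]))
  have htK : t ∈ Icc (δ / 2 ^ K) (δ * 2 ^ K) := by
    refine ⟨?_, ?_⟩
    · rw [div_le_iff₀ (by positivity)]
      rwa [div_le_iff₀ ht, mul_comm] at h1
    · rwa [div_le_iff₀ hδ, mul_comm] at h2
  refine (posConv_mono μ (monotone_enorm_trunc f hJK)
    (monotone_enorm_trunc g hJK) t x).trans ?_
  rw [← enorm_bilinConv_of_nonneg μ (isNice_trunc _ hf) (isNice_trunc _ hg) (trunc_eq_norm _ f)
    (trunc_eq_norm _ g)]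
  exact le_iSup_of_le K (le_iSup₂_of_le t htK le_rfl)

/-- The bound for windows and truncations has a constant independent of J, and the truncated maximal
functions increase in J, so monotone convergence applies. -/
theorem lintegral_fullMax_le {μ : Measure (Rd d × Rd d)} [IsFiniteMeasure μ]
    {p q r R δ : ℝ} (hp : 1 < p) (hq : 1 < q) (hr : 1 < r) {C : ℝ≥0}
    (hC : Grid.StoppedBound μ p q r δ C) {γ : ℝ} (hγ0 : 0 < γ) (hγ1 : γ < 1)
    (hR : ∀ᵐ w ∂μ, ‖w.1‖ ≤ R ∧ ‖w.2‖ ≤ R) (hδ : 0 < δ) (hδR : 2 * δ * R < 1 / 6)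
    {f g h : Rd d → ℂ} (hf : Measurable f) (hg : Measurable g)
    (hh : AEMeasurable (fun x => ‖h x‖ₑ) volume) :
    ∫⁻ x, fullMax μ f g x * ‖h x‖ₑ ≤
      2 ^ d * (C * ENNReal.ofReal (2 / (1 - γ)) ^ 2) *
        ⨆ (S : Set (Cube d)) (_ : IsSparse γ S), sparseForm S p q (r / (r - 1)) f g h := by
  set Φ : ℕ → Rd d → ℝ≥0∞ := fun J x => ⨆ s ∈ Icc (δ / 2 ^ J) (δ * 2 ^ J),
    ‖bilinConv μ s (trunc J f) (trunc J g) x‖ₑ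
  have hΦ : ∀ J, Φ J = fun x => ⨆ s ∈ Icc (δ / 2 ^ J) (δ * 2 ^ J),
      posConv μ s (fun x => ‖trunc J f x‖ₑ) (fun x => ‖trunc J g x‖ₑ) x := fun J => by
    ext x
    exact iSup_congr fun s => iSup_congr fun _ => enorm_bilinConv_of_nonneg μ (isNice_trunc J hf)
      (isNice_trunc J hg) (trunc_eq_norm J f) (trunc_eq_norm J g) s x
  have hmono : Monotone Φ := by
    intro J K hJK x
    rw [hΦ, hΦ]
    have hpow : (2 : ℝ) ^ J ≤ 2 ^ K := pow_le_pow_right₀ one_le_two hJK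
    refine (biSup_mono (Icc_subset_Icc (by gcongr) (by gcongr))).trans (iSup₂_mono fun s _ => ?_)
    exact posConv_mono μ (monotone_enorm_trunc f hJK) (monotone_enorm_trunc g hJK) s x
  have hmeas : ∀ J, AEMeasurable (Φ J) volume := fun J => by
    rw [hΦ]
    exact aemeasurable_biSup_posConv μ (isNice_trunc J hf).measurable.enorm
      (isNice_trunc J hg).measurable.enorm measurableSet_Icc
  calc ∫⁻ x, fullMax μ f g x * ‖h x‖ₑ ≤ ∫⁻ x, ⨆ J, Φ J x * ‖h x‖ₑ := by
        refine lintegral_mono fun x => ?_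
        rw [← ENNReal.iSup_mul]
        exact mul_le_mul_left (fullMax_le_iSup μ hδ hf hg x) _
    _ = ⨆ J, ∫⁻ x, Φ J x * ‖h x‖ₑ := lintegral_iSup' (fun J => (hmeas J).mul hh)
        (ae_of_all _ fun x J K hJK => mul_le_mul_left (hmono hJK x) _)
    _ ≤ _ := iSup_le fun J => by
        refine (Grid.lintegral_biSup_bilinConv_le hp hq hr hC hγ0 hγ1 hR hδ hδR J
          (isNice_trunc J hf) (isNice_trunc J hg) hh).trans ?_
        refine mul_le_mul_right (iSup₂_mono fun S _ => ?_) _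
        exact sparseForm_mono S (one_pos.trans hp) (one_pos.trans hq) _ h
          (ae_of_all _ (enorm_trunc_le J f)) (ae_of_all _ (enorm_trunc_le J g))

/-! ### Exponents, support radius and the final assembly -/

/-- Moving an interior point slightly up and down in the first two coordinates must respect the
closed range [0,1]. This makes p and q finite and greater than 1. -/
theorem mem_Ioo_of_mem_interior {μ : Measure (Rd d × Rd d)} {a b c : ℝ}
    (h : (a, b, c) ∈ interior (boundednessSet μ)) : a ∈ Ioo (0 : ℝ) 1 ∧ b ∈ Ioo (0 : ℝ) 1 := by
  have hset : ∀ v ∈ boundednessSet μ, v.1 ∈ Icc (0 : ℝ) 1 ∧ v.2.1 ∈ Icc (0 : ℝ) 1 := by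
    have hinv : ∀ {p : ℝ≥0∞}, 1 ≤ p → (p⁻¹).toReal ∈ Icc (0 : ℝ) 1 := fun hp =>
      ⟨ENNReal.toReal_nonneg, ENNReal.toReal_le_of_le_ofReal one_pos.le (by simpa using hp)⟩
    rintro _ ⟨p, q, r, hp, hq, -, -, rfl⟩
    exact ⟨hinv hp, hinv hq⟩
  obtain ⟨ε, hε, hball⟩ := Metric.mem_nhds_iff.1 (mem_interior_iff_mem_nhds.1 h)
  have hmem : ∀ t : ℝ, |t| < ε → (a + t, b + t, c) ∈ boundednessSet μ := fun t ht => hball (by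
    simp [Prod.dist_eq, ht])
  have h1 := hset _ (hmem (ε / 2) (by rw [abs_of_pos (by positivity)]; linarith))
  have h2 := hset _ (hmem (-(ε / 2)) (by rw [abs_neg, abs_of_pos (by positivity)]; linarith))
  simp only [mem_Icc] at h1 h2
  exact ⟨⟨by linarith, by linarith⟩, by linarith, by linarith⟩

theorem singleScaleBounded_of_mem {μ : Measure (Rd d × Rd d)} {p q r : ℝ} (hp : 0 < p)
    (hq : 0 < q) (hr : 0 < r) (h : (1 / p, 1 / q, 1 / r) ∈ boundednessSet μ) :
    SingleScaleBounded μ (ENNReal.ofReal p) (ENNReal.ofReal q) (ENNReal.ofReal r) := by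
  have key : ∀ {p : ℝ} {p' : ℝ≥0∞}, 0 < p → 1 / p = (p'⁻¹).toReal → ENNReal.ofReal p = p' := by
    intro p p' hp h
    rw [ENNReal.toReal_inv, one_div, inv_inj] at h
    -- The default `toReal` of ∞ is 0, which p > 0 excludes.
    have : p' ≠ ∞ := by
      rintro rfl
      simp at h
      linarith
    rw [h, ENNReal.ofReal_toReal this]
  obtain ⟨p', q', r', -, -, -, hb, heq⟩ := h
  simp only [Prod.mk.injEq] at heq
  rwa [key hp heq.1, key hq heq.2.1, key hr heq.2.2]

theorem exists_ae_norm_le {μ : Measure (Rd d × Rd d)}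
    (hμ : ∃ K : Set (Rd d × Rd d), IsCompact K ∧ μ Kᶜ = 0) :
    ∃ R : ℝ, 0 < R ∧ ∀ᵐ w ∂μ, ‖w.1‖ ≤ R ∧ ‖w.2‖ ≤ R := by
  obtain ⟨K, hK, hμK⟩ := hμ
  obtain ⟨R, hR, hKR⟩ := hK.isBounded.exists_pos_norm_le
  refine ⟨R, hR, ?_⟩
  filter_upwards [mem_ae_iff.2 hμK] with w hw
  exact ⟨(norm_fst_le w).trans (hKR w hw), (norm_snd_le w).trans (hKR w hw)⟩

theorem exists_stoppedBound_of_continuityEstimate (hd : 1 ≤ d) {μ : Measure (Rd d × Rd d)}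
    [IsFiniteMeasure μ] {p q r R δ : ℝ} (hp : 1 < p) (hq : 1 < q) (hpr : p ≤ r) (hqr : q ≤ r)
    (hR0 : 0 ≤ R) (hR : ∀ᵐ w ∂μ, ‖w.1‖ ≤ R ∧ ‖w.2‖ ≤ R) (hδ : 0 < δ)
    (hcont : ContinuityEstimate μ p q r) : ∃ C : ℝ≥0, Grid.StoppedBound μ p q r δ C := by
  have hr : 1 < r := hp.trans_le hpr
  have hR' : ∀ᵐ w ∂(μ.map Prod.swap), ‖w.1‖ ≤ R ∧ ‖w.2‖ ≤ R := by
    rw [(MeasurableEquiv.prodComm (α := Rd d) (β := Rd d)).measurableEmbedding.ae_map_iff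
      (f := Prod.swap)]
    exact hR.mono fun w hw => hw.symm
  obtain ⟨η₁, hη₁, h₁⟩ := hcont.exists_oneSided hd hR hR0
  obtain ⟨η₂, hη₂, h₂⟩ := hcont.swap.exists_oneSided hd hR' hR0
  obtain ⟨C₁, θ₁, hθ₁, hd₁⟩ := (h₁ (d / δ) (by positivity)).exists_localDecay hr hη₁ hδ
  obtain ⟨C₂, θ₂, hθ₂, hd₂⟩ := (h₂ (d / δ) (by positivity)).exists_localDecay hr hη₂ hδ
  exact Grid.exists_stoppedBound hp hq hpr hqr hd₁ hd₂ hθ₁ hθ₂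

end BilinearSparse

theorem theorem3 (d : ℕ) (hd : 1 ≤ d) (μ : Measure (Rd d × Rd d)) [IsFiniteMeasure μ]
    (hμ : ∃ K : Set (Rd d × Rd d), IsCompact K ∧ μ Kᶜ = 0)
    (hB : (interior (BilinearSparse.boundednessSet μ)).Nonempty)
    (hcont : ∀ p q r : ℝ, (1 / p, 1 / q, 1 / r) ∈ interior (BilinearSparse.boundednessSet μ) →
      BilinearSparse.ContinuityEstimate μ p q r)
    (hlin : ∃ p q r : ℝ, 1 ≤ p ∧ 1 ≤ q ∧ 0 < r ∧
      BilinearSparse.LinearizedUniformlyBounded μ p q r)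
    (p q r : ℝ)
    (hpqr : (1 / p, 1 / q, 1 / r) ∈ interior (BilinearSparse.boundednessSet μ))
    (hpr : p ≤ r) (hqr : q ≤ r) (hr : 1 < r) :
    -- for `f ∈ L^p`, `g ∈ L^q` the full maximal function is defined a.e. and measurable
    (∀ f g : Rd d → ℂ,
      MemLp f (ENNReal.ofReal p) volume → MemLp g (ENNReal.ofReal q) volume →
        (∀ᵐ x, ∀ t : ℝ, 0 < t →
          Integrable (fun w : Rd d × Rd d => f (x - t • w.1) * g (x - t • w.2)) μ) ∧
        AEMeasurable (BilinearSparse.fullMax μ f g) volume) ∧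
    -- the sparse bound
    ∀ γ : ℝ, 0 < γ → γ < 1 → ∃ C : ℝ≥0, ∀ f g h : Rd d → ℂ,
      MemLp f (ENNReal.ofReal p) volume → MemLp g (ENNReal.ofReal q) volume →
      LocallyIntegrable h volume →
        ∫⁻ x, BilinearSparse.fullMax μ f g x * ‖h x‖ₑ ≤
          C * ⨆ (S : Set (BilinearSparse.Cube d)) (_ : BilinearSparse.IsSparse γ S),
            BilinearSparse.sparseForm S p q (r / (r - 1)) f g h := by
  open BilinearSparse in
  have hr0 : 0 < r := one_pos.trans hr
  have one_lt : ∀ {s : ℝ}, 1 / s ∈ Ioo (0 : ℝ) 1 → 1 < s := fun hs =>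
    (div_lt_one (one_div_pos.1 hs.1)).1 hs.2
  obtain ⟨hp, hq⟩ := mem_Ioo_of_mem_interior hpqr
  replace hp := one_lt hp
  replace hq := one_lt hq
  have hb := singleScaleBounded_of_mem (one_pos.trans hp) (one_pos.trans hq) hr0
    (interior_subset hpqr)
  refine ⟨fun f g hf hg => ⟨ae_forall_integrable hr0 hb hf hg, aemeasurable_fullMax hr0 hb hf hg⟩,
    fun γ hγ0 hγ1 => ?_⟩
  obtain ⟨R, hR0, hR⟩ := exists_ae_norm_le hμ
  -- The choice 13 gives 2δR = 2/13 < 1/6, as the one-third trick requires.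
  have hδ : 0 < 1 / (13 * R) := by positivity
  have hδR : 2 * (1 / (13 * R)) * R < 1 / 6 := by
    field_simp
    norm_num
  obtain ⟨C, hC⟩ := exists_stoppedBound_of_continuityEstimate hd hp hq hpr hqr hR0.le hR hδ
    (hcont p q r hpqr)
  refine ⟨2 ^ d * (C * (2 / (1 - γ)).toNNReal ^ 2), fun f g h hf hg hh => ?_⟩
  have hf' := hf.1.aemeasurable
  have hg' := hg.1.aemeasurable
  -- Borel representatives may be used, since changing f and g on null sets changes the maximal
  -- function only on a null set.
  have h1 : ∫⁻ x, fullMax μ f g x * ‖h x‖ₑ =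
      ∫⁻ x, fullMax μ (hf'.mk f) (hg'.mk g) x * ‖h x‖ₑ := lintegral_congr_ae (by
    filter_upwards [fullMax_ae_eq hr0 hb hf'.ae_eq_mk hg'.ae_eq_mk] with x hx
    rw [hx])
  rw [h1]
  refine (lintegral_fullMax_le hp hq hr hC hγ0 hγ1 hR hδ hδR hf'.measurable_mk hg'.measurable_mk
    hh.aestronglyMeasurable.enorm).trans ?_
  push_cast
  refine mul_le_mul_right (iSup₂_mono fun S _ => ?_) _
  refine sparseForm_mono S (one_pos.trans hp) (one_pos.trans hq) _ h ?_ ?_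
  · filter_upwards [hf'.ae_eq_mk] with x hx
    rw [hx]
  · filter_upwards [hg'.ae_eq_mk] with x hx
    rw [hx]
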